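/- Let $n\ge 0$ and let $A_n$ be the $n$-th Weyl algebra: the associative unital $\mathbb{C}$-algebra generated by $a_1,\dots,a_n,a_1^\dagger,\dots,a_n^\dagger$ with relations $[a_i,a_j^\dagger]=\delta_{ij}$, $[a_i,a_j]=[a_i^\dagger,a_j^\dagger]=0$. Let $\dagger$ be the conjugate-linear involutive anti-automorphism of $A_n$ exchanging $a_k$ and $a_k^\dagger$. The skew-hermitian Weyl algebra is the real Lie algebra $\hat A_n=\{g\in A_n : g^\dagger=-g\}$ with the commutator as bracket. For $\gamma=(\alpha,\beta)\in\mathbb{N}^{n}\times\mathbb{N}^n$ put $|\gamma|=\sum_k(\alpha_k+\beta_k)$, $a^{(\alpha,\beta)}=(a_1^\dagger)^{\alpha_1}\cdots(a_n^\dagger)^{\alpha_n}a_1^{\beta_1}\cdots a_n^{\beta_n}$, and $$g_+^{(\alpha,\beta)}=i\bigl(a^{(\beta,\alpha)}+a^{(\alpha,\beta)}\bigr),\qquad g_-^{(\alpha,\beta)}=a^{(\beta,\alpha)}-a^{(\alpha,\beta)} .$$ The monomials $a^\gamma$ form a $\mathbb{C}$-basis of $A_n$; up to sign and zero, the elements $g_\sigma^\gamma$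 form a real basis of $\hat A_n$. Define real subspaces of $\hat A_n$ as the real spans of all $g_\sigma^{\gamma}$, $\sigma\in\{+,-\}$, $\gamma=(\alpha,\beta)$, such that - $\hat A_n^0$: $\alpha=\beta$ and $|\gamma|\in\{0,2\}$; - $\hat A_n^1$: $|\gamma|=1$; - $\hat A_n^2$: $|\gamma|=2$ and $\alpha\ne\beta$; - $\hat A_n^=$: $\alpha=\beta$ and $|\gamma|\ge4$; - $\hat A_n^{\mathrm{om}}$: $|\gamma|\ge 3$ and there is an index $k$ with $\alpha_k+\beta_k=1$ and $\alpha_j=\beta_j$ for all $j\ne k$. Let $\hat A_n^{\mathrm{core}}$ be the sum of these five subspaces, and let $\hat A_n^\perp$ be its orthogonal complement in $\hat A_n$ with respect to the scalar product $\langle x,y\rangle=\mathrm{Re}\sum_\gamma \overline{x_\gamma}\,y_\gamma$, where $x=\sum_\gamma x_\gamma a^\gamma$ and $y=\sum_\gamma y_\gamma a^\gamma$ (for this scalar product distinct basis elements $g_\sigma^\gamma$ are orthogonal). Then $\hat A_n=\hat A_n^{\mathrm{core}}\oplus\hat A_n^\perp$. **Theorem.** Let $(\sigma_p,\gamma_p)_{p\in\mathcal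 R}$ be a finite family in $\{+,-\}\times\mathbb{N}^{2n}$ with $g_{\sigma_p}^{\gamma_p}\notin\hat A_n^1$ for all $p$ (in particular $g_{\sigma_p}^{\gamma_p}\neq0$). Let $$\mathcal G=\{\,i a_k^\dagger a_k : 1\le k\le n\,\}\cup\{\,g_{\sigma_p}^{\gamma_p} : p\in\mathcal R\,\},\qquad \mathcal G^K=\mathcal G\cap\hat A_n^K\quad(K\in\{2,=,\mathrm{om},\perp\}),$$ and let $\mathfrak g$ be the real Lie subalgebra of $\hat A_n$ generated by $\mathcal G$. Then $\mathfrak g$ is finite-dimensional if and only if all of the following hold: (i) $\mathcal G^\perp=\emptyset$; (ii) every element of $\mathcal G^=$ commutes with every element of $\mathcal G$; (iii) $[x,y]\in\hat A_n^{\mathrm{om}}$ for all $x\in\mathcal G^2$ and $y\in\mathcal G^{\mathrm{om}}$; (iv) for all $x,y\in\mathcal G^{\mathrm{om}}$ the projection of $[x,y]$ onto $\hat A_n^\perp$ (along $\hat A_n^{\mathrm{core}}$) is zero. -/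

import Mathlib

namespace BosonicLie

noncomputable section

/-! ### The Weyl algebra -/

/-- The canonical commutation relations. The free generator `Sum.inl k` stands for the creation
operator `a_k†` and `Sum.inr k` for the annihilation operator `a_k`. -/
inductive CCR (n : ℕ) :
    FreeAlgebra ℂ (Fin n ⊕ Fin n) → FreeAlgebra ℂ (Fin n ⊕ Fin n) → Prop
  | cre_cre (i j : Fin n) :
      CCR n (FreeAlgebra.ι ℂ (Sum.inl i) * FreeAlgebra.ι ℂ (Sum.inl j))
        (FreeAlgebra.ι ℂ (Sum.inl j) * FreeAlgebra.ι ℂ (Sum.inl i))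
  | ann_ann (i j : Fin n) :
      CCR n (FreeAlgebra.ι ℂ (Sum.inr i) * FreeAlgebra.ι ℂ (Sum.inr j))
        (FreeAlgebra.ι ℂ (Sum.inr j) * FreeAlgebra.ι ℂ (Sum.inr i))
  | ann_cre (i j : Fin n) :
      CCR n (FreeAlgebra.ι ℂ (Sum.inr i) * FreeAlgebra.ι ℂ (Sum.inl j))
        (FreeAlgebra.ι ℂ (Sum.inl j) * FreeAlgebra.ι ℂ (Sum.inr i) + if i = j then 1 else 0)

/-- The `n`-th Weyl algebra over `ℂ`, presented by creation and annihilation operators subject to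
the canonical commutation relations. -/
def Weyl (n : ℕ) : Type := RingQuot (CCR n)

instance (n : ℕ) : Ring (Weyl n) := inferInstanceAs (Ring (RingQuot (CCR n)))

instance (n : ℕ) : Algebra ℂ (Weyl n) := inferInstanceAs (Algebra ℂ (RingQuot (CCR n)))

/-- The Lie bracket on the Weyl algebra is the commutator. -/
instance (n : ℕ) : LieRing (Weyl n) := LieRing.ofAssociativeRing

instance (n : ℕ) : LieAlgebra ℝ (Weyl n) := LieAlgebra.ofAssociativeAlgebra

variable {n : ℕ}

/-- The quotient map from the free algebra. -/
def toWeyl (n : ℕ) : FreeAlgebra ℂ (Fin n ⊕ Fin n) →ₐ[ℂ] Weyl n := RingQuot.mkAlgHom ℂ (CCR n)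

/-- The creation operator `a_k†`. -/
def cre (k : Fin n) : Weyl n := toWeyl n (FreeAlgebra.ι ℂ (Sum.inl k))

/-- The annihilation operator `a_k`. -/
def ann (k : Fin n) : Weyl n := toWeyl n (FreeAlgebra.ι ℂ (Sum.inr k))

theorem cre_comm (i j : Fin n) : (cre i * cre j : Weyl n) = cre j * cre i := by
  have h := RingQuot.mkAlgHom_rel ℂ (CCR.cre_cre i j)
  rw [map_mul, map_mul] at h
  exact h

theorem ann_comm (i j : Fin n) : (ann i * ann j : Weyl n) = ann j * ann i := by
  have h := RingQuot.mkAlgHom_rel ℂ (CCR.ann_ann i j)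
  rw [map_mul, map_mul] at h
  exact h

theorem ann_mul_cre (i j : Fin n) :
    (ann i * cre j : Weyl n) = cre j * ann i + if i = j then 1 else 0 := by
  have h := RingQuot.mkAlgHom_rel ℂ (CCR.ann_cre i j)
  rw [map_mul, map_add, map_mul] at h
  refine h.trans ?_
  congr 1
  split_ifs
  · exact map_one _
  · exact map_zero _

/-- The universal property of the Weyl algebra. -/
def weylLift {B : Type*} [Ring B] [Algebra ℂ B] (c d : Fin n → B)
    (hcc : ∀ i j, c i * c j = c j * c i) (hdd : ∀ i j, d i * d j = d j * d i)
    (hdc : ∀ i j, d i * c j = c j * d i + if i = j then 1 else 0) : Weyl n →ₐ[ℂ] B :=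
  RingQuot.liftAlgHom ℂ ⟨FreeAlgebra.lift ℂ (Sum.elim c d), by
    intro x y h
    cases h with
    | cre_cre i j => simpa using hcc i j
    | ann_ann i j => simpa using hdd i j
    | ann_cre i j =>
      have := hdc i j
      split_ifs at this ⊢ <;> simpa using this⟩

section lift

variable {B : Type*} [Ring B] [Algebra ℂ B] (c d : Fin n → B)
    (hcc : ∀ i j, c i * c j = c j * c i) (hdd : ∀ i j, d i * d j = d j * d i)
    (hdc : ∀ i j, d i * c j = c j * d i + if i = j then 1 else 0)

theorem weylLift_cre (k : Fin n) : weylLift c d hcc hdd hdc (cre k) = c k := by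
  refine (RingQuot.liftAlgHom_mkAlgHom_apply ℂ _ _ _).trans ?_
  simp

theorem weylLift_ann (k : Fin n) : weylLift c d hcc hdd hdc (ann k) = d k := by
  refine (RingQuot.liftAlgHom_mkAlgHom_apply ℂ _ _ _).trans ?_
  simp

end lift

/-- Ring homomorphisms out of the Weyl algebra that agree on scalars and generators agree. -/
theorem weyl_ringHom_ext {B : Type*} [Ring B] (f g : Weyl n →+* B)
    (hs : ∀ z : ℂ, f (algebraMap ℂ _ z) = g (algebraMap ℂ _ z))
    (hc : ∀ k, f (cre k) = g (cre k)) (hd : ∀ k, f (ann k) = g (ann k)) (x : Weyl n) :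
    f x = g x := by
  obtain ⟨y, rfl⟩ : ∃ y, toWeyl n y = x := RingQuot.mkAlgHom_surjective ℂ (CCR n) x
  induction y using FreeAlgebra.induction with
  | grade0 z => simpa using hs z
  | grade1 k =>
    cases k with
    | inl k => exact hc k
    | inr k => exact hd k
  | mul a b ha hb => rw [map_mul, map_mul, map_mul, ha, hb]
  | add a b ha hb => rw [map_add, map_add, map_add, ha, hb]

/-! ### The adjoint -/

/-- The opposite of the Weyl algebra with complex conjugate scalar multiplication; algebra
homomorphisms into it are the conjugate-linear anti-homomorphisms. -/
def ConjOp (n : ℕ) : Type := (Weyl n)ᵐᵒᵖ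

instance (n : ℕ) : Ring (ConjOp n) := inferInstanceAs (Ring (Weyl n)ᵐᵒᵖ)

instance (n : ℕ) : Algebra ℂ (ConjOp n) := Algebra.compHom (Weyl n)ᵐᵒᵖ (starRingEnd ℂ)

/-- The conjugate-linear anti-homomorphism with `a_k† ↦ a_k` and `a_k ↦ a_k†`. -/
def daggerHom (n : ℕ) : Weyl n →ₐ[ℂ] ConjOp n :=
  weylLift (fun k => (MulOpposite.op (ann k) : (Weyl n)ᵐᵒᵖ))
    (fun k => (MulOpposite.op (cre k) : (Weyl n)ᵐᵒᵖ))
    (fun i j => congrArg MulOpposite.op (ann_comm j i))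
    (fun i j => congrArg MulOpposite.op (cre_comm j i))
    (fun i j => by
      have h := congrArg MulOpposite.op (ann_mul_cre j i)
      refine Eq.trans h ?_
      by_cases hij : i = j
      · subst hij
        rw [if_pos rfl, if_pos rfl]
        rfl
      · rw [if_neg hij, if_neg (Ne.symm hij)]
        rfl)

/-- The adjoint `g ↦ g†`. -/
def dagger (x : Weyl n) : Weyl n := MulOpposite.unop (daggerHom n x : (Weyl n)ᵐᵒᵖ)

theorem dagger_add (x y : Weyl n) : dagger (x + y) = dagger x + dagger y :=
  congrArg MulOpposite.unop ((daggerHom n).map_add x y)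

theorem dagger_mul (x y : Weyl n) : dagger (x * y) = dagger y * dagger x :=
  congrArg MulOpposite.unop ((daggerHom n).map_mul x y)

theorem dagger_one : dagger (1 : Weyl n) = 1 :=
  congrArg MulOpposite.unop ((daggerHom n).map_one)

theorem dagger_algebraMap (z : ℂ) :
    dagger (algebraMap ℂ (Weyl n) z) = algebraMap ℂ (Weyl n) (starRingEnd ℂ z) :=
  congrArg MulOpposite.unop ((daggerHom n).commutes z)

theorem dagger_cre (k : Fin n) : dagger (cre k : Weyl n) = ann k :=
  congrArg MulOpposite.unop (weylLift_cre (B := ConjOp n) _ _ _ _ _ k)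

theorem dagger_ann (k : Fin n) : dagger (ann k : Weyl n) = cre k :=
  congrArg MulOpposite.unop (weylLift_ann (B := ConjOp n) _ _ _ _ _ k)

theorem dagger_dagger (x : Weyl n) : dagger (dagger x) = x := by
  let f : Weyl n →+* Weyl n :=
    { toFun := fun x => dagger (dagger x)
      map_one' := by rw [dagger_one, dagger_one]
      map_mul' := fun x y => by rw [dagger_mul, dagger_mul]
      map_zero' := by
        have h : dagger (0 : Weyl n) = 0 := by simpa using dagger_algebraMap (n := n) 0
        rw [h, h]
      map_add' := fun x y => by rw [dagger_add, dagger_add] }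
  refine weyl_ringHom_ext f (RingHom.id _) (fun z => ?_) (fun k => ?_) (fun k => ?_) x
  · change dagger (dagger _) = _
    rw [dagger_algebraMap, dagger_algebraMap]
    simp
  · change dagger (dagger _) = _
    rw [dagger_cre, dagger_ann]
    rfl
  · change dagger (dagger _) = _
    rw [dagger_ann, dagger_cre]
    rfl

instance : StarRing (Weyl n) where
  star := dagger
  star_involutive := dagger_dagger
  star_mul := dagger_mul
  star_add := dagger_add

theorem star_cre (k : Fin n) : star (cre k : Weyl n) = ann k := dagger_cre k

theorem star_ann (k : Fin n) : star (ann k : Weyl n) = cre k := dagger_ann k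

instance : StarModule ℂ (Weyl n) where
  star_smul z x := by
    rw [Algebra.smul_def, star_mul, Algebra.smul_def, Algebra.commutes]
    congr 1
    exact dagger_algebraMap z

/-! ### Normal-ordered monomials -/

/-- The ordered product `f_1 ^ α_1 ⋯ f_n ^ α_n`. -/
def powProd {A : Type*} [Monoid A] {n : ℕ} (f : Fin n → A) (α : Fin n → ℕ) : A :=
  (List.ofFn fun k => f k ^ α k).prod

/-- The normal-ordered monomial
`a^(α,β) = (a_1†)^α_1 ⋯ (a_n†)^α_n (a_1)^β_1 ⋯ (a_n)^β_n`. -/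
def mono (α β : Fin n → ℕ) : Weyl n := powProd cre α * powProd ann β

section powProd

variable {A : Type*} [Monoid A]

theorem powProd_zero {n : ℕ} (f : Fin n → A) : powProd f 0 = 1 := by
  simp [powProd, List.ofFn_const]

theorem powProd_succ {n : ℕ} (f : Fin (n + 1) → A) (α : Fin (n + 1) → ℕ) :
    powProd f α = f 0 ^ α 0 * powProd (fun k => f k.succ) (fun k => α k.succ) := by
  simp [powProd, List.ofFn_succ]

theorem commute_powProd {n : ℕ} (f : Fin n → A) (α : Fin n → ℕ) (x : A)
    (h : ∀ i, Commute x (f i)) : Commute x (powProd f α) := by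
  refine Commute.list_prod_right _ _ fun y hy => ?_
  obtain ⟨i, rfl⟩ := (List.mem_ofFn' _ _).1 hy
  exact (h i).pow_right _

theorem powProd_add {n : ℕ} (f : Fin n → A) (h : ∀ i j, Commute (f i) (f j))
    (α β : Fin n → ℕ) : powProd f (α + β) = powProd f α * powProd f β := by
  induction n with
  | zero => simp [powProd]
  | succ n ih =>
    rw [powProd_succ, powProd_succ f α, powProd_succ f β]
    have h1 := ih (fun k => f k.succ) (fun i j => h _ _) (fun k => α k.succ) (fun k => β k.succ)
    have h2 : (fun k => (α + β) (Fin.succ k)) = (fun k => α k.succ) + fun k => β k.succ := rfl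
    rw [h2, h1, Pi.add_apply, pow_add]
    have h3 : Commute (f 0 ^ β 0) (powProd (fun k => f k.succ) (fun k => α k.succ)) :=
      (commute_powProd _ _ _ fun i => h _ _).pow_left _
    simp only [mul_assoc]
    rw [← mul_assoc (f 0 ^ β 0), h3.eq, mul_assoc]

theorem powProd_single {n : ℕ} (f : Fin n → A) (k : Fin n) :
    powProd f (Pi.single k 1) = f k := by
  induction n with
  | zero => exact k.elim0
  | succ n ih =>
    rw [powProd_succ]
    refine Fin.cases ?_ (fun k => ?_) k
    · have : (fun j : Fin n => (Pi.single 0 1 : Fin (n + 1) → ℕ) j.succ) = 0 := by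
        ext j
        simp
      rw [this, powProd_zero]
      simp
    · have : (fun j : Fin n => (Pi.single k.succ 1 : Fin (n + 1) → ℕ) j.succ)
          = Pi.single k 1 := by
        ext j
        simp [Pi.single_apply]
      rw [this, ih]
      simp

theorem powProd_add_single {n : ℕ} (f : Fin n → A) (h : ∀ i j, Commute (f i) (f j))
    (α : Fin n → ℕ) (k : Fin n) : powProd f (α + Pi.single k 1) = f k * powProd f α := by
  rw [add_comm, powProd_add f h, powProd_single]

theorem map_powProd {B : Type*} [Monoid B] (φ : A →* B) {n : ℕ} (f : Fin n → A)
    (α : Fin n → ℕ) : φ (powProd f α) = powProd (fun k => φ (f k)) α := by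
  simp [powProd, map_list_prod, List.map_ofFn, Function.comp_def]

/-- Induction on multi-indices by adding unit vectors. -/
theorem multi_induction {n : ℕ} {P : (Fin n → ℕ) → Prop} (h0 : P 0)
    (h1 : ∀ α k, P α → P (α + Pi.single k 1)) (α : Fin n → ℕ) : P α := by
  obtain ⟨m, hm⟩ : ∃ m, ∑ i, α i = m := ⟨_, rfl⟩
  induction m generalizing α with
  | zero =>
    have : α = 0 := by
      ext i
      exact (Finset.sum_eq_zero_iff.1 hm) i (Finset.mem_univ i)
    exact this ▸ h0
  | succ m ih =>
    obtain ⟨k, hk⟩ : ∃ k, α k ≠ 0 := by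
      by_contra hcon
      push Not at hcon
      simp [hcon] at hm
    have hα : α = (α - Pi.single k 1) + Pi.single k 1 := by
      ext i
      by_cases hi : i = k
      · subst hi
        simp
        omega
      · simp [hi]
    have hs : ∑ i, α i = ∑ i, (α - Pi.single k 1 : Fin n → ℕ) i + 1 := by
      conv_lhs => rw [hα]
      simp [Finset.sum_add_distrib]
    rw [hα]
    exact h1 _ k (ih _ (by omega))

end powProd

theorem cre_commute (i j : Fin n) : Commute (cre i : Weyl n) (cre j) := cre_comm i j

theorem ann_commute (i j : Fin n) : Commute (ann i : Weyl n) (ann j) := ann_comm i j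

theorem mono_zero : (mono 0 0 : Weyl n) = 1 := by
  rw [mono, powProd_zero, powProd_zero, one_mul]

theorem star_powProd (f : Fin n → Weyl n) (h : ∀ i j, Commute (f i) (f j)) (α : Fin n → ℕ) :
    star (powProd f α) = powProd (fun k => star (f k)) α := by
  have h' : ∀ i j, Commute (star (f i)) (star (f j)) := fun i j => (h i j).star_star
  induction α using multi_induction with
  | h0 => simp [powProd_zero]
  | h1 α k ih =>
    rw [powProd_add_single f h, powProd_add_single _ h', star_mul, ih]
    exact (commute_powProd _ _ _ fun i => h' k i).eq.symm

theorem star_mono (α β : Fin n → ℕ) : star (mono α β : Weyl n) = mono β α := by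
  rw [mono, star_mul, star_powProd _ cre_commute, star_powProd _ ann_commute]
  simp only [star_cre, star_ann]
  rfl

theorem ann_powProd_cre (k : Fin n) (α : Fin n → ℕ) :
    (ann k * powProd cre α - powProd cre α * ann k : Weyl n) ∈
      Submodule.span ℂ (Set.range fun α : Fin n → ℕ => (powProd cre α : Weyl n)) := by
  induction α using multi_induction with
  | h0 => simp [powProd_zero]
  | h1 α j ih =>
    rw [powProd_add_single _ cre_commute]
    have h : (ann k * (cre j * powProd cre α) - cre j * powProd cre α * ann k : Weyl n) =
        cre j * (ann k * powProd cre α - powProd cre α * ann k) +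
          if k = j then powProd cre α else 0 := by
      rw [← mul_assoc, ann_mul_cre]
      split_ifs <;> noncomm_ring
    rw [h]
    refine Submodule.add_mem _ ?_ ?_
    · revert ih
      generalize (ann k * powProd cre α - powProd cre α * ann k : Weyl n) = x
      intro ih
      induction ih using Submodule.span_induction with
      | mem x hx =>
        obtain ⟨δ, rfl⟩ := hx
        refine Submodule.subset_span ⟨δ + Pi.single j 1, ?_⟩
        exact powProd_add_single _ cre_commute _ _
      | zero => simp
      | add x y _ _ hx hy =>
        rw [mul_add]
        exact Submodule.add_mem _ hx hy
      | smul z x _ hx =>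
        rw [mul_smul_comm]
        exact Submodule.smul_mem _ _ hx
    · split_ifs
      · exact Submodule.subset_span ⟨α, rfl⟩
      · exact Submodule.zero_mem _

/-- The family of normal-ordered monomials, indexed by `γ = (α, β)`. -/
def monoFamily (n : ℕ) (γ : (Fin n → ℕ) × (Fin n → ℕ)) : Weyl n := mono γ.1 γ.2

theorem cre_mul_mono (k : Fin n) (α β : Fin n → ℕ) :
    (cre k * mono α β : Weyl n) = mono (α + Pi.single k 1) β := by
  rw [mono, mono, powProd_add_single _ cre_commute, mul_assoc]

theorem mono_span : Submodule.span ℂ (Set.range (monoFamily n)) = ⊤ := by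
  rw [eq_top_iff]
  have hcre : ∀ k, ∀ x ∈ Submodule.span ℂ (Set.range (monoFamily n)),
      cre k * x ∈ Submodule.span ℂ (Set.range (monoFamily n)) := by
    intro k x hx
    induction hx using Submodule.span_induction with
    | mem x hx =>
      obtain ⟨γ, rfl⟩ := hx
      exact Submodule.subset_span ⟨(γ.1 + Pi.single k 1, γ.2), (cre_mul_mono k _ _).symm⟩
    | zero => simp
    | add x y _ _ hx hy =>
      rw [mul_add]
      exact Submodule.add_mem _ hx hy
    | smul z x _ hx =>
      rw [mul_smul_comm]
      exact Submodule.smul_mem _ _ hx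
  have hann : ∀ k, ∀ x ∈ Submodule.span ℂ (Set.range (monoFamily n)),
      ann k * x ∈ Submodule.span ℂ (Set.range (monoFamily n)) := by
    intro k x hx
    induction hx using Submodule.span_induction with
    | mem x hx =>
      obtain ⟨⟨α, β⟩, rfl⟩ := hx
      have h : (ann k * mono α β : Weyl n) = mono α (β + Pi.single k 1) +
          (ann k * powProd cre α - powProd cre α * ann k) * powProd ann β := by
        rw [mono, mono, powProd_add_single _ ann_commute]
        noncomm_ring
      change ann k * mono α β ∈ _
      rw [h]
      refine Submodule.add_mem _ (Submodule.subset_span ⟨(α, β + Pi.single k 1), rfl⟩) ?_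
      have h2 := ann_powProd_cre k α
      revert h2
      generalize (ann k * powProd cre α - powProd cre α * ann k : Weyl n) = x
      intro h2
      induction h2 using Submodule.span_induction with
      | mem x hx =>
        obtain ⟨δ, rfl⟩ := hx
        exact Submodule.subset_span ⟨(δ, β), rfl⟩
      | zero => simp
      | add x y _ _ hx hy =>
        rw [add_mul]
        exact Submodule.add_mem _ hx hy
      | smul z x _ hx =>
        rw [smul_mul_assoc]
        exact Submodule.smul_mem _ _ hx
    | zero => simp
    | add x y _ _ hx hy =>
      rw [mul_add]
      exact Submodule.add_mem _ hx hy
    | smul z x _ hx =>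
      rw [mul_smul_comm]
      exact Submodule.smul_mem _ _ hx
  have key : ∀ y : FreeAlgebra ℂ (Fin n ⊕ Fin n),
      ∀ x ∈ Submodule.span ℂ (Set.range (monoFamily n)),
      toWeyl n y * x ∈ Submodule.span ℂ (Set.range (monoFamily n)) := by
    intro y
    induction y using FreeAlgebra.induction with
    | grade0 z =>
      intro x hx
      rw [AlgHom.commutes, ← Algebra.smul_def]
      exact Submodule.smul_mem _ _ hx
    | grade1 k =>
      cases k with
      | inl k => exact hcre k
      | inr k => exact hann k
    | mul a b ha hb =>
      intro x hx
      rw [map_mul, mul_assoc]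
      exact ha _ (hb _ hx)
    | add a b ha hb =>
      intro x hx
      rw [map_add, add_mul]
      exact Submodule.add_mem _ (ha _ hx) (hb _ hx)
  intro x _
  obtain ⟨y, rfl⟩ : ∃ y, toWeyl n y = x := RingQuot.mkAlgHom_surjective ℂ (CCR n) x
  have := key y 1 (Submodule.subset_span ⟨(0, 0), mono_zero⟩)
  rwa [mul_one] at this

theorem pderiv_pderiv (i j : Fin n) (p : MvPolynomial (Fin n) ℂ) :
    MvPolynomial.pderiv i (MvPolynomial.pderiv j p) =
      MvPolynomial.pderiv j (MvPolynomial.pderiv i p) := by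
  let D (i : Fin n) : Derivation ℂ (MvPolynomial (Fin n) ℂ) (MvPolynomial (Fin n) ℂ) :=
    MvPolynomial.pderiv i
  have h : ⁅D i, D j⁆ = 0 := by
    refine MvPolynomial.derivation_ext fun k => ?_
    simp only [D, Derivation.commutator_apply, MvPolynomial.pderiv_X, Pi.single_apply]
    split_ifs <;> simp
  have h2 := DFunLike.congr_fun h p
  rw [Derivation.commutator_apply] at h2
  exact sub_eq_zero.1 h2

theorem pderiv_X_mul (i j : Fin n) (p : MvPolynomial (Fin n) ℂ) :
    MvPolynomial.pderiv i (MvPolynomial.X j * p) =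
      MvPolynomial.X j * MvPolynomial.pderiv i p + if i = j then p else 0 := by
  rw [MvPolynomial.pderiv_mul, MvPolynomial.pderiv_X]
  by_cases h : i = j
  · subst h
    simp [add_comm]
  · have h3 : j ≠ i := Ne.symm h
    simp [h, h3]

/-- The action on polynomials by `a_k† ↦ X_k` and `a_k ↦ ∂/∂X_k`. -/
def polyRep (n : ℕ) : Weyl n →ₐ[ℂ] Module.End ℂ (MvPolynomial (Fin n) ℂ) :=
  weylLift (fun k => LinearMap.mulLeft ℂ (MvPolynomial.X k))
    (fun k => (MvPolynomial.pderiv k).toLinearMap)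
    (fun i j => LinearMap.ext fun p => mul_left_comm _ _ _)
    (fun i j => LinearMap.ext fun p => pderiv_pderiv i j p)
    (fun i j => LinearMap.ext fun p => by
      refine (pderiv_X_mul i j p).trans ?_
      rw [LinearMap.add_apply]
      congr 1
      split_ifs <;> rfl)

/-- The monomial polynomial `X^δ`. -/
def polyMon (δ : Fin n → ℕ) : MvPolynomial (Fin n) ℂ :=
  MvPolynomial.monomial (Finsupp.equivFunOnFinite.symm δ) 1

theorem polyRep_cre (k : Fin n) (δ : Fin n → ℕ) :
    polyRep n (cre k) (polyMon δ) = polyMon (δ + Pi.single k 1) := by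
  rw [polyRep, weylLift_cre]
  change MvPolynomial.X k * polyMon δ = _
  rw [polyMon, polyMon, MvPolynomial.X, MvPolynomial.monomial_mul, one_mul]
  have h : Finsupp.single k 1 + Finsupp.equivFunOnFinite.symm δ =
      Finsupp.equivFunOnFinite.symm (δ + Pi.single k 1) := by
    ext i
    simp [Finsupp.single_apply, Pi.single_apply, add_comm, eq_comm]
  rw [h]

theorem polyRep_ann (k : Fin n) (δ : Fin n → ℕ) :
    polyRep n (ann k) (polyMon δ) = (δ k : ℂ) • polyMon (δ - Pi.single k 1) := by
  rw [polyRep, weylLift_ann]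
  change MvPolynomial.pderiv k (polyMon δ) = _
  rw [polyMon, polyMon, MvPolynomial.pderiv_monomial, MvPolynomial.smul_monomial]
  have h : Finsupp.equivFunOnFinite.symm δ - Finsupp.single k 1 =
      Finsupp.equivFunOnFinite.symm (δ - Pi.single k 1) := by
    ext i
    simp [Finsupp.single_apply, Pi.single_apply, eq_comm]
  rw [h]
  simp

theorem polyRep_powProd_cre (α δ : Fin n → ℕ) :
    polyRep n (powProd cre α) (polyMon δ) = polyMon (δ + α) := by
  induction α using multi_induction with
  | h0 => simp [powProd_zero]
  | h1 α k ih =>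
    rw [powProd_add_single _ cre_commute, map_mul, Module.End.mul_apply, ih, polyRep_cre,
      add_assoc]

theorem polyRep_powProd_ann (β δ : Fin n → ℕ) :
    polyRep n (powProd ann β) (polyMon δ) =
      ((∏ i, (δ i).descFactorial (β i) : ℕ) : ℂ) • polyMon (δ - β) := by
  induction β using multi_induction with
  | h0 => simp [powProd_zero]
  | h1 β k ih =>
    rw [powProd_add_single _ ann_commute, map_mul, Module.End.mul_apply, ih, map_smul,
      polyRep_ann, smul_smul, tsub_tsub]
    congr 1
    rw [← Nat.cast_mul]
    congr 1
    rw [← Finset.mul_prod_erase _ _ (Finset.mem_univ k)]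
    refine Eq.trans ?_ (Finset.mul_prod_erase _
      (fun i => (δ i).descFactorial ((β + Pi.single k 1 : Fin n → ℕ) i)) (Finset.mem_univ k))
    have h : ∏ i ∈ Finset.univ.erase k, (δ i).descFactorial ((β + Pi.single k 1 : Fin n → ℕ) i) =
        ∏ i ∈ Finset.univ.erase k, (δ i).descFactorial (β i) := by
      refine Finset.prod_congr rfl fun i hi => ?_
      have := Finset.ne_of_mem_erase hi
      simp [this]
    rw [h]
    simp only [Pi.add_apply, Pi.single_eq_same, Nat.descFactorial_succ, Pi.sub_apply]
    ring

theorem mono_linearIndependent : LinearIndependent ℂ (monoFamily n) := by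
  rw [linearIndependent_iff]
  intro c hc
  by_contra hne
  obtain ⟨⟨α0, β0⟩, h0, hmin⟩ := Finset.exists_min_image c.support (fun γ => ∑ i, γ.2 i)
    (Finsupp.support_nonempty_iff.2 hne)
  have h1 : polyRep n (Finsupp.linearCombination ℂ (monoFamily n) c) (polyMon β0) = 0 := by
    rw [hc, map_zero]
    rfl
  rw [Finsupp.linearCombination_apply, Finsupp.sum, map_sum, LinearMap.sum_apply] at h1
  have h2 := congrArg (MvPolynomial.coeff (Finsupp.equivFunOnFinite.symm α0)) h1
  rw [MvPolynomial.coeff_sum, MvPolynomial.coeff_zero, Finset.sum_eq_single (α0, β0)] at h2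
  · rw [map_smul, LinearMap.smul_apply, monoFamily, mono, map_mul, Module.End.mul_apply,
      polyRep_powProd_ann, map_smul, polyRep_powProd_cre] at h2
    simp only [tsub_self, zero_add, polyMon, MvPolynomial.coeff_smul, Nat.descFactorial_self,
      MvPolynomial.coeff_monomial, if_true, smul_eq_mul, mul_one, mul_eq_zero] at h2
    rcases h2 with h2 | h2
    · exact (Finsupp.mem_support_iff.1 h0) h2
    · rw [Nat.cast_eq_zero, Finset.prod_eq_zero_iff] at h2
      obtain ⟨i, -, hi⟩ := h2
      exact Nat.factorial_ne_zero _ hi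
  · rintro ⟨α, β⟩ hγ hne2
    rw [map_smul, LinearMap.smul_apply, monoFamily, mono, map_mul, Module.End.mul_apply,
      polyRep_powProd_ann, map_smul, polyRep_powProd_cre]
    by_cases hβ : β = β0
    · subst hβ
      have hα : α ≠ α0 := fun h => hne2 (by rw [h])
      have hα2 : Finsupp.equivFunOnFinite.symm α ≠ Finsupp.equivFunOnFinite.symm α0 :=
        fun h => hα (Finsupp.equivFunOnFinite.symm.injective h)
      simp only [tsub_self, zero_add, polyMon, MvPolynomial.coeff_smul,
        MvPolynomial.coeff_monomial, if_neg hα2, smul_zero]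
    · obtain ⟨i, hi⟩ : ∃ i, β0 i < β i := by
        by_contra hcon
        push Not at hcon
        have hs := hmin _ hγ
        have he := (Finset.sum_eq_sum_iff_of_le fun i _ => hcon i).1
          (le_antisymm (Finset.sum_le_sum fun i _ => hcon i) hs)
        exact hβ (funext fun i => he i (Finset.mem_univ i))
      have : ∏ j, (β0 j).descFactorial (β j) = 0 :=
        Finset.prod_eq_zero (Finset.mem_univ i) (Nat.descFactorial_eq_zero_iff_lt.2 hi)
      rw [this]
      simp
  · intro h
    exact absurd h0 h

/-- The basis of the Weyl algebra consisting of the normal-ordered monomials. -/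
def monoBasis (n : ℕ) : Module.Basis ((Fin n → ℕ) × (Fin n → ℕ)) ℂ (Weyl n) :=
  Module.Basis.mk mono_linearIndependent mono_span.ge

/-- The coefficient of `a^(α,β)` in the normal-ordered expansion of `x`. -/
def coeff (x : Weyl n) (γ : (Fin n → ℕ) × (Fin n → ℕ)) : ℂ := (monoBasis n).repr x γ

/-! ### The skew-hermitian Weyl algebra -/

/-- The skew-hermitian Weyl algebra `Â_n`: the real Lie algebra of all `g` with `g† = -g`, under
the commutator. -/
def skewWeyl (n : ℕ) : LieSubalgebra ℝ (Weyl n) where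
  carrier := {g | star g = -g}
  add_mem' {a b} ha hb := by
    simp only [Set.mem_ofPred_eq] at *
    rw [star_add, ha, hb, neg_add]
  zero_mem' := by simp
  smul_mem' c x hx := by
    simp only [Set.mem_ofPred_eq] at *
    rw [star_smul, hx, star_trivial, smul_neg]
  lie_mem' {a b} ha hb := by
    change star a = -a at ha
    change star b = -b at hb
    change star ⁅a, b⁆ = -⁅a, b⁆
    rw [Ring.lie_def, star_sub, star_mul, star_mul, ha, hb]
    noncomm_ring

theorem mem_skewWeyl {g : Weyl n} : g ∈ skewWeyl n ↔ star g = -g := Iff.rfl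

/-- The two types of basis elements. -/
inductive Sgn
  | plus
  | minus

/-- The elements `g_+^(α,β) = i (a^(β,α) + a^(α,β))` and `g_-^(α,β) = a^(β,α) - a^(α,β)`,
as elements of the Weyl algebra. -/
def gWeyl : Sgn → (Fin n → ℕ) → (Fin n → ℕ) → Weyl n
  | Sgn.plus, α, β => Complex.I • (mono β α + mono α β)
  | Sgn.minus, α, β => mono β α - mono α β

theorem gWeyl_mem (σ : Sgn) (α β : Fin n → ℕ) : gWeyl σ α β ∈ skewWeyl n := by
  rw [mem_skewWeyl]
  cases σ with
  | plus =>
    change star (Complex.I • (mono β α + mono α β) : Weyl n) = _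
    rw [star_smul, star_add, star_mono, star_mono, Complex.star_def, Complex.conj_I,
      neg_smul, add_comm]
    rfl
  | minus =>
    change star (mono β α - mono α β : Weyl n) = -(mono β α - mono α β)
    rw [star_sub, star_mono, star_mono, neg_sub]

/-- The elements `g_σ^(α,β)` of the skew-hermitian Weyl algebra. -/
def g (σ : Sgn) (α β : Fin n → ℕ) : skewWeyl n := ⟨gWeyl σ α β, gWeyl_mem σ α β⟩

/-- The free term `i a_k† a_k`. -/
def free (k : Fin n) : skewWeyl n := ⟨Complex.I • (cre k * ann k), by
  rw [mem_skewWeyl, star_smul, star_mul, star_cre, star_ann, Complex.star_def, Complex.conj_I,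
    neg_smul]⟩

/-! ### The decomposition of the skew-hermitian Weyl algebra -/

/-- The degree `|γ| = |α| + |β|` of the multi-index `γ = (α, β)`. -/
def deg (α β : Fin n → ℕ) : ℕ := ∑ k, α k + ∑ k, β k

/-- The real span of the `g_σ^(α,β)` whose multi-index satisfies `P`. -/
def spanG (P : (Fin n → ℕ) → (Fin n → ℕ) → Prop) : Submodule ℝ (skewWeyl n) :=
  Submodule.span ℝ {x | ∃ σ α β, P α β ∧ x = g σ α β}

/-- `Â_n^0`. -/
def A0 (n : ℕ) : Submodule ℝ (skewWeyl n) :=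
  spanG fun α β => α = β ∧ (deg α β = 0 ∨ deg α β = 2)

/-- `Â_n^1`. -/
def A1 (n : ℕ) : Submodule ℝ (skewWeyl n) :=
  spanG fun α β => deg α β = 1

/-- `Â_n^2`. -/
def A2 (n : ℕ) : Submodule ℝ (skewWeyl n) :=
  spanG fun α β => α ≠ β ∧ deg α β = 2

/-- `Â_n^=`. -/
def Aeq (n : ℕ) : Submodule ℝ (skewWeyl n) :=
  spanG fun α β => α = β ∧ 4 ≤ deg α β

/-- `Â_n^om`. -/
def Aom (n : ℕ) : Submodule ℝ (skewWeyl n) :=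
  spanG fun α β => 3 ≤ deg α β ∧ ∃ k, α k + β k = 1 ∧ ∀ j, j ≠ k → α j = β j

/-- `Â_n^core`, the sum of the five subspaces above. -/
def Acore (n : ℕ) : Submodule ℝ (skewWeyl n) :=
  A0 n ⊔ A1 n ⊔ A2 n ⊔ Aeq n ⊔ Aom n

theorem skew_coe_add (x y : skewWeyl n) : ((x + y : skewWeyl n) : Weyl n) = x + y := rfl

theorem skew_coe_smul (r : ℝ) (x : skewWeyl n) :
    ((r • x : skewWeyl n) : Weyl n) = r • (x : Weyl n) := rfl

theorem skew_coe_zero : ((0 : skewWeyl n) : Weyl n) = 0 := rfl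

theorem coeff_add (x y : Weyl n) (γ) : coeff (x + y) γ = coeff x γ + coeff y γ := by
  simp [coeff]

theorem coeff_sub (x y : Weyl n) (γ) : coeff (x - y) γ = coeff x γ - coeff y γ := by
  simp [coeff]

theorem coeff_smul (z : ℂ) (x : Weyl n) (γ) : coeff (z • x) γ = z * coeff x γ := by
  simp [coeff]

theorem coeff_real_smul (r : ℝ) (x : Weyl n) (γ) : coeff (r • x) γ = r * coeff x γ :=
  coeff_smul (r : ℂ) x γ

theorem monoBasis_apply (γ) : monoBasis n γ = mono γ.1 γ.2 := by
  rw [monoBasis, Module.Basis.mk_apply, monoFamily]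

theorem coeff_mono (α β : Fin n → ℕ) (γ) :
    coeff (mono α β) γ = (Finsupp.single (α, β) (1 : ℂ)) γ := by
  rw [coeff, ← monoBasis_apply (α, β), Module.Basis.repr_self]

theorem coeff_support_finite (x : Weyl n) : {γ | coeff x γ ≠ 0}.Finite :=
  ((monoBasis n).repr x).hasFiniteSupport

theorem scalar_support_finite (x y : Weyl n) :
    (Function.support fun γ => (starRingEnd ℂ (coeff x γ) * coeff y γ).re).Finite := by
  refine (coeff_support_finite y).subset fun γ hγ h => hγ ?_
  simp only
  rw [h, mul_zero, Complex.zero_re]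

/-- The scalar product `Re ∑_γ conj (x_γ) y_γ` in terms of normal-ordered coefficients; the
`g_σ^γ` (taken up to sign, for `γ` modulo exchange of `α` and `β`) form an orthogonal basis. -/
def scalar (n : ℕ) : skewWeyl n →ₗ[ℝ] skewWeyl n →ₗ[ℝ] ℝ :=
  LinearMap.mk₂ ℝ
    (fun x y => ∑ᶠ γ, (starRingEnd ℂ (coeff (x : Weyl n) γ) * coeff (y : Weyl n) γ).re)
    (fun x x' y => by
      rw [← finsum_add_distrib (scalar_support_finite _ _) (scalar_support_finite _ _)]
      refine finsum_congr fun γ => ?_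
      rw [skew_coe_add, coeff_add, map_add, add_mul, Complex.add_re])
    (fun r x y => by
      rw [smul_finsum]
      refine finsum_congr fun γ => ?_
      rw [skew_coe_smul, coeff_real_smul, map_mul, Complex.conj_ofReal, mul_assoc,
        Complex.re_ofReal_mul, smul_eq_mul])
    (fun x y y' => by
      rw [← finsum_add_distrib (scalar_support_finite _ _) (scalar_support_finite _ _)]
      refine finsum_congr fun γ => ?_
      rw [skew_coe_add, coeff_add, mul_add, Complex.add_re])
    (fun r x y => by
      rw [smul_finsum]
      refine finsum_congr fun γ => ?_
      rw [skew_coe_smul, coeff_real_smul, mul_left_comm, Complex.re_ofReal_mul,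
        smul_eq_mul])

theorem scalar_apply (x y : skewWeyl n) : scalar n x y =
    ∑ᶠ γ, (starRingEnd ℂ (coeff (x : Weyl n) γ) * coeff (y : Weyl n) γ).re := rfl

theorem eq_zero_of_scalar_self {x : skewWeyl n} (h : scalar n x x = 0) : x = 0 := by
  have hterm : ∀ γ, (starRingEnd ℂ (coeff (x : Weyl n) γ) * coeff (x : Weyl n) γ).re =
      Complex.normSq (coeff (x : Weyl n) γ) := fun γ => by
    rw [← Complex.normSq_eq_conj_mul_self, Complex.ofReal_re]
  have h0 : ∀ γ, coeff (x : Weyl n) γ = 0 := by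
    intro γ
    by_contra hγ
    refine (finsum_pos (M := ℝ)
      (fun γ => (hterm γ).symm ▸ Complex.normSq_nonneg (coeff (x : Weyl n) γ))
      ⟨γ, (hterm γ).symm ▸ Complex.normSq_pos.2 hγ⟩ (scalar_support_finite _ _)).ne' h
  apply Subtype.ext
  apply (monoBasis n).repr.injective
  ext γ
  rw [skew_coe_zero, map_zero]
  exact h0 γ

theorem coeff_g_eq_zero (σ : Sgn) (α β : Fin n → ℕ) (γ : (Fin n → ℕ) × (Fin n → ℕ))
    (h1 : γ ≠ (α, β)) (h2 : γ ≠ (β, α)) : coeff (g σ α β : Weyl n) γ = 0 := by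
  have e1 : coeff (mono α β) γ = 0 := by
    rw [coeff_mono, Finsupp.single_eq_of_ne h1]
  have e2 : coeff (mono β α) γ = 0 := by
    rw [coeff_mono, Finsupp.single_eq_of_ne h2]
  cases σ with
  | plus =>
    change coeff (Complex.I • (mono β α + mono α β)) γ = 0
    rw [coeff_smul, coeff_add, e1, e2, add_zero, mul_zero]
  | minus =>
    change coeff (mono β α - mono α β) γ = 0
    rw [coeff_sub, e1, e2, sub_zero]

theorem scalar_g_eq_zero (σ τ : Sgn) (α β μ ν : Fin n → ℕ)
    (h1 : (α, β) ≠ (μ, ν)) (h2 : (α, β) ≠ (ν, μ)) : scalar n (g σ α β) (g τ μ ν) = 0 := by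
  rw [scalar_apply]
  refine (finsum_congr fun γ => ?_).trans finsum_zero
  by_cases ha : γ = (α, β)
  · subst ha
    rw [coeff_g_eq_zero τ μ ν _ h1 h2, mul_zero, Complex.zero_re]
  · by_cases hb : γ = (β, α)
    · subst hb
      rw [coeff_g_eq_zero τ μ ν, mul_zero, Complex.zero_re]
      · rintro h
        simp only [Prod.mk.injEq] at h
        exact h2 (by rw [h.1, h.2])
      · rintro h
        simp only [Prod.mk.injEq] at h
        exact h1 (by rw [h.1, h.2])
    · rw [coeff_g_eq_zero σ α β _ ha hb, map_zero, zero_mul, Complex.zero_re]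

theorem spanG_true : spanG (fun _ _ : Fin n → ℕ => True) = ⊤ := by
  rw [eq_top_iff]
  intro x _
  have hx : star (x : Weyl n) = -x := x.2
  let c := (monoBasis n).repr (x : Weyl n)
  have hc : (x : Weyl n) = ∑ γ ∈ c.support, c γ • mono γ.1 γ.2 := by
    conv_lhs => rw [← (monoBasis n).linearCombination_repr (x : Weyl n)]
    rw [Finsupp.linearCombination_apply, Finsupp.sum]
    exact Finset.sum_congr rfl fun γ _ => by rw [monoBasis_apply]
  have key : x = ∑ γ ∈ c.support, (((c γ).im / 2 : ℝ) • g Sgn.plus γ.1 γ.2 +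
      (-(c γ).re / 2 : ℝ) • g Sgn.minus γ.1 γ.2) := by
    apply Subtype.ext
    have h2 : (x : Weyl n) = (1 / 2 : ℂ) • ((x : Weyl n) - star (x : Weyl n)) := by
      rw [hx, sub_neg_eq_add, ← two_smul ℂ, smul_smul]
      norm_num
    rw [h2]
    conv_lhs => rw [hc]
    rw [star_sum, ← Finset.sum_sub_distrib, Finset.smul_sum]
    have hv : ((∑ γ ∈ c.support, (((c γ).im / 2 : ℝ) • g Sgn.plus γ.1 γ.2 +
        (-(c γ).re / 2 : ℝ) • g Sgn.minus γ.1 γ.2) : skewWeyl n) : Weyl n) =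
        ∑ γ ∈ c.support, (((((c γ).im / 2 : ℝ) : ℂ) •
          (Complex.I • (mono γ.2 γ.1 + mono γ.1 γ.2))) +
          ((-(c γ).re / 2 : ℝ) : ℂ) • (mono γ.2 γ.1 - mono γ.1 γ.2)) :=
      map_sum (skewWeyl n).toSubmodule.subtype _ _
    rw [hv]
    refine Finset.sum_congr rfl fun γ _ => ?_
    rw [star_smul, star_mono, Complex.star_def]
    obtain ⟨r, s⟩ := c γ
    have e1 : (⟨r, s⟩ : ℂ) = r + s * Complex.I := Complex.mk_eq_add_mul_I r s
    rw [e1]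
    simp only [map_add, map_mul, Complex.conj_ofReal, Complex.conj_I]
    push_cast
    simp only [Complex.add_re, Complex.add_im, Complex.ofReal_re, Complex.ofReal_im,
      Complex.mul_re, Complex.mul_im, Complex.I_re, Complex.I_im]
    push_cast
    module
  rw [key]
  refine Submodule.sum_mem _ fun γ _ => Submodule.add_mem _ ?_ ?_
  · exact Submodule.smul_mem _ _ (Submodule.subset_span ⟨_, _, _, trivial, rfl⟩)
  · exact Submodule.smul_mem _ _ (Submodule.subset_span ⟨_, _, _, trivial, rfl⟩)

/-- `Â_n^⊥`, the orthogonal complement of `Â_n^core`. -/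
def Aperp (n : ℕ) : Submodule ℝ (skewWeyl n) := (Acore n).orthogonalBilin (scalar n)

theorem spanG_le_ker (P : (Fin n → ℕ) → (Fin n → ℕ) → Prop) (hP : ∀ α β, P α β → P β α)
    (σ : Sgn) (α β : Fin n → ℕ) (h : ¬ P α β) :
    spanG P ≤ LinearMap.ker ((scalar n).flip (g σ α β)) := by
  rw [spanG, Submodule.span_le]
  rintro x ⟨τ, μ, ν, hx, rfl⟩
  rw [SetLike.mem_coe, LinearMap.mem_ker, LinearMap.flip_apply]
  refine scalar_g_eq_zero _ _ _ _ _ _ (fun he => ?_) (fun he => ?_)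
  · simp only [Prod.mk.injEq] at he
    exact h (by rw [← he.1, ← he.2]; exact hx)
  · simp only [Prod.mk.injEq] at he
    exact h (by rw [← he.1, ← he.2]; exact hP _ _ hx)

theorem deg_comm (α β : Fin n → ℕ) : deg α β = deg β α := add_comm _ _

theorem g_mem_core_or (σ : Sgn) (α β : Fin n → ℕ) :
    g σ α β ∈ Acore n ∨ g σ α β ∈ Aperp n := by
  by_cases hc : g σ α β ∈ Acore n
  · exact Or.inl hc
  · have hs : ∀ P : (Fin n → ℕ) → (Fin n → ℕ) → Prop, P α β → g σ α β ∈ spanG P :=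
      fun P hP => Submodule.subset_span ⟨_, _, _, hP, rfl⟩
    have i0 : A0 n ≤ Acore n :=
      le_sup_left.trans (le_sup_left.trans (le_sup_left.trans le_sup_left))
    have i1 : A1 n ≤ Acore n :=
      le_sup_right.trans (le_sup_left.trans (le_sup_left.trans le_sup_left))
    have i2 : A2 n ≤ Acore n := le_sup_right.trans (le_sup_left.trans le_sup_left)
    have i3 : Aeq n ≤ Acore n := le_sup_right.trans le_sup_left
    have i4 : Aom n ≤ Acore n := le_sup_right
    refine Or.inr ?_
    have hle : Acore n ≤ LinearMap.ker ((scalar n).flip (g σ α β)) := by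
      refine sup_le (sup_le (sup_le (sup_le ?_ ?_) ?_) ?_) ?_
      · refine spanG_le_ker _ (fun μ ν h => ?_) _ _ _ fun h => hc (i0 (hs _ h))
        exact ⟨h.1.symm, deg_comm μ ν ▸ h.2⟩
      · refine spanG_le_ker _ (fun μ ν h => ?_) _ _ _ fun h => hc (i1 (hs _ h))
        exact (deg_comm ν μ).trans h
      · refine spanG_le_ker _ (fun μ ν h => ?_) _ _ _ fun h => hc (i2 (hs _ h))
        exact ⟨h.1.symm, (deg_comm ν μ).trans h.2⟩
      · refine spanG_le_ker _ (fun μ ν h => ?_) _ _ _ fun h => hc (i3 (hs _ h))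
        exact ⟨h.1.symm, deg_comm μ ν ▸ h.2⟩
      · refine spanG_le_ker _ (fun μ ν h => ?_) _ _ _ fun h => hc (i4 (hs _ h))
        obtain ⟨h3, k, hk, hj⟩ := h
        exact ⟨deg_comm μ ν ▸ h3, k, (add_comm _ _).trans hk, fun j hjk => (hj j hjk).symm⟩
    intro x hx
    have := hle hx
    rwa [LinearMap.mem_ker, LinearMap.flip_apply] at this

theorem isCompl_perp_core (n : ℕ) : IsCompl (Aperp n) (Acore n) := by
  constructor
  · rw [Submodule.disjoint_def]
    intro x hp hc
    exact eq_zero_of_scalar_self (hp x hc)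
  · rw [codisjoint_iff, eq_top_iff, ← spanG_true, spanG, Submodule.span_le]
    rintro x ⟨σ, α, β, -, rfl⟩
    rcases g_mem_core_or σ α β with h | h
    · exact Submodule.mem_sup_right h
    · exact Submodule.mem_sup_left h

/-- The projection of `Â_n` onto `Â_n^⊥` along `Â_n^core`. -/
def projPerp (n : ℕ) : skewWeyl n →ₗ[ℝ] skewWeyl n :=
  (Aperp n).projection (Acore n) (isCompl_perp_core n)

/-! ### Generators -/

/-- The set of all `i a_k† a_k` together with the family `g_(σ_p)^(α_p,β_p)`. -/
def gens {R : Type*} (σ : R → Sgn) (α β : R → Fin n → ℕ) : Set (skewWeyl n) :=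
  Set.range free ∪ Set.range fun p => g (σ p) (α p) (β p)

/-- The elements of `G` that commute with all of `G`. -/
def centralGens (G : Set (skewWeyl n)) : Set (skewWeyl n) := {x ∈ G | ∀ y ∈ G, ⁅x, y⁆ = 0}

end

end BosonicLie

/-!
The algebra acts on polynomials in the occupation numbers `N = (N_1, …, N_n)`: the operator `a_k`
is the translation `p(N) ↦ p(N + e_k)`, and `a_k†` is `p(N) ↦ N_k p(N - e_k)` (`shiftRep`). The
monomial `a^(α,β)` then has weight `v = β - α` and acts by `p(N) ↦ fall α (N) p(N + v)`. In
general an element `x` of weight `v` acts by `p(N) ↦ s(N) p(N + v)` for a polynomial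
`s = sym x`, which determines `x`. Brackets become differences of products of translated
polynomials. Commutators with the number operators, which are all generators up to the factor `i`,
separate weights; so for every generator the complex span of the Lie algebra contains the monomial
`a^(α,β)` as well as its adjoint (`IsPair.mono_mem`).

*Necessity.* Let `f` have weight zero and let `x ≠ 0` have weight `v`, both in a finite-dimensional
Lie algebra. Bracketing `r` times with `f` multiplies `sym x` by the `r`-th power of
`sym f - shift v (sym f)`, so this difference is constant (`exists_difference_eq_C`). For
`f = [x, y]` with `y` of weight `-v` it is, up to a translation and sign, the second difference
along `v` of `G = sym x * shift v (sym y)`. Hence `G` is quadratic on lines of direction `v`, with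
constant leading coefficient (`natDegree_line_le_two`). As `G` contains the `∑ |v_k|` linear factors
forced by the weights, elements with `∑ |v_k| ≥ 2` are quadratic (`quadratic_of_two_le`), and
monomials with `∑ |v_k| = 1` are linear operators times diagonal monomials in other modes
(`deg_eq_two_or_single_mode`). This gives (i) and (iv). For (iii), a quadratic generator that
touches a balanced mode of a generator in `Â_n^om` produces a nonzero bracket of weight of length
three (`lie_quadratic_ne_zero`). For (ii), take for `f` a diagonal monomial: its difference along
`v` is constant only if it vanishes or the monomial is linear in `N` (`lie_diagonal_eq_zero`).

*Sufficiency.* Let `M` be the set of modes that occur in the diagonal factors `a^(μ,μ)` of the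
generators in `Â_n^om`. By (iii) the quadratic generators avoid `M`, and by (iv) so do the linear
factors of the generators in `Â_n^om` (`eq_zero_of_mem_omModes`, `notMem_omModes`). So all
generators outside `Â_n^=` lie in the span of quadratic operators `l l'`, of products
`l a^(μ,μ)` and of products `a^(μ,μ) a^(ν,ν)`, where `l`, `l'` are creation or annihilation
operators of modes outside `M` and `μ`, `ν` run through a finite set of indices supported in `M`.
This finite-dimensional span is closed under brackets (`lie_mem_omSpan`). The remaining generators
are central by (ii) and only add their own span (`finiteDimensional_lieSpan_of_central`).
-/

namespace BosonicLie

noncomputable section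

variable {n : ℕ}

/-! ### Weights -/

theorem coeff_zero (γ) : coeff (0 : Weyl n) γ = 0 := by
  simp [coeff]

theorem weyl_ext {x y : Weyl n} (h : ∀ γ, coeff x γ = coeff y γ) : x = y :=
  (monoBasis n).repr.injective (Finsupp.ext h)

theorem exists_coeff_ne_zero {x : Weyl n} (h : x ≠ 0) : ∃ γ, coeff x γ ≠ 0 := by
  by_contra hcon
  push Not at hcon
  exact h (weyl_ext fun γ => by rw [hcon, coeff_zero])

theorem coeff_mono_self (α β : Fin n → ℕ) : coeff (mono α β) (α, β) = 1 := by
  rw [coeff_mono, Finsupp.single_eq_same]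

theorem coeff_mono_of_ne {α β : Fin n → ℕ} {γ} (h : γ ≠ (α, β)) : coeff (mono α β) γ = 0 := by
  rw [coeff_mono, Finsupp.single_eq_of_ne h]

theorem mono_ne_zero (α β : Fin n → ℕ) : (mono α β : Weyl n) ≠ 0 := fun h => by
  have := coeff_mono_self α β
  rw [h, coeff_zero] at this
  exact zero_ne_one this

/-- The expansion of an element in normal-ordered monomials. -/
theorem eq_sum_coeff (x : Weyl n) :
    x = ∑ γ ∈ ((monoBasis n).repr x).support, coeff x γ • mono γ.1 γ.2 := by
  conv_lhs => rw [← (monoBasis n).linearCombination_repr x]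
  rw [Finsupp.linearCombination_apply, Finsupp.sum]
  exact Finset.sum_congr rfl fun γ _ => by rw [monoBasis_apply]; rfl

/-- The number operator `a_k† a_k`. -/
def num (k : Fin n) : Weyl n := cre k * ann k

theorem commutator_mul {A : Type*} [Ring A] [Algebra ℂ A] {N x y : A} {a b : ℂ}
    (hx : N * x - x * N = a • x) (hy : N * y - y * N = b • y) :
    N * (x * y) - x * y * N = (a + b) • (x * y) := by
  have : N * (x * y) - x * y * N = (N * x - x * N) * y + x * (N * y - y * N) := by noncomm_ring
  rw [this, hx, hy, smul_mul_assoc, mul_smul_comm, add_smul]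

theorem num_cre (k j : Fin n) :
    num k * cre j - cre j * num k = ((Pi.single j 1 : Fin n → ℕ) k : ℂ) • (cre j : Weyl n) := by
  rw [num, mul_assoc, ann_mul_cre, mul_add, ← mul_assoc, cre_comm k j, mul_assoc,
    add_sub_cancel_left, Pi.single_apply]
  split_ifs with h
  · rw [h]; simp
  · simp

theorem num_ann (k j : Fin n) :
    num k * ann j - ann j * num k = (-((Pi.single j 1 : Fin n → ℕ) k : ℂ)) • (ann j : Weyl n) := by
  have h : num k * ann j - ann j * num k = -((ann j * cre k - cre k * ann j) * ann k : Weyl n) := by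
    rw [num, sub_mul, mul_assoc, ann_comm k j]
    noncomm_ring
  rw [h, ann_mul_cre, add_sub_cancel_left, Pi.single_apply]
  by_cases hk : j = k
  · subst hk; simp
  · simp [hk, Ne.symm hk]

theorem num_powProd (f : Fin n → Weyl n) (hf : ∀ i j, Commute (f i) (f j)) (s : ℂ)
    (h : ∀ k j, num k * f j - f j * num k = (s * ((Pi.single j 1 : Fin n → ℕ) k : ℂ)) • f j)
    (k : Fin n) (α : Fin n → ℕ) :
    num k * powProd f α - powProd f α * num k = (s * (α k : ℂ)) • powProd f α := by
  induction α using multi_induction with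
  | h0 => simp [powProd_zero]
  | h1 α j ih =>
    rw [powProd_add_single _ hf, commutator_mul (h k j) ih, Pi.add_apply]
    push_cast
    rw [mul_add, add_comm]

theorem num_mono (k : Fin n) (α β : Fin n → ℕ) :
    num k * mono α β - mono α β * num k = ((α k : ℂ) - β k) • (mono α β : Weyl n) := by
  have h1 := num_powProd (cre (n := n)) cre_commute 1
    (fun k j => by rw [one_mul]; exact num_cre k j) k α
  have h2 := num_powProd (ann (n := n)) ann_commute (-1)
    (fun k j => by rw [neg_one_mul]; exact num_ann k j) k β
  rw [mono, commutator_mul h1 h2]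
  congr 1
  ring

theorem coeff_num_commutator (k : Fin n) (x : Weyl n) (γ) :
    coeff (num k * x - x * num k) γ = ((γ.1 k : ℂ) - γ.2 k) * coeff x γ := by
  have h : (monoBasis n).coord γ ∘ₗ (LinearMap.mulLeft ℂ (num k) - LinearMap.mulRight ℂ (num k)) =
      ((γ.1 k : ℂ) - γ.2 k) • (monoBasis n).coord γ := by
    refine (monoBasis n).ext fun δ => ?_
    rw [monoBasis_apply]
    change coeff (num k * mono δ.1 δ.2 - mono δ.1 δ.2 * num k) γ =
      ((γ.1 k : ℂ) - γ.2 k) * coeff (mono δ.1 δ.2) γ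
    rw [num_mono, coeff_smul]
    by_cases hδ : γ = (δ.1, δ.2)
    · rw [hδ]
    · rw [coeff_mono_of_ne hδ, mul_zero, mul_zero]
  exact LinearMap.congr_fun h x

/-- An element has weight `v ∈ ℤⁿ` if only monomials `a^(α,β)` with `β - α = v` occur in its
normal-ordered expansion. -/
def IsWeight (x : Weyl n) (v : Fin n → ℤ) : Prop :=
  ∀ γ, coeff x γ ≠ 0 → ∀ k, (γ.2 k : ℤ) - γ.1 k = v k

/-- The weight spaces are the joint eigenspaces of the commutators with the number operators. -/
theorem isWeight_iff {x : Weyl n} {v : Fin n → ℤ} :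
    IsWeight x v ↔ ∀ k, num k * x - x * num k = (-(v k : ℂ)) • x := by
  constructor
  · intro h k
    refine weyl_ext fun γ => ?_
    rw [coeff_num_commutator, coeff_smul]
    by_cases hγ : coeff x γ = 0
    · rw [hγ, mul_zero, mul_zero]
    · rw [← h γ hγ k]
      push_cast
      ring
  · intro h γ hγ k
    have h1 := coeff_num_commutator k x γ
    rw [h k, coeff_smul] at h1
    have h2 := mul_right_cancel₀ hγ h1
    have h3 : ((v k : ℤ) : ℂ) = ((γ.2 k - γ.1 k : ℤ) : ℂ) := by
      push_cast
      linear_combination -h2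
    exact (Int.cast_injective h3).symm

theorem IsWeight.mul {x y : Weyl n} {v w : Fin n → ℤ} (hx : IsWeight x v) (hy : IsWeight y w) :
    IsWeight (x * y) (v + w) := by
  rw [isWeight_iff] at *
  intro k
  rw [commutator_mul (hx k) (hy k), Pi.add_apply]
  push_cast
  rw [neg_add]

theorem IsWeight.smul {x : Weyl n} {v : Fin n → ℤ} (z : ℂ) (hx : IsWeight x v) :
    IsWeight (z • x) v := fun γ hγ =>
  hx γ fun h => hγ (by rw [coeff_smul, h, mul_zero])

theorem IsWeight.sub {x y : Weyl n} {v : Fin n → ℤ} (hx : IsWeight x v) (hy : IsWeight y v) :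
    IsWeight (x - y) v := fun γ hγ => by
  by_cases h : coeff x γ = 0
  · exact hy γ fun h' => hγ (by rw [coeff_sub, h, h', sub_zero])
  · exact hx γ h

theorem IsWeight.lie {x y : Weyl n} {v w : Fin n → ℤ} (hx : IsWeight x v) (hy : IsWeight y w) :
    IsWeight ⁅x, y⁆ (v + w) := by
  rw [Ring.lie_def]
  exact (hx.mul hy).sub (add_comm w v ▸ hy.mul hx)

theorem isWeight_mono (α β : Fin n → ℕ) :
    IsWeight (mono α β) (fun k => (β k : ℤ) - α k) := fun γ hγ k => by
  by_cases h : γ = (α, β)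
  · rw [h]
  · exact absurd (coeff_mono_of_ne h) hγ

/-! ### The representation by shift operators -/

/-- The translation `p(N) ↦ p(N + v)` of polynomials. -/
def shift (v : Fin n → ℤ) : MvPolynomial (Fin n) ℂ →ₐ[ℂ] MvPolynomial (Fin n) ℂ :=
  MvPolynomial.aeval fun k => MvPolynomial.X k + MvPolynomial.C (v k : ℂ)

theorem shift_X (v : Fin n → ℤ) (k : Fin n) :
    shift v (MvPolynomial.X k) = MvPolynomial.X k + MvPolynomial.C (v k : ℂ) :=
  MvPolynomial.aeval_X _ _

theorem shift_C (v : Fin n → ℤ) (z : ℂ) : shift v (MvPolynomial.C z) = MvPolynomial.C z :=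
  MvPolynomial.aeval_C _ _

theorem shift_shift (v w : Fin n → ℤ) (p : MvPolynomial (Fin n) ℂ) :
    shift v (shift w p) = shift (v + w) p := by
  have h : (shift v).comp (shift w) = shift (v + w) := by
    refine MvPolynomial.algHom_ext fun k => ?_
    rw [AlgHom.comp_apply, shift_X, map_add, shift_X, shift_C, shift_X, add_assoc, ← map_add,
      Pi.add_apply]
    push_cast
    rfl
  exact DFunLike.congr_fun h p

theorem shift_zero (p : MvPolynomial (Fin n) ℂ) : shift 0 p = p := by
  have h : shift (0 : Fin n → ℤ) = AlgHom.id ℂ _ := by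
    refine MvPolynomial.algHom_ext fun k => ?_
    rw [shift_X]
    simp
  rw [h]
  rfl

theorem shift_injective (v : Fin n → ℤ) : Function.Injective (shift v) := fun p q h => by
  have := congrArg (shift (-v)) h
  rwa [shift_shift, shift_shift, neg_add_cancel, shift_zero, shift_zero] at this

/-- The operator `p(N) ↦ N_k p(N - e_k)`. -/
def raise (k : Fin n) : Module.End ℂ (MvPolynomial (Fin n) ℂ) :=
  LinearMap.mulLeft ℂ (MvPolynomial.X k) ∘ₗ (shift (-Pi.single k 1)).toLinearMap

/-- The operator `p(N) ↦ p(N + e_k)`. -/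
def lower (k : Fin n) : Module.End ℂ (MvPolynomial (Fin n) ℂ) :=
  (shift (Pi.single k 1)).toLinearMap

theorem raise_apply (k : Fin n) (p : MvPolynomial (Fin n) ℂ) :
    raise k p = MvPolynomial.X k * shift (-Pi.single k 1) p := rfl

theorem lower_apply (k : Fin n) (p : MvPolynomial (Fin n) ℂ) :
    lower k p = shift (Pi.single k 1) p := rfl

theorem raise_comm (i j : Fin n) : raise i * raise j = raise j * raise i := by
  refine LinearMap.ext fun p => ?_
  rw [Module.End.mul_apply, Module.End.mul_apply, raise_apply, raise_apply, raise_apply,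
    raise_apply, map_mul, map_mul, shift_shift, shift_shift, shift_X, shift_X,
    add_comm (-Pi.single j 1 : Fin n → ℤ)]
  by_cases h : i = j
  · rw [h]
  · simp [h, Ne.symm h]
    ring

theorem lower_comm (i j : Fin n) : lower i * lower j = lower j * lower i := by
  refine LinearMap.ext fun p => ?_
  rw [Module.End.mul_apply, Module.End.mul_apply, lower_apply, lower_apply, lower_apply,
    lower_apply, shift_shift, shift_shift, add_comm]

theorem lower_mul_raise (i j : Fin n) :
    lower i * raise j = raise j * lower i + if i = j then 1 else 0 := by
  refine LinearMap.ext fun p => ?_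
  rw [LinearMap.add_apply, Module.End.mul_apply, Module.End.mul_apply, lower_apply, lower_apply,
    raise_apply, raise_apply, map_mul, shift_shift, shift_shift, shift_X,
    add_comm (-Pi.single j 1 : Fin n → ℤ)]
  by_cases h : i = j
  · subst h
    rw [if_pos rfl, add_neg_cancel, shift_zero]
    simp [add_mul]
  · simp [h]

/-- The action of the Weyl algebra on polynomials in the occupation numbers, in which `a_k` is the
translation `p(N) ↦ p(N + e_k)` and `a_k†` is `p(N) ↦ N_k p(N - e_k)`. -/
def shiftRep (n : ℕ) : Weyl n →ₐ[ℂ] Module.End ℂ (MvPolynomial (Fin n) ℂ) :=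
  weylLift raise lower raise_comm lower_comm lower_mul_raise

theorem shiftRep_cre (k : Fin n) (p : MvPolynomial (Fin n) ℂ) :
    shiftRep n (cre k) p = MvPolynomial.X k * shift (-Pi.single k 1) p := by
  rw [shiftRep, weylLift_cre]
  rfl

theorem shiftRep_ann (k : Fin n) (p : MvPolynomial (Fin n) ℂ) :
    shiftRep n (ann k) p = shift (Pi.single k 1) p := by
  rw [shiftRep, weylLift_ann]
  rfl

/-- The falling factorial `∏_k N_k (N_k - 1) ⋯ (N_k - α_k + 1)`. -/
def fall (α : Fin n → ℕ) : MvPolynomial (Fin n) ℂ :=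
  ∏ k, ∏ i ∈ Finset.range (α k), (MvPolynomial.X k - MvPolynomial.C (i : ℂ))

theorem fall_zero : fall (0 : Fin n → ℕ) = 1 := by
  simp [fall]

theorem shift_fall (v : Fin n → ℤ) (α : Fin n → ℕ) :
    shift v (fall α) = ∏ k, ∏ i ∈ Finset.range (α k),
      (MvPolynomial.X k + MvPolynomial.C ((v k : ℂ) - i)) := by
  rw [fall, map_prod]
  refine Finset.prod_congr rfl fun k _ => ?_
  rw [map_prod]
  refine Finset.prod_congr rfl fun i _ => ?_
  rw [map_sub, shift_X, shift_C, MvPolynomial.C_sub, add_sub_assoc]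

theorem fall_add (u μ : Fin n → ℕ) :
    fall (u + μ) = fall u * shift (fun k => -(u k : ℤ)) (fall μ) := by
  rw [shift_fall, fall, fall, ← Finset.prod_mul_distrib]
  refine Finset.prod_congr rfl fun k _ => ?_
  rw [Pi.add_apply, Finset.prod_range_add]
  congr 1
  refine Finset.prod_congr rfl fun i _ => ?_
  rw [sub_eq_add_neg, ← MvPolynomial.C_neg]
  push_cast
  rw [neg_add, sub_eq_add_neg]

theorem fall_single (k : Fin n) : fall (Pi.single k 1) = MvPolynomial.X k := by
  rw [fall, Finset.prod_eq_single k]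
  · simp
  · intro j _ hj
    simp [hj]
  · simp

theorem fall_ne_zero (α : Fin n → ℕ) : fall α ≠ 0 := by
  rw [fall, Finset.prod_ne_zero_iff]
  intro k _
  rw [Finset.prod_ne_zero_iff]
  intro i _ h
  have := congrArg (MvPolynomial.eval fun _ => (i : ℂ) + 1) h
  simp at this

theorem eval_fall (α m : Fin n → ℕ) :
    MvPolynomial.eval (fun k => (m k : ℂ)) (fall α) = ∏ k, ((m k).descFactorial (α k) : ℂ) := by
  rw [fall, map_prod]
  refine Finset.prod_congr rfl fun k _ => ?_
  rw [map_prod]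
  induction α k with
  | zero => simp
  | succ a ih =>
    rw [Finset.prod_range_succ, ih, Nat.descFactorial_succ]
    simp only [map_sub, MvPolynomial.eval_X, MvPolynomial.eval_C]
    push_cast
    rcases le_or_gt a (m k) with h | h
    · rw [Nat.cast_sub h, mul_comm]
    · rw [Nat.descFactorial_eq_zero_iff_lt.2 h]
      simp

theorem eval_fall_ne_zero_iff (α m : Fin n → ℕ) :
    MvPolynomial.eval (fun k => (m k : ℂ)) (fall α) ≠ 0 ↔ ∀ k, α k ≤ m k := by
  rw [eval_fall, Finset.prod_ne_zero_iff]
  simp [Nat.descFactorial_eq_zero_iff_lt]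

theorem eval_shift (v : Fin n → ℤ) (a b : Fin n → ℂ) (h : ∀ k, a k + v k = b k)
    (p : MvPolynomial (Fin n) ℂ) :
    MvPolynomial.eval a (shift v p) = MvPolynomial.eval b p := by
  have h1 : (MvPolynomial.aeval a).comp (shift v) = MvPolynomial.aeval b := by
    refine MvPolynomial.algHom_ext fun k => ?_
    rw [AlgHom.comp_apply, shift_X]
    simp [h]
  have h2 : MvPolynomial.aeval a (shift v p) = MvPolynomial.aeval b p := DFunLike.congr_fun h1 p
  rw [← MvPolynomial.coe_aeval_eq_eval, ← MvPolynomial.coe_aeval_eq_eval]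
  exact h2

theorem shiftRep_mono (α β : Fin n → ℕ) (p : MvPolynomial (Fin n) ℂ) :
    shiftRep n (mono α β) p = fall α * shift (fun k => (β k : ℤ) - α k) p := by
  have hann : shiftRep n (powProd ann β) p = shift (fun k => (β k : ℤ)) p := by
    induction β using multi_induction with
    | h0 =>
      rw [powProd_zero, map_one]
      exact (shift_zero p).symm
    | h1 β j ih =>
      rw [powProd_add_single _ ann_commute, map_mul, Module.End.mul_apply, ih, shiftRep_ann,
        shift_shift]
      congr 2
      ext k
      rcases eq_or_ne k j with rfl | h
      · simp [add_comm]
      · simp [h]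
  rw [mono, map_mul, Module.End.mul_apply, hann]
  induction α using multi_induction with
  | h0 => simp [powProd_zero, fall_zero]
  | h1 α j ih =>
    rw [powProd_add_single _ cre_commute, map_mul, Module.End.mul_apply, ih, shiftRep_cre,
      map_mul, shift_shift, add_comm α, fall_add, fall_single, mul_assoc]
    have h1 : (fun k => -((Pi.single j 1 : Fin n → ℕ) k : ℤ)) = -Pi.single j 1 := by
      ext k
      rcases eq_or_ne k j with rfl | h
      · simp
      · simp [h]
    rw [h1]
    congr 4
    ext k
    rcases eq_or_ne k j with rfl | h
    · simp
      ring
    · simp [h]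

/-- The polynomial `s` such that an element of weight `v` acts by `p(N) ↦ s(N) p(N + v)`. -/
def sym (x : Weyl n) : MvPolynomial (Fin n) ℂ := shiftRep n x 1

theorem sym_mono (α β : Fin n → ℕ) : sym (mono α β) = fall α := by
  rw [sym, shiftRep_mono, map_one, mul_one]

theorem sym_sub (x y : Weyl n) : sym (x - y) = sym x - sym y := by
  rw [sym, map_sub]
  rfl

theorem sym_smul (z : ℂ) (x : Weyl n) : sym (z • x) = z • sym x := by
  rw [sym, map_smul]
  rfl

theorem sym_eq_sum (x : Weyl n) :
    sym x = ∑ γ ∈ ((monoBasis n).repr x).support, coeff x γ • fall γ.1 := by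
  conv_lhs => rw [eq_sum_coeff x]
  rw [sym, map_sum, LinearMap.sum_apply]
  refine Finset.sum_congr rfl fun γ _ => ?_
  rw [map_smul, LinearMap.smul_apply, shiftRep_mono, map_one, mul_one]

theorem IsWeight.shiftRep_apply {x : Weyl n} {v : Fin n → ℤ} (hx : IsWeight x v)
    (p : MvPolynomial (Fin n) ℂ) : shiftRep n x p = sym x * shift v p := by
  rw [sym_eq_sum]
  conv_lhs => rw [eq_sum_coeff x]
  rw [map_sum, LinearMap.sum_apply, Finset.sum_mul]
  refine Finset.sum_congr rfl fun γ hγ => ?_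
  rw [map_smul, LinearMap.smul_apply, shiftRep_mono, smul_mul_assoc]
  congr 4
  exact funext (hx γ (Finsupp.mem_support_iff.1 hγ))

theorem IsWeight.sym_mul {x : Weyl n} {v : Fin n → ℤ} (hx : IsWeight x v) (y : Weyl n) :
    sym (x * y) = sym x * shift v (sym y) := by
  rw [sym, map_mul, Module.End.mul_apply, hx.shiftRep_apply]
  rfl

theorem IsWeight.sym_lie {x y : Weyl n} {v w : Fin n → ℤ} (hx : IsWeight x v)
    (hy : IsWeight y w) : sym ⁅x, y⁆ = sym x * shift v (sym y) - sym y * shift w (sym x) := by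
  rw [Ring.lie_def, sym_sub, hx.sym_mul, hy.sym_mul]

/-- On a weight space the symbol determines the element, because the falling factorials are
linearly independent. -/
theorem IsWeight.sym_ne_zero {x : Weyl n} {v : Fin n → ℤ} (hx : IsWeight x v) (h : x ≠ 0) :
    sym x ≠ 0 := by
  obtain ⟨γ', hγ'⟩ := exists_coeff_ne_zero h
  -- Evaluation at `N = α` with `|α|` minimal kills all falling factorials but the one of `α`.
  obtain ⟨γ, hγ, hmin⟩ := Finset.exists_min_image ((monoBasis n).repr x).support
    (fun γ => ∑ i, γ.1 i) ⟨γ', Finsupp.mem_support_iff.2 hγ'⟩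
  intro h0
  have h1 := congrArg (MvPolynomial.eval fun k => (γ.1 k : ℂ)) h0
  rw [sym_eq_sum, map_sum, map_zero, Finset.sum_eq_single γ] at h1
  · rw [MvPolynomial.smul_eval] at h1
    exact mul_ne_zero (Finsupp.mem_support_iff.1 hγ)
      ((eval_fall_ne_zero_iff _ _).2 fun _ => le_rfl) h1
  · intro δ hδ hne
    rw [MvPolynomial.smul_eval]
    refine mul_eq_zero_of_right _ ?_
    by_contra hcon
    rw [← ne_eq, eval_fall_ne_zero_iff] at hcon
    have he := (Finset.sum_eq_sum_iff_of_le fun i _ => hcon i).1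
      (le_antisymm (Finset.sum_le_sum fun i _ => hcon i) (hmin _ hδ))
    have e1 : δ.1 = γ.1 := funext fun i => he i (Finset.mem_univ i)
    refine hne (Prod.ext e1 (funext fun i => ?_))
    have e2 := hx δ (Finsupp.mem_support_iff.1 hδ) i
    have e3 := hx γ (Finsupp.mem_support_iff.1 hγ) i
    rw [e1] at e2
    omega
  · exact fun hcon => absurd hγ hcon

theorem IsWeight.eq_of_sym_eq {x y : Weyl n} {v : Fin n → ℤ} (hx : IsWeight x v)
    (hy : IsWeight y v) (h : sym x = sym y) : x = y := by
  by_contra hne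
  refine (hx.sub hy).sym_ne_zero (sub_ne_zero.2 hne) ?_
  rw [sym_sub, h, sub_self]

/-! ### Restriction of polynomials to lines -/

/-- The restriction `t ↦ p(N + t v)` of a polynomial to the generic line of direction `v`. -/
def line (v : Fin n → ℤ) :
    MvPolynomial (Fin n) ℂ →ₐ[ℂ] Polynomial (MvPolynomial (Fin n) ℂ) :=
  MvPolynomial.aeval fun k => Polynomial.C (MvPolynomial.X k) +
    Polynomial.C (MvPolynomial.C (v k : ℂ)) * Polynomial.X

theorem line_X (v : Fin n → ℤ) (k : Fin n) :
    line v (MvPolynomial.X k) = Polynomial.C (MvPolynomial.X k) +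
      Polynomial.C (MvPolynomial.C (v k : ℂ)) * Polynomial.X :=
  MvPolynomial.aeval_X _ _

theorem line_C (v : Fin n → ℤ) (z : ℂ) :
    line v (MvPolynomial.C z) = Polynomial.C (MvPolynomial.C z) :=
  MvPolynomial.aeval_C _ _

theorem line_shift (v : Fin n → ℤ) (p : MvPolynomial (Fin n) ℂ) :
    line v (shift v p) = Polynomial.taylor 1 (line v p) := by
  have h : (line v).comp (shift v) =
      ((Polynomial.taylorAlgHom (1 : MvPolynomial (Fin n) ℂ)).restrictScalars ℂ).comp
        (line v) := by
    refine MvPolynomial.algHom_ext fun k => ?_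
    rw [AlgHom.comp_apply, AlgHom.comp_apply, shift_X, map_add, line_X, line_C]
    change _ = Polynomial.taylor 1 _
    rw [map_add, Polynomial.taylor_mul, Polynomial.taylor_C, Polynomial.taylor_C,
      Polynomial.taylor_X, Polynomial.C_1]
    ring
  exact DFunLike.congr_fun h p

theorem eval_zero_line (v : Fin n → ℤ) (p : MvPolynomial (Fin n) ℂ) :
    (line v p).eval 0 = p := by
  have h : ((Polynomial.aeval (0 : MvPolynomial (Fin n) ℂ)).restrictScalars ℂ).comp (line v) =
      AlgHom.id ℂ _ := by
    refine MvPolynomial.algHom_ext fun k => ?_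
    rw [AlgHom.comp_apply, line_X]
    simp
  exact DFunLike.congr_fun h p

theorem line_injective (v : Fin n → ℤ) : Function.Injective (line v) := fun p q h => by
  rw [← eval_zero_line v p, h, eval_zero_line]

theorem line_ne_zero (v : Fin n → ℤ) {p : MvPolynomial (Fin n) ℂ} (h : p ≠ 0) : line v p ≠ 0 :=
  fun h' => h (line_injective v (h'.trans (map_zero _).symm))

theorem line_eq_C {v : Fin n → ℤ} {p : MvPolynomial (Fin n) ℂ} (h : (line v p).natDegree = 0) :
    line v p = Polynomial.C p := by
  have h1 := Polynomial.eq_C_of_natDegree_eq_zero h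
  have h2 := eval_zero_line v p
  rw [h1, Polynomial.eval_C] at h2
  rw [h1, h2]

theorem coeff_taylor_sub {R : Type*} [CommRing R] (P : Polynomial R) (m : ℕ)
    (h : P.natDegree ≤ m + 1) :
    (Polynomial.taylor 1 P - P).coeff m = (m + 1) * P.coeff (m + 1) := by
  rw [Polynomial.coeff_sub, Polynomial.taylor_coeff,
    Polynomial.eval_eq_sum_range' (n := 2)
      (lt_of_le_of_lt (Polynomial.natDegree_hasseDeriv_le P m) (by omega)),
    Finset.sum_range_succ, Finset.sum_range_one, Polynomial.hasseDeriv_coeff,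
    Polynomial.hasseDeriv_coeff, zero_add, add_comm 1 m, Nat.choose_self, Nat.choose_succ_self_right]
  push_cast
  ring

/-- The difference operator lowers the degree by exactly one. -/
theorem natDegree_le_of_taylor_sub {R : Type*} [CommRing R] [IsDomain R] [CharZero R]
    (P : Polynomial R) (d : ℕ) (h : (Polynomial.taylor 1 P - P).natDegree ≤ d) :
    P.natDegree ≤ d + 1 := by
  by_contra hcon
  push Not at hcon
  obtain ⟨m, hm⟩ : ∃ m, P.natDegree = m + 1 := ⟨P.natDegree - 1, by omega⟩
  have h1 := coeff_taylor_sub P m hm.le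
  rw [Polynomial.coeff_eq_zero_of_natDegree_lt (by omega), ← hm, Polynomial.coeff_natDegree] at h1
  have h2 : P ≠ 0 := fun h0 => by
    rw [h0, Polynomial.natDegree_zero] at hm
    omega
  exact mul_ne_zero (Nat.cast_add_one_ne_zero m) (Polynomial.leadingCoeff_ne_zero.2 h2) h1.symm

theorem line_factor (v : Fin n → ℤ) (k : Fin n) (z : ℂ) :
    (line v (MvPolynomial.X k + MvPolynomial.C z)).natDegree = (if v k = 0 then 0 else 1) ∧
      (line v (MvPolynomial.X k + MvPolynomial.C z)).leadingCoeff =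
        if v k = 0 then MvPolynomial.X k + MvPolynomial.C z else MvPolynomial.C (v k : ℂ) := by
  have h : line v (MvPolynomial.X k + MvPolynomial.C z) =
      Polynomial.C (MvPolynomial.C (v k : ℂ)) * Polynomial.X +
        Polynomial.C (MvPolynomial.X k + MvPolynomial.C z) := by
    rw [map_add, line_X, line_C, Polynomial.C_add]
    ring
  rw [h]
  by_cases hv : v k = 0
  · rw [if_pos hv, if_pos hv, hv]
    simp only [Int.cast_zero, map_zero, zero_mul, zero_add]
    exact ⟨Polynomial.natDegree_C _, Polynomial.leadingCoeff_C _⟩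
  · have hz : MvPolynomial.C (σ := Fin n) (v k : ℂ) ≠ 0 := by
      simpa using hv
    rw [if_neg hv, if_neg hv]
    exact ⟨Polynomial.natDegree_linear hz, Polynomial.leadingCoeff_linear hz⟩

theorem X_add_C_ne_zero (k : Fin n) (z : ℂ) : MvPolynomial.X k + MvPolynomial.C z ≠ 0 := by
  intro h
  have := congrArg (MvPolynomial.eval fun _ => 1 - z) h
  simp at this

theorem not_isUnit_X_add_C (k : Fin n) (z : ℂ) :
    ¬ IsUnit (MvPolynomial.X k + MvPolynomial.C z : MvPolynomial (Fin n) ℂ) := by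
  intro h
  have := h.map (MvPolynomial.eval fun _ => -z)
  simp at this

theorem line_shift_fall_ne_zero (v w : Fin n → ℤ) (α : Fin n → ℕ) (k : Fin n) :
    ∏ i ∈ Finset.range (α k), line v (MvPolynomial.X k + MvPolynomial.C ((w k : ℂ) - i)) ≠ 0 :=
  Finset.prod_ne_zero_iff.2 fun _ _ => line_ne_zero v (X_add_C_ne_zero _ _)

theorem natDegree_line_shift_fall (v w : Fin n → ℤ) (α : Fin n → ℕ) :
    (line v (shift w (fall α))).natDegree = ∑ k, if v k = 0 then 0 else α k := by
  rw [shift_fall, map_prod]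
  simp only [map_prod]
  rw [Polynomial.natDegree_prod _ _ fun k _ => line_shift_fall_ne_zero v w α k]
  refine Finset.sum_congr rfl fun k _ => ?_
  rw [Polynomial.natDegree_prod _ _ fun i _ => line_ne_zero v (X_add_C_ne_zero _ _)]
  simp only [(line_factor v k _).1]
  split_ifs <;> simp

theorem leadingCoeff_line_shift_fall (v w : Fin n → ℤ) (α : Fin n → ℕ) :
    (line v (shift w (fall α))).leadingCoeff =
      ∏ k, ∏ i ∈ Finset.range (α k), if v k = 0 then
        MvPolynomial.X k + MvPolynomial.C ((w k : ℂ) - i) else MvPolynomial.C (v k : ℂ) := by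
  rw [shift_fall, map_prod]
  simp only [map_prod]
  rw [Polynomial.leadingCoeff_prod]
  refine Finset.prod_congr rfl fun k _ => ?_
  rw [Polynomial.leadingCoeff_prod]
  exact Finset.prod_congr rfl fun i _ => (line_factor v k _).2

theorem eq_zero_of_isUnit_leadingCoeff (v w : Fin n → ℤ) (α : Fin n → ℕ)
    (h : IsUnit (line v (shift w (fall α))).leadingCoeff) (k : Fin n) (hk : v k = 0) :
    α k = 0 := by
  by_contra hα
  rw [leadingCoeff_line_shift_fall] at h
  have h1 := isUnit_of_dvd_unit (Finset.dvd_prod_of_mem _ (Finset.mem_univ k)) h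
  have h2 := isUnit_of_dvd_unit
    (Finset.dvd_prod_of_mem _ (Finset.mem_range.2 (Nat.pos_of_ne_zero hα))) h1
  rw [if_pos hk] at h2
  exact not_isUnit_X_add_C _ _ h2

/-! ### Weight vectors in a finite-dimensional Lie algebra -/

/-- The symbol as a linear map. -/
def symLin (n : ℕ) : Weyl n →ₗ[ℂ] MvPolynomial (Fin n) ℂ :=
  LinearMap.applyₗ 1 ∘ₗ (shiftRep n).toLinearMap

theorem symLin_apply (x : Weyl n) : symLin n x = sym x := rfl

theorem exists_totalDegree_le (W : Submodule ℂ (MvPolynomial (Fin n) ℂ)) [FiniteDimensional ℂ W] :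
    ∃ m, ∀ p ∈ W, p.totalDegree ≤ m := by
  obtain ⟨S, hS⟩ := (Module.Finite.iff_fg (N := W)).1 inferInstance
  refine ⟨S.sup MvPolynomial.totalDegree, fun p hp => ?_⟩
  have h : W ≤ MvPolynomial.restrictTotalDegree (Fin n) ℂ (S.sup MvPolynomial.totalDegree) := by
    rw [← hS, Submodule.span_le]
    intro q hq
    rw [SetLike.mem_coe, MvPolynomial.mem_restrictTotalDegree]
    exact Finset.le_sup (f := MvPolynomial.totalDegree) hq
  exact (MvPolynomial.mem_restrictTotalDegree _ _ _).1 (h hp)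

section finite

variable {V : Submodule ℂ (Weyl n)} [FiniteDimensional ℂ V]
  (hV : ∀ x ∈ V, ∀ y ∈ V, ⁅x, y⁆ ∈ V)

include hV

/-- Commuting `r` times with `f` multiplies the symbol of a weight vector by the `r`-th power of a
difference of the symbol of `f`; in a finite-dimensional space this difference must be constant. -/
theorem exists_difference_eq_C {f x : Weyl n} {v : Fin n → ℤ} (hf : f ∈ V) (hx : x ∈ V)
    (hf0 : IsWeight f 0) (hxv : IsWeight x v) (hne : x ≠ 0) :
    ∃ z : ℂ, sym f - shift v (sym f) = MvPolynomial.C z := by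
  set q := sym f - shift v (sym f) with hq
  have hpow : ∀ r : ℕ, ∃ y ∈ V, IsWeight y v ∧ sym y = sym x * q ^ r := by
    intro r
    induction r with
    | zero => exact ⟨x, hx, hxv, by rw [pow_zero, mul_one]⟩
    | succ r ih =>
      obtain ⟨y, hyV, hyv, hy⟩ := ih
      refine ⟨⁅f, y⁆, hV f hf y hyV, zero_add v ▸ hf0.lie hyv, ?_⟩
      rw [hf0.sym_lie hyv, shift_zero, pow_succ, ← mul_assoc, ← hy, hq]
      ring
  obtain ⟨m, hm⟩ := exists_totalDegree_le (V.map (symLin n))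
  have hs := hxv.sym_ne_zero hne
  by_cases hq0 : q = 0
  · exact ⟨0, by rw [hq0, map_zero]⟩
  · have hdeg : ∀ r : ℕ, (sym x * q ^ r).totalDegree = (sym x).totalDegree + r * q.totalDegree := by
      intro r
      induction r with
      | zero => rw [pow_zero, mul_one, zero_mul, add_zero]
      | succ r ih =>
        rw [pow_succ, ← mul_assoc, MvPolynomial.totalDegree_mul_of_isDomain
          (mul_ne_zero hs (pow_ne_zero r hq0)) hq0, ih]
        ring
    obtain ⟨y, hyV, -, hy⟩ := hpow (m + 1)
    have h1 := hm _ ⟨y, hyV, rfl⟩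
    rw [symLin_apply, hy, hdeg] at h1
    have h2 : q.totalDegree = 0 := by
      by_contra hcon
      have := Nat.le_mul_of_pos_right (m + 1) (Nat.pos_of_ne_zero hcon)
      omega
    exact ⟨_, MvPolynomial.totalDegree_eq_zero_iff_eq_C.1 h2⟩

/-- Along its weight `v`, the symbol of the product of `x` with an element of opposite weight is
quadratic with constant leading coefficient. -/
theorem natDegree_line_le_two {x y : Weyl n} {v : Fin n → ℤ} (hx : x ∈ V) (hy : y ∈ V)
    (hxv : IsWeight x v) (hyv : IsWeight y (-v)) (hne : x ≠ 0) :
    (line v (sym x * shift v (sym y))).natDegree ≤ 2 ∧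
      ∃ z : ℂ, (line v (sym x * shift v (sym y))).coeff 2 = MvPolynomial.C z := by
  have hw : IsWeight ⁅x, y⁆ 0 := add_neg_cancel v ▸ hxv.lie hyv
  obtain ⟨z, hz⟩ := exists_difference_eq_C hV (hV x hx y hy) hx hw hxv hne
  set G := sym x * shift v (sym y) with hG
  have h1 : sym ⁅x, y⁆ = G - shift (-v) G := by
    rw [hxv.sym_lie hyv, hG, map_mul, shift_shift, neg_add_cancel, shift_zero, mul_comm (sym y)]
  -- The difference for `f = [x, y]` is a second difference of `G`, here translated by `v`.
  have h2 : shift v (shift v G - G) - (shift v G - G) = MvPolynomial.C (-z) := by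
    have e : shift v (shift (-v) G) = G := by rw [shift_shift, add_neg_cancel, shift_zero]
    have := congrArg (shift v) hz
    simp only [h1, shift_C, map_sub, e] at this
    rw [map_sub, MvPolynomial.C_neg, ← this]
    ring
  set P := line v G
  set D := Polynomial.taylor 1 P - P with hD
  have h3 : line v (shift v G - G) = D := by rw [map_sub, line_shift]
  have h4 : Polynomial.taylor 1 D - D = Polynomial.C (MvPolynomial.C (-z)) := by
    have := congrArg (line v) h2
    rwa [map_sub, line_shift, h3, line_C] at this
  have h5 : D.natDegree ≤ 1 := natDegree_le_of_taylor_sub D 0 (by rw [h4, Polynomial.natDegree_C])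
  have h6 : P.natDegree ≤ 2 := natDegree_le_of_taylor_sub P 1 h5
  have h7 := coeff_taylor_sub D 0 h5
  have h8 := coeff_taylor_sub P 1 h6
  rw [h4, Polynomial.coeff_C_zero] at h7
  refine ⟨h6, -z / 2, ?_⟩
  rw [← hD] at h8
  norm_num at h7 h8
  rw [h8] at h7
  have h9 : (2 : MvPolynomial (Fin n) ℂ) = MvPolynomial.C 2 :=
    (map_ofNat MvPolynomial.C 2).symm
  have h10 : (2 : MvPolynomial (Fin n) ℂ) ≠ 0 := two_ne_zero
  refine mul_left_cancel₀ h10 ?_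
  rw [h9, ← map_mul, mul_div_cancel₀ _ (two_ne_zero), ← h9, MvPolynomial.C_neg, h7]

/-- Degrees along the weight, after splitting off from the symbols of `x` and `y` the factors
forced by their weights `v` and `-v`. -/
theorem sum_add_natDegree_le_two {x y : Weyl n} {v : Fin n → ℤ} (hx : x ∈ V) (hy : y ∈ V)
    (hxv : IsWeight x v) (hyv : IsWeight y (-v)) (hx0 : x ≠ 0) (hy0 : y ≠ 0)
    {u w : Fin n → ℕ} (hu : ∀ k, v k = 0 → u k = 0) (hw : ∀ k, v k = 0 → w k = 0)
    {h h' : MvPolynomial (Fin n) ℂ} (hsx : sym x = fall u * shift (fun k => -(u k : ℤ)) h)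
    (hsy : sym y = fall w * shift (fun k => -(w k : ℤ)) h') :
    ∑ k, u k + ∑ k, w k + (line v (shift (fun k => -(u k : ℤ)) h)).natDegree +
        (line v (shift v (shift (fun k => -(w k : ℤ)) h'))).natDegree ≤ 2 ∧
      (∑ k, u k + ∑ k, w k = 2 → IsUnit h) := by
  obtain ⟨h1, z, hz⟩ := natDegree_line_le_two hV hx hy hxv hyv hx0
  have hsx0 := hxv.sym_ne_zero hx0
  have hsy0 := hyv.sym_ne_zero hy0
  rw [hsx] at hsx0
  rw [hsy] at hsy0
  have a1 := line_ne_zero v (left_ne_zero_of_mul hsx0)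
  have a2 := line_ne_zero v (right_ne_zero_of_mul hsx0)
  have inj : ∀ p : MvPolynomial (Fin n) ℂ, p ≠ 0 → line v (shift v p) ≠ 0 := fun p hp =>
    line_ne_zero v fun h0 => hp (shift_injective v (h0.trans (map_zero _).symm))
  have a3 := inj _ (left_ne_zero_of_mul hsy0)
  have a4 := inj _ (right_ne_zero_of_mul hsy0)
  have hdu : (line v (fall u)).natDegree = ∑ k, u k := by
    rw [← shift_zero (fall u), natDegree_line_shift_fall]
    refine Finset.sum_congr rfl fun k _ => ?_
    split_ifs with hk
    · exact (hu k hk).symm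
    · rfl
  have hdw : (line v (shift v (fall w))).natDegree = ∑ k, w k := by
    rw [natDegree_line_shift_fall]
    refine Finset.sum_congr rfl fun k _ => ?_
    split_ifs with hk
    · exact (hw k hk).symm
    · rfl
  rw [hsx, hsy] at h1 hz
  simp only [map_mul] at h1 hz
  have hdeg : ((line v (fall u) * line v (shift (fun k => -(u k : ℤ)) h)) *
      (line v (shift v (fall w)) * line v (shift v (shift (fun k => -(w k : ℤ)) h')))).natDegree =
      ∑ k, u k + ∑ k, w k + (line v (shift (fun k => -(u k : ℤ)) h)).natDegree +
        (line v (shift v (shift (fun k => -(w k : ℤ)) h'))).natDegree := by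
    rw [Polynomial.natDegree_mul (mul_ne_zero a1 a2) (mul_ne_zero a3 a4),
      Polynomial.natDegree_mul a1 a2, Polynomial.natDegree_mul a3 a4, hdu, hdw]
    omega
  rw [hdeg] at h1
  refine ⟨h1, fun h2 => ?_⟩
  have hlead : ((line v (fall u) * line v (shift (fun k => -(u k : ℤ)) h)) *
      (line v (shift v (fall w)) *
        line v (shift v (shift (fun k => -(w k : ℤ)) h')))).leadingCoeff = MvPolynomial.C z := by
    rw [Polynomial.leadingCoeff, hdeg, ← hz]
    congr 1
    omega
  have hz0 : z ≠ 0 := by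
    rintro rfl
    rw [map_zero, Polynomial.leadingCoeff_eq_zero] at hlead
    exact mul_ne_zero (mul_ne_zero a1 a2) (mul_ne_zero a3 a4) hlead
  have hunit : IsUnit (MvPolynomial.C (σ := Fin n) z) := (isUnit_iff_ne_zero.2 hz0).map _
  rw [← hlead, Polynomial.leadingCoeff_mul, Polynomial.leadingCoeff_mul, line_eq_C (v := v)
    (p := shift (fun k => -(u k : ℤ)) h) (by omega), Polynomial.leadingCoeff_C] at hunit
  have h3 := (isUnit_of_mul_isUnit_right (isUnit_of_mul_isUnit_left hunit)).map
    (shift fun k => (u k : ℤ))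
  rw [shift_shift] at h3
  have h4 : ((fun k => (u k : ℤ)) + fun k => -(u k : ℤ)) = 0 := by
    ext k
    simp
  rwa [h4, shift_zero] at h3

end finite

/-- A weight vector is divisible by the monomial of least degree of its weight. -/
theorem IsWeight.exists_sym_eq {x : Weyl n} {v : Fin n → ℤ} (hx : IsWeight x v) :
    ∃ h, sym x = fall (fun k => (-v k).toNat) * shift (fun k => -((-v k).toNat : ℤ)) h := by
  refine ⟨∑ γ ∈ ((monoBasis n).repr x).support,
    coeff x γ • fall (γ.1 - fun k => (-v k).toNat), ?_⟩
  rw [sym_eq_sum, map_sum, Finset.mul_sum]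
  refine Finset.sum_congr rfl fun γ hγ => ?_
  rw [map_smul, mul_smul_comm, ← fall_add]
  congr 2
  ext k
  have := hx γ (Finsupp.mem_support_iff.1 hγ) k
  simp only [Pi.add_apply, Pi.sub_apply]
  omega

theorem sum_toNat_add (v : Fin n → ℤ) :
    ∑ k, (-v k).toNat + ∑ k, (v k).toNat = ∑ k, (v k).natAbs := by
  rw [← Finset.sum_add_distrib]
  exact Finset.sum_congr rfl fun k _ => by omega

section finite

variable {V : Submodule ℂ (Weyl n)} [FiniteDimensional ℂ V]
  (hV : ∀ x ∈ V, ∀ y ∈ V, ⁅x, y⁆ ∈ V)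

include hV

/-- In a finite-dimensional Lie algebra, paired weight vectors of weight of length at least two
are quadratic. -/
theorem quadratic_of_two_le {x y : Weyl n} {v : Fin n → ℤ} (hx : x ∈ V) (hy : y ∈ V)
    (hxv : IsWeight x v) (hyv : IsWeight y (-v)) (hx0 : x ≠ 0) (hy0 : y ≠ 0)
    (hv : 2 ≤ ∑ k, (v k).natAbs) :
    ∑ k, (v k).natAbs = 2 ∧ ∀ γ, coeff x γ ≠ 0 → deg γ.1 γ.2 = 2 := by
  obtain ⟨h, hh⟩ := hxv.exists_sym_eq
  obtain ⟨h', hh'⟩ := hyv.exists_sym_eq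
  simp only [Pi.neg_apply, neg_neg] at hh'
  obtain ⟨h1, h2⟩ := sum_add_natDegree_le_two hV hx hy hxv hyv hx0 hy0
    (fun k hk => by simp [hk]) (fun k hk => by simp [hk]) hh hh'
  rw [sum_toNat_add] at h1 h2
  have h3 : ∑ k, (v k).natAbs = 2 := by omega
  refine ⟨h3, fun γ hγ => ?_⟩
  obtain ⟨z, -, hz⟩ := MvPolynomial.isUnit_iff_eq_C_of_isReduced.1 (h2 h3)
  have hm := isWeight_mono (fun k => (-v k).toNat) fun k => (v k).toNat
  have e : (fun k => ((v k).toNat : ℤ) - (-v k).toNat) = v := by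
    ext k
    omega
  rw [e] at hm
  have hxe : x = z • mono (fun k => (-v k).toNat) fun k => (v k).toNat := by
    refine hxv.eq_of_sym_eq (hm.smul z) ?_
    rw [hh, hz, shift_C, sym_smul, sym_mono, mul_comm, MvPolynomial.smul_eq_C_mul]
  have hγ2 : γ = (fun k => (-v k).toNat, fun k => (v k).toNat) := by
    by_contra hcon
    rw [hxe, coeff_smul, coeff_mono_of_ne hcon, mul_zero] at hγ
    exact hγ rfl
  rw [hγ2, deg, sum_toNat_add, h3]

/-- Off-diagonal monomials in a finite-dimensional Lie algebra are quadratic, or a single creation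
or annihilation operator times a diagonal monomial in the other modes. -/
theorem deg_eq_two_or_single_mode {α β : Fin n → ℕ} (h1 : mono α β ∈ V) (h2 : mono β α ∈ V)
    (hne : α ≠ β) : deg α β = 2 ∨ ∃ k, α k + β k = 1 ∧ ∀ j, j ≠ k → α j = β j := by
  set v : Fin n → ℤ := fun k => (β k : ℤ) - α k with hv
  have hxv : IsWeight (mono α β) v := isWeight_mono α β
  have hyv : IsWeight (mono β α) (-v) := by
    convert isWeight_mono β α using 1
    ext k
    simp [hv]
  rcases le_or_gt 2 (∑ k, (v k).natAbs) with hs | hs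
  · exact Or.inl ((quadratic_of_two_le hV h1 h2 hxv hyv (mono_ne_zero _ _)
      (mono_ne_zero _ _) hs).2 (α, β) (by rw [coeff_mono_self]; exact one_ne_zero))
  · right
    obtain ⟨k, hk⟩ : ∃ k, v k ≠ 0 := by
      by_contra hcon
      push Not at hcon
      refine hne (funext fun k => ?_)
      have := hcon k
      simp only [hv] at this
      omega
    have hle := Finset.add_sum_erase Finset.univ (fun k => (v k).natAbs) (Finset.mem_univ k)
    have hk1 : (v k).natAbs = 1 := by omega
    have hrest : ∑ j ∈ Finset.univ.erase k, (v j).natAbs = 0 := by omega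
    have hj : ∀ j, j ≠ k → v j = 0 := fun j hjk =>
      Int.natAbs_eq_zero.1 ((Finset.sum_eq_zero_iff.1 hrest) j (by simp [hjk]))
    let μ : Fin n → ℕ := fun j => min (α j) (β j)
    have e1 : sym (mono α β : Weyl n) = fall (fun k => (-v k).toNat) *
        shift (fun k => -((-v k).toNat : ℤ)) (fall μ) := by
      rw [sym_mono, ← fall_add]
      congr 1
      ext j
      simp only [hv, μ, Pi.add_apply]
      omega
    have e2 : sym (mono β α : Weyl n) = fall (fun k => (v k).toNat) *
        shift (fun k => -((v k).toNat : ℤ)) (fall μ) := by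
      rw [sym_mono, ← fall_add]
      congr 1
      ext j
      simp only [hv, μ, Pi.add_apply]
      omega
    obtain ⟨h3, -⟩ := sum_add_natDegree_le_two hV h1 h2 hxv hyv (mono_ne_zero _ _)
      (mono_ne_zero _ _) (fun k hk => by simp [hk]) (fun k hk => by simp [hk]) e1 e2
    rw [shift_shift, natDegree_line_shift_fall, natDegree_line_shift_fall, sum_toNat_add] at h3
    have h4 := Finset.single_le_sum (f := fun k => if v k = 0 then 0 else μ k)
      (fun _ _ => Nat.zero_le _) (Finset.mem_univ k)
    simp only [if_neg hk] at h4
    have hμ : μ k = 0 := by omega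
    refine ⟨k, ?_, fun j hjk => ?_⟩
    · simp only [μ, hv] at hμ hk1
      omega
    · have := hj j hjk
      simp only [hv] at this
      omega

/-- A diagonal monomial of degree at least four in a finite-dimensional Lie algebra commutes with
all monomials in it. -/
theorem lie_diagonal_eq_zero {μ α β : Fin n → ℕ} (hμ : 2 ≤ ∑ k, μ k) (h1 : mono μ μ ∈ V)
    (h2 : mono α β ∈ V) : ⁅(mono μ μ : Weyl n), (mono α β : Weyl n)⁆ = 0 := by
  set v : Fin n → ℤ := fun k => (β k : ℤ) - α k with hv
  have hxv : IsWeight (mono α β) v := isWeight_mono α β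
  have hf0 : IsWeight (mono μ μ : Weyl n) 0 := by
    convert isWeight_mono μ μ using 1
    ext k
    simp
  obtain ⟨z, hz⟩ := exists_difference_eq_C hV h1 h2 hf0 hxv (mono_ne_zero _ _)
  rw [sym_mono] at hz
  suffices hs : shift v (fall μ) = fall μ by
    by_contra hcon
    refine (hf0.lie hxv).sym_ne_zero hcon ?_
    rw [hf0.sym_lie hxv, sym_mono, sym_mono, hs, shift_zero, mul_comm, sub_self]
  set P := line v (fall μ) with hP
  have h3 : Polynomial.taylor 1 P - P = Polynomial.C (MvPolynomial.C (-z)) := by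
    rw [hP, ← line_shift, ← map_sub, ← line_C, MvPolynomial.C_neg, ← hz, neg_sub]
  have h4 : P.natDegree ≤ 1 := natDegree_le_of_taylor_sub P 0 (by rw [h3, Polynomial.natDegree_C])
  rcases Nat.le_one_iff_eq_zero_or_eq_one.1 h4 with h5 | h5
  · refine line_injective v ?_
    rw [line_shift, line_eq_C h5, Polynomial.taylor_C]
  · exfalso
    have h6 := coeff_taylor_sub P 0 h4
    rw [h3, Polynomial.coeff_C_zero] at h6
    have h7 : P.leadingCoeff = MvPolynomial.C (-z) := by
      rw [Polynomial.leadingCoeff, h5, h6]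
      simp
    have hz0 : -z ≠ 0 := fun h0 => by
      rw [h0, map_zero] at h7
      exact line_ne_zero v (fall_ne_zero μ) (Polynomial.leadingCoeff_eq_zero.1 h7)
    have hunit : IsUnit P.leadingCoeff := by
      rw [h7]
      exact (isUnit_iff_ne_zero.2 hz0).map _
    have h8 : P.natDegree = ∑ k, if v k = 0 then 0 else μ k := by
      rw [hP, ← shift_zero (fall μ), natDegree_line_shift_fall]
    have h9 : ∑ k, μ k = ∑ k, if v k = 0 then 0 else μ k := by
      refine Finset.sum_congr rfl fun k _ => ?_
      split_ifs with hk
      · rw [hP, ← shift_zero (fall μ)] at hunit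
        exact eq_zero_of_isUnit_leadingCoeff v 0 μ hunit k hk
      · rfl
    omega

end finite

/-! ### Multi-indices -/

theorem deg_eq_sum (α β : Fin n → ℕ) : deg α β = ∑ k, (α k + β k) := by
  rw [deg, Finset.sum_add_distrib]

theorem deg_eq_add (α β : Fin n → ℕ) (k : Fin n) :
    deg α β = α k + β k + ∑ j ∈ Finset.univ.erase k, (α j + β j) := by
  rw [deg_eq_sum, Finset.add_sum_erase Finset.univ (fun k => α k + β k) (Finset.mem_univ k)]

theorem deg_self (α : Fin n → ℕ) : deg α α = 2 * ∑ k, α k := by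
  rw [deg, two_mul]

theorem eq_zero_of_deg_erase {α β : Fin n → ℕ} {k : Fin n}
    (h : ∑ j ∈ Finset.univ.erase k, (α j + β j) = 0) {j : Fin n} (hj : j ≠ k) :
    α j = 0 ∧ β j = 0 := by
  have := (Finset.sum_eq_zero_iff.1 h) j (by simp [hj])
  omega

theorem exists_pos_of_deg_ne_zero {α β : Fin n → ℕ} (h : deg α β ≠ 0) :
    ∃ k, α k + β k ≠ 0 := by
  by_contra hcon
  push Not at hcon
  exact h (by rw [deg_eq_sum]; exact Finset.sum_eq_zero fun k _ => hcon k)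

/-- The pair `(α, β)` is balanced in all modes except one, in which it has degree one. -/
def SingleMode (α β : Fin n → ℕ) : Prop :=
  ∃ k, α k + β k = 1 ∧ ∀ j, j ≠ k → α j = β j

theorem SingleMode.symm {α β : Fin n → ℕ} (h : SingleMode α β) : SingleMode β α := by
  obtain ⟨k, hk, hj⟩ := h
  exact ⟨k, by omega, fun j hjk => (hj j hjk).symm⟩

theorem singleMode_of_deg_eq_one {α β : Fin n → ℕ} (h : deg α β = 1) : SingleMode α β := by
  obtain ⟨k, hk⟩ := exists_pos_of_deg_ne_zero (by rw [h]; exact one_ne_zero)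
  rw [deg_eq_add α β k] at h
  refine ⟨k, by omega, fun j hj => ?_⟩
  have := eq_zero_of_deg_erase (α := α) (β := β) (k := k) (by omega) hj
  omega

theorem SingleMode.odd_deg {α β : Fin n → ℕ} (h : SingleMode α β) : Odd (deg α β) := by
  obtain ⟨k, hk, hj⟩ := h
  rw [deg_eq_add α β k, hk]
  refine ⟨∑ j ∈ Finset.univ.erase k, α j, ?_⟩
  rw [add_comm, Finset.mul_sum]
  congr 1
  refine Finset.sum_congr rfl fun j hjk => ?_
  rw [hj j (Finset.ne_of_mem_erase hjk), two_mul]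

theorem SingleMode.ne {α β : Fin n → ℕ} (h : SingleMode α β) : α ≠ β := by
  rintro rfl
  obtain ⟨k, hk, -⟩ := h
  omega

theorem SingleMode.sum_natAbs {α β : Fin n → ℕ} (h : SingleMode α β) :
    ∑ k, ((β k : ℤ) - α k).natAbs = 1 := by
  obtain ⟨k, hk, hj⟩ := h
  rw [Finset.sum_eq_single k]
  · omega
  · intro j _ hjk
    rw [hj j hjk, sub_self, Int.natAbs_zero]
  · simp

/-- A pair of multi-indices of one uncompensated mode has the form `(μ, μ + e_k)`, up to
exchange. -/
theorem SingleMode.exists_eq {α β : Fin n → ℕ} (h : SingleMode α β) :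
    ∃ μ k, μ k = 0 ∧ ((α = μ ∧ β = μ + Pi.single k 1) ∨ (α = μ + Pi.single k 1 ∧ β = μ)) := by
  obtain ⟨k, hk, hj⟩ := h
  rcases Nat.eq_zero_or_pos (α k) with h0 | h0
  · refine ⟨α, k, h0, Or.inl ⟨rfl, funext fun j => ?_⟩⟩
    rcases eq_or_ne j k with rfl | hjk
    · simp
      omega
    · simp [hjk, hj j hjk]
  · refine ⟨β, k, by omega, Or.inr ⟨funext fun j => ?_, rfl⟩⟩
    rcases eq_or_ne j k with rfl | hjk
    · simp
      omega
    · simp [hjk, hj j hjk]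

theorem singleMode_add_single {μ : Fin n → ℕ} {k : Fin n} (hk : μ k = 0) :
    SingleMode μ (μ + Pi.single k 1) :=
  ⟨k, by simp [hk], fun j hj => by simp [hj]⟩

theorem deg_add_single (μ : Fin n → ℕ) (k : Fin n) :
    deg μ (μ + Pi.single k 1) = 2 * ∑ j, μ j + 1 := by
  rw [deg]
  simp [Finset.sum_add_distrib]
  ring

theorem sum_eq_zero_iff_eq_zero {μ : Fin n → ℕ} : ∑ j, μ j = 0 ↔ μ = 0 := by
  rw [Finset.sum_eq_zero_iff]
  exact ⟨fun h => funext fun j => h j (Finset.mem_univ j), fun h j _ => by rw [h]; rfl⟩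

theorem disjoint_of_deg_eq_two {α β : Fin n → ℕ} (h : deg α β = 2) (hne : α ≠ β) (j : Fin n) :
    α j = 0 ∨ β j = 0 := by
  by_contra hcon
  push Not at hcon
  rw [deg_eq_add α β j] at h
  refine hne (funext fun i => ?_)
  rcases eq_or_ne i j with rfl | hij
  · omega
  · have := eq_zero_of_deg_erase (α := α) (β := β) (k := j) (by omega) hij
    omega

/-! ### The subspaces in terms of normal-ordered coefficients -/

theorem spanG_sup (P Q : (Fin n → ℕ) → (Fin n → ℕ) → Prop) :
    spanG P ⊔ spanG Q = spanG fun α β => P α β ∨ Q α β := by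
  rw [spanG, spanG, spanG, ← Submodule.span_union]
  congr 1
  ext x
  constructor
  · rintro (⟨σ, α, β, h, rfl⟩ | ⟨σ, α, β, h, rfl⟩)
    · exact ⟨σ, α, β, Or.inl h, rfl⟩
    · exact ⟨σ, α, β, Or.inr h, rfl⟩
  · rintro ⟨σ, α, β, h | h, rfl⟩
    · exact Or.inl ⟨σ, α, β, h, rfl⟩
    · exact Or.inr ⟨σ, α, β, h, rfl⟩

theorem of_mem_spanG {P : (Fin n → ℕ) → (Fin n → ℕ) → Prop} (hP : ∀ α β, P α β → P β α)
    {x : skewWeyl n} (hx : x ∈ spanG P) (γ) (hγ : coeff (x : Weyl n) γ ≠ 0) : P γ.1 γ.2 := by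
  by_contra hcon
  refine hγ ?_
  induction hx using Submodule.span_induction with
  | mem x hx =>
    obtain ⟨σ, α, β, h, rfl⟩ := hx
    refine coeff_g_eq_zero _ _ _ _ ?_ ?_
    · rintro rfl
      exact hcon h
    · rintro rfl
      exact hcon (hP _ _ h)
  | zero => rw [skew_coe_zero, coeff_zero]
  | add x y _ _ hx hy =>
    by_contra hne
    rw [skew_coe_add, coeff_add] at hne
    by_cases h1 : coeff (x : Weyl n) γ = 0
    · by_cases h2 : coeff (y : Weyl n) γ = 0
      · exact hne (by rw [h1, h2, add_zero])
      · exact h2 (hy h2)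
    · exact h1 (hx h1)
  | smul r x _ hx =>
    by_cases h1 : coeff (x : Weyl n) γ = 0
    · rw [skew_coe_smul, coeff_real_smul, h1, mul_zero]
    · exact absurd (hx h1) h1

theorem mem_spanG_iff {P : (Fin n → ℕ) → (Fin n → ℕ) → Prop} (hP : ∀ α β, P α β → P β α)
    {x : skewWeyl n} :
    x ∈ spanG P ↔ ∀ γ, coeff (x : Weyl n) γ ≠ 0 → P γ.1 γ.2 := by
  refine ⟨of_mem_spanG hP, fun h => ?_⟩
  have htop : spanG P ⊔ spanG (fun α β => ¬ P α β) = ⊤ := by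
    rw [spanG_sup, ← spanG_true]
    congr 1
    ext α β
    exact ⟨fun _ => trivial, fun _ => em _⟩
  obtain ⟨y, hy, z, hz, rfl⟩ := Submodule.mem_sup.1 (htop.symm ▸ Submodule.mem_top : x ∈ _)
  have hz0 : z = 0 := by
    refine Subtype.ext (weyl_ext fun γ => ?_)
    rw [skew_coe_zero, coeff_zero]
    by_contra hne
    have h1 := of_mem_spanG (fun α β h' h'' => h' (hP _ _ h'')) hz γ hne
    have h2 : coeff (y : Weyl n) γ = 0 := by
      by_contra hne2
      exact h1 (of_mem_spanG hP hy γ hne2)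
    exact h1 (h γ (by rwa [skew_coe_add, coeff_add, h2, zero_add]))
  rw [hz0, add_zero]
  exact hy

theorem mem_A2_iff {x : skewWeyl n} : x ∈ A2 n ↔
    ∀ γ, coeff (x : Weyl n) γ ≠ 0 → γ.1 ≠ γ.2 ∧ deg γ.1 γ.2 = 2 :=
  mem_spanG_iff fun α β h => ⟨h.1.symm, (deg_comm β α).trans h.2⟩

theorem mem_Aeq_iff {x : skewWeyl n} : x ∈ Aeq n ↔
    ∀ γ, coeff (x : Weyl n) γ ≠ 0 → γ.1 = γ.2 ∧ 4 ≤ deg γ.1 γ.2 :=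
  mem_spanG_iff fun α β h => ⟨h.1.symm, deg_comm α β ▸ h.2⟩

theorem mem_Aom_iff {x : skewWeyl n} : x ∈ Aom n ↔
    ∀ γ, coeff (x : Weyl n) γ ≠ 0 → 3 ≤ deg γ.1 γ.2 ∧ SingleMode γ.1 γ.2 :=
  mem_spanG_iff (P := fun α β => 3 ≤ deg α β ∧ SingleMode α β)
    fun α β h => ⟨deg_comm α β ▸ h.1, h.2.symm⟩

theorem mem_Acore_iff {x : skewWeyl n} : x ∈ Acore n ↔
    ∀ γ, coeff (x : Weyl n) γ ≠ 0 → γ.1 = γ.2 ∨ deg γ.1 γ.2 = 2 ∨ SingleMode γ.1 γ.2 := by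
  have h : Acore n = spanG fun α β => α = β ∨ deg α β = 2 ∨ SingleMode α β := by
    rw [Acore, A0, A1, A2, Aeq, Aom, spanG_sup, spanG_sup, spanG_sup, spanG_sup]
    congr 1
    ext α β
    constructor
    · rintro ((((h | h) | h) | h) | h)
      · exact Or.inl h.1
      · exact Or.inr (Or.inr (singleMode_of_deg_eq_one h))
      · exact Or.inr (Or.inl h.2)
      · exact Or.inl h.1
      · exact Or.inr (Or.inr h.2)
    · intro h
      by_cases he : α = β
      · subst he
        have := deg_self α
        by_cases h4 : 4 ≤ deg α α
        · exact Or.inl (Or.inr ⟨rfl, h4⟩)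
        · exact Or.inl (Or.inl (Or.inl (Or.inl ⟨rfl, by omega⟩)))
      · rcases h with h | h | h
        · exact absurd h he
        · exact Or.inl (Or.inl (Or.inr ⟨he, h⟩))
        · obtain ⟨m, hm⟩ := h.odd_deg
          by_cases h1 : deg α β = 1
          · exact Or.inl (Or.inl (Or.inl (Or.inr h1)))
          · exact Or.inr ⟨by omega, h⟩
  rw [h]
  refine mem_spanG_iff fun α β h => ?_
  rcases h with h | h | h
  · exact Or.inl h.symm
  · exact Or.inr (Or.inl ((deg_comm β α).trans h))
  · exact Or.inr (Or.inr h.symm)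

theorem projPerp_eq_zero_iff {x : skewWeyl n} : projPerp n x = 0 ↔ x ∈ Acore n :=
  Submodule.projection_apply_eq_zero_iff _

/-! ### Generators as combinations of adjoint pairs of monomials -/

/-- The element `x` is a nonzero combination of `a^(α,β)` and of its adjoint, with both
coefficients nonzero. -/
def IsPair (x : skewWeyl n) (α β : Fin n → ℕ) : Prop :=
  ∃ z z' : ℂ, z ≠ 0 ∧ z' ≠ 0 ∧ (α = β → z + z' ≠ 0) ∧
    (x : Weyl n) = z • mono α β + z' • mono β α

theorem IsPair.symm {x : skewWeyl n} {α β : Fin n → ℕ} (h : IsPair x α β) : IsPair x β α := by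
  obtain ⟨z, z', hz, hz', hd, hx⟩ := h
  exact ⟨z', z, hz', hz, fun he => by rw [add_comm]; exact hd he.symm, by rw [hx, add_comm]⟩

theorem IsPair.coeff_ne_zero {x : skewWeyl n} {α β : Fin n → ℕ} (h : IsPair x α β) :
    coeff (x : Weyl n) (α, β) ≠ 0 := by
  obtain ⟨z, z', hz, hz', hd, hx⟩ := h
  rw [hx, coeff_add, coeff_smul, coeff_smul, coeff_mono_self, mul_one]
  by_cases he : α = β
  · subst he
    rw [coeff_mono_self, mul_one]
    exact hd rfl
  · rw [coeff_mono_of_ne (by simp [he]), mul_zero, add_zero]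
    exact hz

theorem IsPair.eq_of_coeff_ne_zero {x : skewWeyl n} {α β : Fin n → ℕ} (h : IsPair x α β) {γ}
    (hγ : coeff (x : Weyl n) γ ≠ 0) : γ = (α, β) ∨ γ = (β, α) := by
  obtain ⟨z, z', -, -, -, hx⟩ := h
  by_contra hcon
  push Not at hcon
  rw [hx, coeff_add, coeff_smul, coeff_smul, coeff_mono_of_ne hcon.1, coeff_mono_of_ne hcon.2,
    mul_zero, mul_zero, add_zero] at hγ
  exact hγ rfl

theorem IsPair.ne_zero {x : skewWeyl n} {α β : Fin n → ℕ} (h : IsPair x α β) : x ≠ 0 := by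
  rintro rfl
  exact h.coeff_ne_zero (by rw [skew_coe_zero, coeff_zero])

theorem isPair_g {σ : Sgn} {α β : Fin n → ℕ} (h : g σ α β ≠ 0) : IsPair (g σ α β) α β := by
  cases σ with
  | plus =>
    refine ⟨Complex.I, Complex.I, Complex.I_ne_zero, Complex.I_ne_zero, fun _ => ?_, ?_⟩
    · rw [← two_mul]
      exact mul_ne_zero two_ne_zero Complex.I_ne_zero
    · change Complex.I • (mono β α + mono α β) = _
      rw [smul_add, add_comm]
  | minus =>
    refine ⟨-1, 1, neg_ne_zero.2 one_ne_zero, one_ne_zero, fun he => ?_, ?_⟩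
    · subst he
      exact absurd (Subtype.ext (sub_self (mono α α))) h
    · change mono β α - mono α β = _
      rw [neg_one_smul, one_smul, sub_eq_neg_add]

theorem mono_single (k : Fin n) : mono (Pi.single k 1) (Pi.single k 1) = num k := by
  rw [mono, powProd_single, powProd_single, num]

theorem isPair_free (k : Fin n) : IsPair (free k) (Pi.single k 1) (Pi.single k 1) := by
  have hI : Complex.I / 2 ≠ 0 := div_ne_zero Complex.I_ne_zero two_ne_zero
  refine ⟨Complex.I / 2, Complex.I / 2, hI, hI, fun _ => ?_, ?_⟩
  · rw [add_halves]
    exact Complex.I_ne_zero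
  · rw [← add_smul, add_halves, mono_single]
    rfl

theorem IsPair.lie_eq {x y : skewWeyl n} {α β α' β' : Fin n → ℕ} (hx : IsPair x α β)
    (hy : IsPair y α' β') : ∃ z z' w w' : ℂ, z ≠ 0 ∧ w ≠ 0 ∧ ((⁅x, y⁆ : skewWeyl n) : Weyl n) =
      (z * w) • ⁅(mono α β : Weyl n), (mono α' β' : Weyl n)⁆ +
      (z * w') • ⁅(mono α β : Weyl n), (mono β' α' : Weyl n)⁆ +
      (z' * w) • ⁅(mono β α : Weyl n), (mono α' β' : Weyl n)⁆ +
      (z' * w') • ⁅(mono β α : Weyl n), (mono β' α' : Weyl n)⁆ := by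
  obtain ⟨z, z', hz, -, -, hx⟩ := hx
  obtain ⟨w, w', hw, -, -, hy⟩ := hy
  refine ⟨z, z', w, w', hz, hw, ?_⟩
  rw [LieSubalgebra.coe_bracket, hx, hy]
  simp only [Ring.lie_def, add_mul, mul_add, smul_mul_assoc, mul_smul_comm, smul_sub, mul_smul]
  module

/-- A monomial occurring in a bracket of two pairs occurs in one of the four brackets of
monomials. -/
theorem IsPair.coeff_lie {x y : skewWeyl n} {α β α' β' : Fin n → ℕ} (hx : IsPair x α β)
    (hy : IsPair y α' β') {P : (Fin n → ℕ) × (Fin n → ℕ) → Prop}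
    (h : ∀ a b a' b', IsPair x a b → IsPair y a' b' → ((a = α ∧ b = β) ∨ (a = β ∧ b = α)) →
      ((a' = α' ∧ b' = β') ∨ (a' = β' ∧ b' = α')) →
      ∀ γ, coeff ⁅(mono a b : Weyl n), (mono a' b' : Weyl n)⁆ γ ≠ 0 → P γ)
    (γ) (hγ : coeff ((⁅x, y⁆ : skewWeyl n) : Weyl n) γ ≠ 0) : P γ := by
  obtain ⟨z, z', w, w', -, -, he⟩ := hx.lie_eq hy
  by_contra hcon
  have h0 : ∀ a b a' b', IsPair x a b → IsPair y a' b' → ((a = α ∧ b = β) ∨ (a = β ∧ b = α)) →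
      ((a' = α' ∧ b' = β') ∨ (a' = β' ∧ b' = α')) →
      coeff ⁅(mono a b : Weyl n), (mono a' b' : Weyl n)⁆ γ = 0 := by
    intro a b a' b' h1 h2 h3 h4
    by_contra hne
    exact hcon (h a b a' b' h1 h2 h3 h4 γ hne)
  refine hγ ?_
  rw [he, coeff_add, coeff_add, coeff_add, coeff_smul, coeff_smul, coeff_smul, coeff_smul,
    h0 α β α' β' hx hy (by simp) (by simp), h0 α β β' α' hx hy.symm (by simp) (by simp),
    h0 β α α' β' hx.symm hy (by simp) (by simp), h0 β α β' α' hx.symm hy.symm (by simp) (by simp)]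
  simp

/-- In the bracket of two pairs, the bracket of the monomials of weights `v` and `w` cannot cancel
if `v`, `w` and `v + w` are nonzero, since the other three brackets of monomials then have different
weights. -/
theorem IsPair.coeff_lie_ne_zero {x y : skewWeyl n} {α β α' β' : Fin n → ℕ} (hx : IsPair x α β)
    (hy : IsPair y α' β') (h1 : α ≠ β) (h2 : α' ≠ β')
    (h3 : ∃ k, (β k : ℤ) - α k + (β' k - α' k) ≠ 0) {γ}
    (hγ : coeff ⁅(mono α β : Weyl n), (mono α' β' : Weyl n)⁆ γ ≠ 0) :
    coeff ((⁅x, y⁆ : skewWeyl n) : Weyl n) γ ≠ 0 := by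
  obtain ⟨z, z', w, w', hz, hw, he⟩ := hx.lie_eq hy
  have hγw := ((isWeight_mono α β).lie (isWeight_mono α' β')) γ hγ
  obtain ⟨i, hi⟩ := Function.ne_iff.1 h1
  obtain ⟨j, hj⟩ := Function.ne_iff.1 h2
  obtain ⟨k, hk⟩ := h3
  have e1 : coeff ⁅(mono α β : Weyl n), (mono β' α' : Weyl n)⁆ γ = 0 := by
    by_contra hne
    have a := ((isWeight_mono α β).lie (isWeight_mono β' α')) γ hne j
    have b := hγw j
    simp only [Pi.add_apply] at a b
    omega
  have e2 : coeff ⁅(mono β α : Weyl n), (mono α' β' : Weyl n)⁆ γ = 0 := by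
    by_contra hne
    have a := ((isWeight_mono β α).lie (isWeight_mono α' β')) γ hne i
    have b := hγw i
    simp only [Pi.add_apply] at a b
    omega
  have e3 : coeff ⁅(mono β α : Weyl n), (mono β' α' : Weyl n)⁆ γ = 0 := by
    by_contra hne
    have a := ((isWeight_mono β α).lie (isWeight_mono β' α')) γ hne k
    have b := hγw k
    simp only [Pi.add_apply] at a b
    omega
  rw [he, coeff_add, coeff_add, coeff_add, coeff_smul, coeff_smul, coeff_smul, coeff_smul,
    e1, e2, e3, mul_zero, mul_zero, mul_zero, add_zero, add_zero, add_zero]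
  exact mul_ne_zero (mul_ne_zero hz hw) hγ

/-! ### Nonvanishing brackets -/

theorem sum_natAbs_quadratic_add_single {α β μ : Fin n → ℕ} {k : Fin n} (hd : deg α β = 2)
    (hne : α ≠ β) (hα : α k = 0) :
    ∑ j, ((β j : ℤ) - α j + (((μ + Pi.single k 1 : Fin n → ℕ) j : ℤ) - μ j)).natAbs = 3 := by
  have h : ∀ j, ((β j : ℤ) - α j + (((μ + Pi.single k 1 : Fin n → ℕ) j : ℤ) - μ j)).natAbs =
      (α j + β j) + (Pi.single k 1 : Fin n → ℕ) j := by
    intro j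
    have := disjoint_of_deg_eq_two hd hne j
    rcases eq_or_ne j k with rfl | hj
    · simp
      omega
    · simp [hj]
      omega
  simp only [h]
  rw [Finset.sum_add_distrib, ← deg_eq_sum, hd]
  simp

/-- A quadratic monomial does not commute with `a^(μ,μ) a_k` if it changes the occupation number of
a mode of `μ`. Evaluating symbols just below the zero set of the falling factorial of `μ`, exactly
one of the two terms of the commutator survives. -/
theorem lie_quadratic_ne_zero {α β μ : Fin n → ℕ} {i k : Fin n} (hd : deg α β = 2) (hne : α ≠ β)
    (hi : μ i ≠ 0) (hab : α i + β i ≠ 0) :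
    ⁅(mono α β : Weyl n), (mono μ (μ + Pi.single k 1) : Weyl n)⁆ ≠ 0 := by
  intro h0
  have h1 := congrArg sym h0
  rw [(isWeight_mono α β).sym_lie (isWeight_mono μ _), sym_mono, sym_mono, sym, map_zero,
    LinearMap.zero_apply] at h1
  -- At `μ - e_i + f` the polynomial `fall μ` is nonzero iff `f i ≥ 1`, and the two values of `f`
  -- that occur are `α` and, after translation by `β - α`, `β`.
  let m : Fin n → ℕ := fun j => μ j - (Pi.single i 1 : Fin n → ℕ) j + α j
  have h2 := congrArg (MvPolynomial.eval fun j => (m j : ℂ)) h1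
  rw [map_sub, map_mul, map_mul, map_zero,
    eval_shift _ _ (fun j => ((μ j - (Pi.single i 1 : Fin n → ℕ) j + β j : ℕ) : ℂ))
      (fun j => by simp only [m]; push_cast; ring),
    eval_shift _ _ (fun j => ((m j + (Pi.single k 1 : Fin n → ℕ) j : ℕ) : ℂ))
      (fun j => by push_cast [Pi.add_apply]; ring)] at h2
  have a1 := (eval_fall_ne_zero_iff α m).2 fun j => Nat.le_add_left _ _
  have a2 := (eval_fall_ne_zero_iff α fun j => m j + (Pi.single k 1 : Fin n → ℕ) j).2 fun j =>
    (Nat.le_add_left _ _).trans (Nat.le_add_right _ _)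
  have hdis := disjoint_of_deg_eq_two hd hne i
  have hle : ∀ f : Fin n → ℕ, (∀ j, μ j ≤ μ j - (Pi.single i 1 : Fin n → ℕ) j + f j) ↔ 1 ≤ f i := by
    intro f
    constructor
    · intro h
      have := h i
      rw [Pi.single_eq_same] at this
      omega
    · intro h j
      rcases eq_or_ne j i with rfl | hj
      · rw [Pi.single_eq_same]
        omega
      · rw [Pi.single_eq_of_ne hj]
        omega
  have b1 := (eval_fall_ne_zero_iff μ m).trans (hle α)
  have b2 := (eval_fall_ne_zero_iff μ
    fun j => μ j - (Pi.single i 1 : Fin n → ℕ) j + β j).trans (hle β)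
  rcases hdis with h | h
  · have c1 := not_not.1 (mt b1.1 (by omega))
    rw [c1, zero_mul, sub_zero] at h2
    exact mul_ne_zero a1 (b2.2 (by omega)) h2
  · have c1 := not_not.1 (mt b2.1 (by omega))
    rw [c1, mul_zero, zero_sub, neg_eq_zero] at h2
    exact mul_ne_zero (b1.2 (by omega)) a2 h2

theorem eval_zero_fall {μ : Fin n → ℕ} (hμ : μ ≠ 0) :
    MvPolynomial.eval (fun _ => (0 : ℂ)) (fall μ) = 0 := by
  by_contra hne
  have h := (eval_fall_ne_zero_iff μ fun _ => 0).1 (by simpa using hne)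
  exact hμ (funext fun j => Nat.le_zero.1 (h j))

/-- If `a^(μ,μ)` involves the mode `l ≠ k`, the bracket of `a^(μ,μ) a_k` with `a^(ν,ν) a_l` is not
quadratic: a quadratic bracket of this weight would have constant symbol, but the symbol vanishes at
the origin and is not zero. -/
theorem exists_coeff_lie_singleMode {μ ν : Fin n → ℕ} {k l : Fin n} (hμ : μ l ≠ 0) (hν : ν ≠ 0)
    (hνl : ν l = 0) :
    ∃ γ, coeff ⁅(mono μ (μ + Pi.single k 1) : Weyl n), (mono ν (ν + Pi.single l 1) : Weyl n)⁆ γ ≠ 0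
      ∧ deg γ.1 γ.2 ≠ 2 := by
  by_contra hcon
  push Not at hcon
  set x : Weyl n := ⁅(mono μ (μ + Pi.single k 1) : Weyl n), (mono ν (ν + Pi.single l 1) : Weyl n)⁆
    with hx
  have hw := (isWeight_mono μ (μ + Pi.single k 1)).lie (isWeight_mono ν (ν + Pi.single l 1))
  rw [← hx] at hw
  obtain ⟨z, hz⟩ : ∃ z, sym x = MvPolynomial.C z := by
    refine ⟨∑ γ ∈ ((monoBasis n).repr x).support, coeff x γ, ?_⟩
    rw [sym_eq_sum, map_sum]
    refine Finset.sum_congr rfl fun γ hγ => ?_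
    have h1 := hcon γ (Finsupp.mem_support_iff.1 hγ)
    have h2 := Finset.sum_congr rfl fun j (_ : j ∈ Finset.univ) =>
      hw γ (Finsupp.mem_support_iff.1 hγ) j
    have h3 : γ.1 = 0 := by
      rw [← sum_eq_zero_iff_eq_zero]
      rw [deg] at h1
      simp [Finset.sum_add_distrib] at h2
      have h4 : (∑ j, γ.2 j : ℤ) = (∑ j, γ.2 j : ℕ) := by push_cast; rfl
      have h5 : (∑ j, γ.1 j : ℤ) = (∑ j, γ.1 j : ℕ) := by push_cast; rfl
      have h6 : ∀ i, (∑ j, ((Pi.single i 1 : Fin n → ℕ) j : ℤ)) = 1 := fun i => by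
        rw [← Nat.cast_sum]
        simp
      rw [h4, h5, h6, h6] at h2
      omega
    rw [h3, fall_zero, MvPolynomial.smul_eq_C_mul, mul_one]
  rw [(isWeight_mono _ _).sym_lie (isWeight_mono _ _), sym_mono, sym_mono] at hz
  have h0 := congrArg (MvPolynomial.eval fun _ => (0 : ℂ)) hz
  rw [map_sub, map_mul, map_mul, eval_zero_fall hν, eval_zero_fall (fun h => hμ (by rw [h]; rfl)),
    zero_mul, zero_mul, sub_zero, MvPolynomial.eval_C] at h0
  rw [← h0, map_zero] at hz
  -- At this point `fall μ` vanishes because of the mode `l`, where `ν l = 0`; raising the occupation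
  -- number of `l` by one makes it nonzero.
  let m : Fin n → ℕ := fun j => μ j - (Pi.single l 1 : Fin n → ℕ) j + ν j
  have h1 := congrArg (MvPolynomial.eval fun j => (m j : ℂ)) hz
  rw [map_sub, map_mul, map_mul, map_zero,
    eval_shift _ _ (fun j => ((m j + (Pi.single l 1 : Fin n → ℕ) j : ℕ) : ℂ))
      (fun j => by push_cast [Pi.add_apply]; ring) (fall μ)] at h1
  have a1 : MvPolynomial.eval (fun j => (m j : ℂ)) (fall μ) = 0 := by
    by_contra hne
    have := (eval_fall_ne_zero_iff μ m).1 hne l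
    simp only [m, Pi.single_eq_same] at this
    omega
  rw [a1, zero_mul, zero_sub, neg_eq_zero] at h1
  refine mul_ne_zero ((eval_fall_ne_zero_iff ν m).2 fun j => Nat.le_add_left _ _)
    ((eval_fall_ne_zero_iff μ _).2 fun j => ?_) h1
  simp only [m]
  omega

/-! ### Linear and quadratic operators in a set of modes -/

/-- The creation and annihilation operators of the modes outside `M`. -/
def linOps (M : Set (Fin n)) : Set (Weyl n) := {x | ∃ j ∉ M, x = cre j ∨ x = ann j}

theorem exists_commutator_linOps {M : Set (Fin n)} {l m : Weyl n} (hl : l ∈ linOps M)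
    (hm : m ∈ linOps M) : ∃ z : ℂ, l * m - m * l = z • 1 := by
  obtain ⟨i, -, rfl | rfl⟩ := hl <;> obtain ⟨j, -, rfl | rfl⟩ := hm
  · exact ⟨0, by rw [cre_comm, sub_self, zero_smul]⟩
  · refine ⟨if j = i then -1 else 0, ?_⟩
    rw [ann_mul_cre]
    split_ifs <;> simp
  · refine ⟨if i = j then 1 else 0, ?_⟩
    rw [ann_mul_cre]
    split_ifs <;> simp
  · exact ⟨0, by rw [ann_comm, sub_self, zero_smul]⟩

theorem commute_powProd_of_eq_zero (f : Fin n → Weyl n) (α : Fin n → ℕ) (x : Weyl n)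
    (h : ∀ i, α i ≠ 0 → Commute x (f i)) : Commute x (powProd f α) := by
  refine Commute.list_prod_right _ _ fun y hy => ?_
  obtain ⟨i, rfl⟩ := (List.mem_ofFn' _ _).1 hy
  simp only
  by_cases hi : α i = 0
  · rw [hi, pow_zero]
    exact Commute.one_right x
  · exact (h i hi).pow_right _

theorem commute_linOps_mono {μ : Fin n → ℕ} {l : Weyl n} (hl : l ∈ linOps {i | μ i ≠ 0}) :
    Commute l (mono μ μ) := by
  have hac : ∀ i j : Fin n, i ≠ j → Commute (ann i : Weyl n) (cre j) := fun i j hij => by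
    have := ann_mul_cre i j
    rwa [if_neg hij, add_zero] at this
  obtain ⟨j, hj, rfl | rfl⟩ := hl
  · exact (commute_powProd_of_eq_zero _ _ _ fun i _ => cre_commute j i).mul_right
      (commute_powProd_of_eq_zero _ _ _ fun i hi =>
        (hac i j fun h => hj (by rw [← h]; exact hi)).symm)
  · exact (commute_powProd_of_eq_zero _ _ _ fun i hi =>
        hac j i fun h => hj (by rw [h]; exact hi)).mul_right
      (commute_powProd_of_eq_zero _ _ _ fun i _ => ann_commute j i)

theorem mono_mul_ann (α β : Fin n → ℕ) (k : Fin n) :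
    (mono α (β + Pi.single k 1) : Weyl n) = mono α β * ann k := by
  rw [mono, mono, powProd_add _ ann_commute, powProd_single, mul_assoc]

theorem linOps_mul_mono {μ : Fin n → ℕ} {l : Weyl n} (hl : l ∈ linOps {i | μ i ≠ 0}) :
    ∃ k, μ k = 0 ∧ (l * mono μ μ = mono μ (μ + Pi.single k 1) ∨
      l * mono μ μ = mono (μ + Pi.single k 1) μ) := by
  have hc := commute_linOps_mono hl
  obtain ⟨k, hk, rfl | rfl⟩ := hl
  · exact ⟨k, not_not.1 hk, Or.inr (cre_mul_mono k μ μ)⟩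
  · exact ⟨k, not_not.1 hk, Or.inl (by rw [hc.eq, mono_mul_ann])⟩

/-- Split one operator off a monomial, on the left if it creates, on the right if it
annihilates. -/
theorem exists_mono_eq {α β : Fin n → ℕ} {m : ℕ} (h : deg α β = m + 1) :
    ∃ k α' β', α k + β k ≠ 0 ∧ deg α' β' = m ∧ (∀ j, α' j ≤ α j ∧ β' j ≤ β j) ∧
      ((mono α β : Weyl n) = cre k * mono α' β' ∨ (mono α β : Weyl n) = mono α' β' * ann k) := by
  have hsub : ∀ (a : Fin n → ℕ) (k), a k ≠ 0 → a - Pi.single k 1 + Pi.single k 1 = a := by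
    intro a k hk
    ext j
    rcases eq_or_ne j k with rfl | hj
    · simp
      omega
    · simp [hj]
  have hsum : ∀ (a : Fin n → ℕ) (k), a k ≠ 0 →
      ∑ j, a j = ∑ j, (a - Pi.single k 1 : Fin n → ℕ) j + 1 := by
    intro a k hk
    conv_lhs => rw [← hsub a k hk]
    simp [Finset.sum_add_distrib]
  obtain ⟨k, hk⟩ := exists_pos_of_deg_ne_zero (α := α) (β := β) (by omega)
  by_cases hα : α k = 0
  · have hβ : β k ≠ 0 := by omega
    refine ⟨k, α, β - Pi.single k 1, hk, ?_, fun j => ⟨le_rfl, Nat.sub_le _ _⟩, Or.inr ?_⟩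
    · have := hsum β k hβ
      rw [deg] at h ⊢
      omega
    · rw [← mono_mul_ann, hsub β k hβ]
  · refine ⟨k, α - Pi.single k 1, β, hk, ?_, fun j => ⟨Nat.sub_le _ _, le_rfl⟩, Or.inl ?_⟩
    · have := hsum α k hα
      rw [deg] at h ⊢
      omega
    · rw [cre_mul_mono, hsub α k hα]

theorem mono_eq_one {α β : Fin n → ℕ} (h : deg α β = 0) : (mono α β : Weyl n) = 1 := by
  have h1 : α = 0 := sum_eq_zero_iff_eq_zero.1 (by rw [deg] at h; omega)
  have h2 : β = 0 := sum_eq_zero_iff_eq_zero.1 (by rw [deg] at h; omega)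
  rw [h1, h2, mono_zero]

theorem mono_mem_linOps {M : Set (Fin n)} {α β : Fin n → ℕ} (h : deg α β = 1)
    (hM : ∀ j ∈ M, α j = 0 ∧ β j = 0) : mono α β ∈ linOps M := by
  obtain ⟨k, α', β', hk, hd, -, he⟩ := exists_mono_eq h
  have hkM : k ∉ M := fun hk' => hk (by have := hM k hk'; omega)
  rw [mono_eq_one hd, mul_one, one_mul] at he
  exact ⟨k, hkM, he⟩

theorem exists_mono_eq_mul_linOps {M : Set (Fin n)} {α β : Fin n → ℕ} (h : deg α β = 2)
    (hM : ∀ j ∈ M, α j = 0 ∧ β j = 0) :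
    ∃ l ∈ linOps M, ∃ l' ∈ linOps M, (mono α β : Weyl n) = l * l' := by
  obtain ⟨k, α', β', hk, hd, hle, he⟩ := exists_mono_eq h
  have hkM : k ∉ M := fun hk' => hk (by have := hM k hk'; omega)
  have h' := mono_mem_linOps (M := M) hd fun j hj => by
    have := hM j hj
    have := hle j
    omega
  rcases he with he | he
  · exact ⟨_, ⟨k, hkM, Or.inl rfl⟩, _, h', he⟩
  · exact ⟨_, h', _, ⟨k, hkM, Or.inr rfl⟩, he⟩

theorem exists_commutator_quadratic {M : Set (Fin n)} {l l' m : Weyl n} (hl : l ∈ linOps M)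
    (hl' : l' ∈ linOps M) (hm : m ∈ linOps M) :
    ∃ z z' : ℂ, l * l' * m - m * (l * l') = z • l + z' • l' := by
  obtain ⟨z, hz⟩ := exists_commutator_linOps hl' hm
  obtain ⟨z', hz'⟩ := exists_commutator_linOps hl hm
  refine ⟨z, z', ?_⟩
  have : l * l' * m - m * (l * l') = l * (l' * m - m * l') + (l * m - m * l) * l' := by
    noncomm_ring
  rw [this, hz, hz', mul_smul_comm, smul_mul_assoc, mul_one, one_mul]

theorem lie_quadratic_mul_mono {μ : Fin n → ℕ} {l l' m : Weyl n}
    (hl : l ∈ linOps {i | μ i ≠ 0}) (hl' : l' ∈ linOps {i | μ i ≠ 0})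
    (hm : m ∈ linOps {i | μ i ≠ 0}) :
    ∃ z z' : ℂ, ⁅l * l', m * mono μ μ⁆ = z • (l * mono μ μ) + z' • (l' * mono μ μ) := by
  obtain ⟨z, z', h⟩ := exists_commutator_quadratic hl hl' hm
  refine ⟨z, z', ?_⟩
  have hc := (commute_linOps_mono hl).mul_left (commute_linOps_mono hl')
  rw [Ring.lie_def, mul_assoc m, ← hc.eq, ← mul_assoc, ← mul_assoc, ← sub_mul, h, add_mul,
    smul_mul_assoc, smul_mul_assoc]

/-- A pair `(α, β)` of one uncompensated mode is a linear operator times a diagonal monomial. -/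
theorem SingleMode.exists_mono_eq {α β : Fin n → ℕ} (h : SingleMode α β) :
    ∃ μ, ∃ l ∈ linOps {i | μ i ≠ 0}, (mono α β : Weyl n) = l * mono μ μ ∧
      deg α β = 2 * ∑ j, μ j + 1 ∧ (∀ j, μ j = min (α j) (β j)) := by
  obtain ⟨μ, k, hk, ⟨rfl, rfl⟩ | ⟨rfl, rfl⟩⟩ := h.exists_eq
  · have hl : ann k ∈ linOps {i | α i ≠ 0} := ⟨k, not_not.2 hk, Or.inr rfl⟩
    exact ⟨α, ann k, hl, by rw [mono_mul_ann, (commute_linOps_mono hl).eq], deg_add_single _ _,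
      fun j => by simp⟩
  · exact ⟨β, cre k, ⟨k, not_not.2 hk, Or.inl rfl⟩, (cre_mul_mono k β β).symm,
      by rw [deg_comm, deg_add_single], fun j => by simp⟩

/-- A quadratic monomial that avoids the balanced modes of a monomial of one uncompensated mode
preserves this type. -/
theorem singleMode_of_coeff_lie {α β α' β' : Fin n → ℕ} (hd : deg α β = 2)
    (h' : SingleMode α' β') (h3 : 3 ≤ deg α' β')
    (hM : ∀ i, α' i ≠ 0 → β' i ≠ 0 → α i = 0 ∧ β i = 0) (γ)
    (hγ : coeff ⁅(mono α β : Weyl n), (mono α' β' : Weyl n)⁆ γ ≠ 0) :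
    3 ≤ deg γ.1 γ.2 ∧ SingleMode γ.1 γ.2 := by
  obtain ⟨μ, m, hm, he, hdeg, hμ⟩ := h'.exists_mono_eq
  obtain ⟨l, hl, l', hl', hll⟩ := exists_mono_eq_mul_linOps (M := {i | μ i ≠ 0}) hd
    fun j hj => by
      have h1 : μ j ≠ 0 := hj
      rw [hμ j] at h1
      exact hM j (by omega) (by omega)
  obtain ⟨z, z', hz⟩ := lie_quadratic_mul_mono hl hl' hm
  have key : ∀ l ∈ linOps {i | μ i ≠ 0}, coeff (l * mono μ μ) γ ≠ 0 →
      3 ≤ deg γ.1 γ.2 ∧ SingleMode γ.1 γ.2 := by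
    intro l hl hne
    obtain ⟨k, hk, h | h⟩ := linOps_mul_mono hl
    · rw [h] at hne
      have : γ = (μ, μ + Pi.single k 1) := by
        by_contra hcon
        exact hne (coeff_mono_of_ne hcon)
      rw [this]
      refine ⟨?_, singleMode_add_single hk⟩
      change 3 ≤ deg μ (μ + Pi.single k 1)
      rw [deg_add_single]
      omega
    · rw [h] at hne
      have : γ = (μ + Pi.single k 1, μ) := by
        by_contra hcon
        exact hne (coeff_mono_of_ne hcon)
      rw [this]
      refine ⟨?_, (singleMode_add_single hk).symm⟩
      change 3 ≤ deg (μ + Pi.single k 1) μ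
      rw [deg_comm, deg_add_single]
      omega
  rw [hll, he, hz, coeff_add, coeff_smul, coeff_smul] at hγ
  by_cases h1 : coeff (l * mono μ μ) γ = 0
  · by_cases h2 : coeff (l' * mono μ μ) γ = 0
    · rw [h1, h2, mul_zero, mul_zero, add_zero] at hγ
      exact absurd rfl hγ
    · exact key l' hl' h2
  · exact key l hl h1

/-! ### The generators -/

section gens

variable {R : Type*} {σ : R → Sgn} {α β : R → Fin n → ℕ}

theorem exists_isPair (hG : ∀ p, g (σ p) (α p) (β p) ∉ A1 n) {x : skewWeyl n}
    (hx : x ∈ gens σ α β) : ∃ a b, IsPair x a b ∧ deg a b ≠ 1 := by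
  rcases hx with ⟨k, rfl⟩ | ⟨p, rfl⟩
  · refine ⟨_, _, isPair_free k, ?_⟩
    rw [deg_self]
    omega
  · have h0 : g (σ p) (α p) (β p) ≠ 0 := fun h => hG p (by rw [h]; exact Submodule.zero_mem _)
    refine ⟨_, _, isPair_g h0, fun h => hG p (Submodule.subset_span ⟨_, _, _, h, rfl⟩)⟩

theorem mem_Acore_of_notMem_Aperp {x : skewWeyl n} (hx : x ∈ gens σ α β) (h : x ∉ Aperp n) :
    x ∈ Acore n := by
  rcases hx with ⟨k, rfl⟩ | ⟨p, rfl⟩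
  · rw [mem_Acore_iff]
    intro γ hγ
    left
    rcases (isPair_free k).eq_of_coeff_ne_zero hγ with rfl | rfl <;> rfl
  · exact (g_mem_core_or _ _ _).resolve_right h

theorem finite_gens [Finite R] : (gens σ α β).Finite :=
  (Set.finite_range _).union (Set.finite_range _)

end gens

theorem IsPair.mem_Acore_iff {x : skewWeyl n} {α β : Fin n → ℕ} (h : IsPair x α β) :
    x ∈ Acore n ↔ α = β ∨ deg α β = 2 ∨ SingleMode α β := by
  rw [BosonicLie.mem_Acore_iff]
  refine ⟨fun h' => h' (α, β) h.coeff_ne_zero, fun h' γ hγ => ?_⟩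
  rcases h.eq_of_coeff_ne_zero hγ with rfl | rfl
  · exact h'
  · rcases h' with h' | h' | h'
    · exact Or.inl h'.symm
    · exact Or.inr (Or.inl ((deg_comm β α).trans h'))
    · exact Or.inr (Or.inr h'.symm)

theorem IsPair.mem_A2_iff {x : skewWeyl n} {α β : Fin n → ℕ} (h : IsPair x α β) :
    x ∈ A2 n ↔ α ≠ β ∧ deg α β = 2 := by
  rw [BosonicLie.mem_A2_iff]
  refine ⟨fun h' => h' (α, β) h.coeff_ne_zero, fun h' γ hγ => ?_⟩
  rcases h.eq_of_coeff_ne_zero hγ with rfl | rfl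
  · exact h'
  · exact ⟨h'.1.symm, (deg_comm β α).trans h'.2⟩

theorem IsPair.mem_Aeq_iff {x : skewWeyl n} {α β : Fin n → ℕ} (h : IsPair x α β) :
    x ∈ Aeq n ↔ α = β ∧ 4 ≤ deg α β := by
  rw [BosonicLie.mem_Aeq_iff]
  refine ⟨fun h' => h' (α, β) h.coeff_ne_zero, fun h' γ hγ => ?_⟩
  rcases h.eq_of_coeff_ne_zero hγ with rfl | rfl
  · exact h'
  · exact ⟨h'.1.symm, deg_comm α β ▸ h'.2⟩

theorem IsPair.mem_Aom_iff {x : skewWeyl n} {α β : Fin n → ℕ} (h : IsPair x α β) :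
    x ∈ Aom n ↔ 3 ≤ deg α β ∧ SingleMode α β := by
  rw [BosonicLie.mem_Aom_iff]
  refine ⟨fun h' => h' (α, β) h.coeff_ne_zero, fun h' γ hγ => ?_⟩
  rcases h.eq_of_coeff_ne_zero hγ with rfl | rfl
  · exact h'
  · exact ⟨deg_comm α β ▸ h'.1, h'.2.symm⟩

/-- Up to exchange, the pair of an element of `Â_n^om` is `(μ, μ + e_k)` with `μ_k = 0`. -/
theorem IsPair.exists_of_mem_Aom {x : skewWeyl n} {α β : Fin n → ℕ} (h : IsPair x α β)
    (hx : x ∈ Aom n) : ∃ μ k, μ k = 0 ∧ μ ≠ 0 ∧ IsPair x μ (μ + Pi.single k 1) ∧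
      ∀ i, μ i = min (α i) (β i) := by
  obtain ⟨h3, hs⟩ := h.mem_Aom_iff.1 hx
  have hne : ∀ (μ : Fin n → ℕ) (k), 3 ≤ deg μ (μ + Pi.single k 1) → μ ≠ 0 := by
    rintro μ k hd rfl
    rw [deg_add_single] at hd
    simp at hd
  obtain ⟨μ, k, hk, ⟨rfl, rfl⟩ | ⟨rfl, rfl⟩⟩ := hs.exists_eq
  · exact ⟨α, k, hk, hne _ _ h3, h, fun i => by simp⟩
  · exact ⟨β, k, hk, hne _ _ (by rwa [deg_comm]), h.symm, fun i => by simp⟩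

/-! ### Necessity -/

/-- The complex span in the Weyl algebra of a real subspace of the skew-hermitian elements. -/
def complexSpan (L : Submodule ℝ (skewWeyl n)) : Submodule ℂ (Weyl n) :=
  Submodule.span ℂ ((fun x : skewWeyl n => (x : Weyl n)) '' L)

theorem coe_mem_complexSpan {L : Submodule ℝ (skewWeyl n)} {x : skewWeyl n} (hx : x ∈ L) :
    (x : Weyl n) ∈ complexSpan L :=
  Submodule.subset_span ⟨x, hx, rfl⟩

theorem finiteDimensional_complexSpan (L : Submodule ℝ (skewWeyl n)) [FiniteDimensional ℝ L] :
    FiniteDimensional ℂ (complexSpan L) := by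
  obtain ⟨S, rfl⟩ := (Module.Finite.iff_fg (N := L)).1 inferInstance
  let T : Submodule ℂ (Weyl n) :=
    Submodule.span ℂ ((fun x : skewWeyl n => (x : Weyl n)) '' (S : Set (skewWeyl n)))
  have : FiniteDimensional ℂ T :=
    FiniteDimensional.span_of_finite ℂ (S.finite_toSet.image _)
  refine Submodule.finiteDimensional_of_le (S₂ := T) (Submodule.span_le.2 ?_)
  rintro _ ⟨x, hx, rfl⟩
  induction hx using Submodule.span_induction with
  | mem x hx => exact Submodule.subset_span ⟨x, hx, rfl⟩
  | zero => exact T.zero_mem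
  | add x y _ _ hx hy => exact T.add_mem hx hy
  | smul r x _ hx => exact T.smul_mem (r : ℂ) hx

theorem lie_mem_complexSpan (L : LieSubalgebra ℝ (skewWeyl n)) :
    ∀ x ∈ complexSpan L.toSubmodule, ∀ y ∈ complexSpan L.toSubmodule,
      ⁅x, y⁆ ∈ complexSpan L.toSubmodule := by
  intro x hx y hy
  induction hx using Submodule.span_induction with
  | mem x hx =>
    obtain ⟨x, hx, rfl⟩ := hx
    induction hy using Submodule.span_induction with
    | mem y hy =>
      obtain ⟨y, hy, rfl⟩ := hy
      exact coe_mem_complexSpan (x := ⁅x, y⁆) (L.lie_mem hx hy)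
    | zero => rw [lie_zero]; exact Submodule.zero_mem _
    | add y y' _ _ hy hy' => rw [lie_add]; exact Submodule.add_mem _ hy hy'
    | smul z y _ hy =>
      rw [Ring.lie_def, mul_smul_comm, smul_mul_assoc, ← smul_sub]
      exact Submodule.smul_mem _ z hy
  | zero => rw [zero_lie]; exact Submodule.zero_mem _
  | add x x' _ _ hx hx' => rw [add_lie]; exact Submodule.add_mem _ hx hx'
  | smul z x _ hx =>
    rw [Ring.lie_def, mul_smul_comm, smul_mul_assoc, ← smul_sub]
    exact Submodule.smul_mem _ z hx

theorem star_mem_complexSpan (L : Submodule ℝ (skewWeyl n)) :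
    ∀ x ∈ complexSpan L, star x ∈ complexSpan L := by
  intro x hx
  induction hx using Submodule.span_induction with
  | mem x hx =>
    obtain ⟨x, hx, rfl⟩ := hx
    change star (x : Weyl n) ∈ _
    rw [mem_skewWeyl.1 x.2]
    exact Submodule.neg_mem _ (coe_mem_complexSpan hx)
  | zero => rw [star_zero]; exact Submodule.zero_mem _
  | add x y _ _ hx hy => rw [star_add]; exact Submodule.add_mem _ hx hy
  | smul z x _ hx => rw [star_smul]; exact Submodule.smul_mem _ _ hx

theorem star_num (k : Fin n) : star (num k : Weyl n) = num k := by
  rw [num, star_mul, star_cre, star_ann]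

theorem IsWeight.star {x : Weyl n} {v : Fin n → ℤ} (hx : IsWeight x v) :
    IsWeight (star x) (-v) := by
  rw [isWeight_iff] at *
  intro k
  have h := congrArg Star.star (hx k)
  rw [star_sub, star_mul, star_mul, star_num, star_smul] at h
  rw [← neg_sub, h, ← neg_smul]
  simp

/-- Commutators with the number operators separate the two monomials of a pair. -/
theorem IsPair.mono_mem {V : Submodule ℂ (Weyl n)} (hV : ∀ x ∈ V, ∀ y ∈ V, ⁅x, y⁆ ∈ V)
    (hnum : ∀ k, num k ∈ V) {x : skewWeyl n} {α β : Fin n → ℕ} (h : IsPair x α β)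
    (hx : (x : Weyl n) ∈ V) : mono α β ∈ V := by
  obtain ⟨z, z', hz, -, hd, he⟩ := h
  by_cases hab : α = β
  · subst hab
    rw [← add_smul] at he
    rw [he] at hx
    exact (V.smul_mem_iff (hd rfl)).1 hx
  · obtain ⟨k, hk⟩ := Function.ne_iff.1 hab
    have hc : (α k : ℂ) - β k ≠ 0 := by
      rw [sub_ne_zero]
      exact_mod_cast hk
    have h1 := V.add_mem (V.smul_mem ((α k : ℂ) - β k) hx) (hV _ (hnum k) _ hx)
    have h2 : ((α k : ℂ) - β k) • (x : Weyl n) + ⁅num k, (x : Weyl n)⁆ =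
        (2 * ((α k : ℂ) - β k) * z) • mono α β := by
      have h3 : ⁅num k, (x : Weyl n)⁆ = z • (num k * mono α β - mono α β * num k) +
          z' • (num k * mono β α - mono β α * num k) := by
        rw [he, Ring.lie_def, mul_add, add_mul, mul_smul_comm, mul_smul_comm, smul_mul_assoc,
          smul_mul_assoc, smul_sub, smul_sub]
        abel
      rw [h3, num_mono, num_mono, he]
      module
    rw [h2] at h1
    exact (V.smul_mem_iff (mul_ne_zero (mul_ne_zero two_ne_zero hc) hz)).1 h1

section necessity

variable {V : Submodule ℂ (Weyl n)} [FiniteDimensional ℂ V]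
  (hV : ∀ x ∈ V, ∀ y ∈ V, ⁅x, y⁆ ∈ V) (hstar : ∀ x ∈ V, star x ∈ V) (hnum : ∀ k, num k ∈ V)

include hV hnum

theorem mem_Acore_of_mem {x : skewWeyl n} {α β : Fin n → ℕ} (h : IsPair x α β)
    (hx : (x : Weyl n) ∈ V) : x ∈ Acore n := by
  rw [h.mem_Acore_iff]
  by_cases hab : α = β
  · exact Or.inl hab
  · exact Or.inr (deg_eq_two_or_single_mode hV (h.mono_mem hV hnum hx)
      (h.symm.mono_mem hV hnum hx) hab)

theorem lie_eq_zero_of_mem_Aeq {x y : skewWeyl n} {α β α' β' : Fin n → ℕ} (h : IsPair x α β)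
    (h' : IsPair y α' β') (hx : (x : Weyl n) ∈ V) (hy : (y : Weyl n) ∈ V) (hxe : x ∈ Aeq n) :
    ⁅x, y⁆ = 0 := by
  obtain ⟨rfl, hd⟩ := h.mem_Aeq_iff.1 hxe
  rw [deg_self] at hd
  have hm := h.mono_mem hV hnum hx
  obtain ⟨z, z', w, w', -, -, he⟩ := h.lie_eq h'
  refine Subtype.ext ?_
  rw [he, lie_diagonal_eq_zero hV (by omega) hm (h'.mono_mem hV hnum hy),
    lie_diagonal_eq_zero hV (by omega) hm (h'.symm.mono_mem hV hnum hy)]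
  simp

include hstar

/-- A quadratic generator that touches the balanced modes of a generator in `Â_n^om` would produce
a nonzero element of weight of length three. -/
theorem eq_zero_of_quadratic {x y : skewWeyl n} {α β μ : Fin n → ℕ} {k i : Fin n}
    (h : IsPair x α β) (h' : IsPair y μ (μ + Pi.single k 1)) (hx : (x : Weyl n) ∈ V)
    (hy : (y : Weyl n) ∈ V) (hd : deg α β = 2) (hne : α ≠ β) (hi : μ i ≠ 0) :
    α i = 0 ∧ β i = 0 := by
  by_contra hcon
  have key : ∀ {α β}, IsPair x α β → deg α β = 2 → α ≠ β → α i + β i ≠ 0 → α k = 0 → False := by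
    intro α β h hd hne hi' hk
    have hX := lie_quadratic_ne_zero (k := k) hd hne hi hi'
    have hm := hV _ (h.mono_mem hV hnum hx) _ (h'.mono_mem hV hnum hy)
    have hw := (isWeight_mono α β).lie (isWeight_mono μ (μ + Pi.single k 1))
    have hs := sum_natAbs_quadratic_add_single (μ := μ) hd hne hk
    have := (quadratic_of_two_le hV hm (hstar _ hm) hw hw.star hX (star_ne_zero.2 hX)
      (le_of_le_of_eq (by norm_num) hs.symm)).1
    exact absurd (hs.symm.trans this) (by norm_num)
  rcases disjoint_of_deg_eq_two hd hne k with hk | hk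
  · exact key h hd hne (by omega) hk
  · exact key h.symm (by rwa [deg_comm]) hne.symm (by omega) hk

theorem lie_mem_Aom {x y : skewWeyl n} {α β α' β' : Fin n → ℕ}
    (h : IsPair x α β) (h' : IsPair y α' β') (hx : (x : Weyl n) ∈ V) (hy : (y : Weyl n) ∈ V)
    (hx2 : x ∈ A2 n) (hyo : y ∈ Aom n) : ⁅x, y⁆ ∈ Aom n := by
  rw [mem_Aom_iff]
  refine h.coeff_lie h' (P := fun γ => 3 ≤ deg γ.1 γ.2 ∧ SingleMode γ.1 γ.2)
    fun a b a' b' hxp hyp _ _ γ hγ => ?_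
  obtain ⟨hne, hd⟩ := hxp.mem_A2_iff.1 hx2
  obtain ⟨h3, hs⟩ := hyp.mem_Aom_iff.1 hyo
  refine singleMode_of_coeff_lie hd hs h3 (fun i ha hb => ?_) γ hγ
  obtain ⟨μ, k, -, -, hyμ, hμ⟩ := hyp.exists_of_mem_Aom hyo
  refine eq_zero_of_quadratic hV hstar hnum hxp hyμ hx hy hd hne ?_
  rw [hμ]
  omega

end necessity

theorem two_dvd_sum_natAbs_sub (v : Fin n → ℤ) : (2 : ℤ) ∣ (∑ k, (v k).natAbs : ℕ) - ∑ k, v k := by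
  rw [Nat.cast_sum, ← Finset.sum_sub_distrib]
  refine Finset.dvd_sum fun k _ => ?_
  omega

section necessity

variable {V : Submodule ℂ (Weyl n)} [FiniteDimensional ℂ V]
  (hV : ∀ x ∈ V, ∀ y ∈ V, ⁅x, y⁆ ∈ V) (hstar : ∀ x ∈ V, star x ∈ V) (hnum : ∀ k, num k ∈ V)

include hV hnum hstar

/-- The weights of a bracket of two elements of `Â_n^om` have even length, so they vanish or the
bracket is quadratic. -/
theorem lie_mem_Acore {x y : skewWeyl n} {α β α' β' : Fin n → ℕ}
    (h : IsPair x α β) (h' : IsPair y α' β') (hx : (x : Weyl n) ∈ V) (hy : (y : Weyl n) ∈ V)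
    (hxo : x ∈ Aom n) (hyo : y ∈ Aom n) : ⁅x, y⁆ ∈ Acore n := by
  rw [mem_Acore_iff]
  refine h.coeff_lie h' (P := fun γ => γ.1 = γ.2 ∨ deg γ.1 γ.2 = 2 ∨ SingleMode γ.1 γ.2)
    fun a b a' b' hxp hyp _ _ γ hγ => ?_
  have hX : ⁅(mono a b : Weyl n), (mono a' b' : Weyl n)⁆ ≠ 0 := fun h0 => hγ (by
    rw [h0, coeff_zero])
  have hm := hV _ (hxp.mono_mem hV hnum hx) _ (hyp.mono_mem hV hnum hy)
  have hw := (isWeight_mono a b).lie (isWeight_mono a' b')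
  set v : Fin n → ℤ := (fun k => (b k : ℤ) - a k) + fun k => (b' k : ℤ) - a' k with hv
  by_cases hv0 : ∀ k, v k = 0
  · left
    ext k
    have := hw γ hγ k
    rw [hv0 k] at this
    omega
  · right
    left
    refine (quadratic_of_two_le hV hm (hstar _ hm) hw hw.star hX (star_ne_zero.2 hX) ?_).2 γ hγ
    push Not at hv0
    obtain ⟨k, hk⟩ := hv0
    have h1 := Finset.single_le_sum (f := fun k => (v k).natAbs) (fun _ _ => Nat.zero_le _)
      (Finset.mem_univ k)
    have h2 := two_dvd_sum_natAbs_sub v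
    have h3 := two_dvd_sum_natAbs_sub fun k => (b k : ℤ) - a k
    have h4 := two_dvd_sum_natAbs_sub fun k => (b' k : ℤ) - a' k
    rw [(hxp.mem_Aom_iff.1 hxo).2.sum_natAbs] at h3
    rw [(hyp.mem_Aom_iff.1 hyo).2.sum_natAbs] at h4
    have h5 : ∑ k, v k = ∑ k, ((b k : ℤ) - a k) + ∑ k, ((b' k : ℤ) - a' k) :=
      Finset.sum_add_distrib
    rw [h5] at h2
    omega

end necessity

/-! ### Sufficiency -/

theorem commute_mono_self (μ ν : Fin n → ℕ) : Commute (mono μ μ : Weyl n) (mono ν ν) := by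
  have h0 : ∀ μ : Fin n → ℕ, IsWeight (mono μ μ : Weyl n) 0 := fun μ => by
    convert isWeight_mono μ μ using 1
    ext k
    simp
  have h1 := (h0 μ).mul (h0 ν)
  have h2 := (h0 ν).mul (h0 μ)
  refine h1.eq_of_sym_eq h2 ?_
  rw [(h0 μ).sym_mul, (h0 ν).sym_mul, shift_zero, shift_zero, mul_comm]

/-- The span of the quadratic operators in the modes outside `M`, of the products of linear
operators in these modes with diagonal monomials `a^(μ,μ)`, `μ ∈ S`, and of the products of two
such monomials. -/
def omSpan (M : Set (Fin n)) (S : Set (Fin n → ℕ)) : Submodule ℂ (Weyl n) :=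
  Submodule.span ℂ (Set.image2 (fun l l' => l * l') (linOps M) (linOps M) ∪
    Set.image2 (fun l μ => l * mono μ μ) (linOps M) S ∪
    Set.image2 (fun μ ν => mono μ μ * mono ν ν) S S)

theorem finite_linOps (M : Set (Fin n)) : (linOps M).Finite := by
  refine ((Set.finite_range (cre (n := n))).union (Set.finite_range (ann (n := n)))).subset ?_
  rintro x ⟨j, -, rfl | rfl⟩
  · exact Or.inl ⟨j, rfl⟩
  · exact Or.inr ⟨j, rfl⟩

theorem finiteDimensional_omSpan (M : Set (Fin n)) {S : Set (Fin n → ℕ)} (hS : S.Finite) :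
    FiniteDimensional ℂ (omSpan M S) := by
  have hl := finite_linOps M
  exact FiniteDimensional.span_of_finite ℂ
    (((hl.image2 _ hl).union (hl.image2 _ hS)).union (hS.image2 _ hS))

section omSpan

variable {M : Set (Fin n)} {S : Set (Fin n → ℕ)}

theorem mul_mem_omSpan {l l' : Weyl n} (hl : l ∈ linOps M) (hl' : l' ∈ linOps M) :
    l * l' ∈ omSpan M S :=
  Submodule.subset_span (Or.inl (Or.inl ⟨l, hl, l', hl', rfl⟩))

theorem mul_mono_mem_omSpan {l : Weyl n} {μ : Fin n → ℕ} (hl : l ∈ linOps M) (hμ : μ ∈ S) :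
    l * mono μ μ ∈ omSpan M S :=
  Submodule.subset_span (Or.inl (Or.inr ⟨l, hl, μ, hμ, rfl⟩))

theorem mono_mul_mono_mem_omSpan {μ ν : Fin n → ℕ} (hμ : μ ∈ S) (hν : ν ∈ S) :
    (mono μ μ * mono ν ν : Weyl n) ∈ omSpan M S :=
  Submodule.subset_span (Or.inr ⟨μ, hμ, ν, hν, rfl⟩)

variable (hS : ∀ μ ∈ S, ∀ i, μ i ≠ 0 → i ∈ M)

include hS

theorem linOps_subset {μ : Fin n → ℕ} (hμ : μ ∈ S) : linOps M ⊆ linOps {i | μ i ≠ 0} := by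
  rintro x ⟨j, hj, h⟩
  exact ⟨j, fun h' => hj (hS μ hμ j h'), h⟩

theorem lie_mem_omSpan : ∀ x ∈ omSpan M S, ∀ y ∈ omSpan M S, ⁅x, y⁆ ∈ omSpan M S := by
  have hc : ∀ l ∈ linOps M, ∀ μ ∈ S, Commute l (mono μ μ) := fun l hl μ hμ =>
    commute_linOps_mono (linOps_subset hS hμ hl)
  have hqq : ∀ l ∈ linOps M, ∀ l' ∈ linOps M, ∀ m ∈ linOps M, ∀ m' ∈ linOps M,
      ⁅l * l', m * m'⁆ ∈ omSpan M S := by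
    intro l hl l' hl' m hm m' hm'
    obtain ⟨z, z', h⟩ := exists_commutator_quadratic hl hl' hm
    obtain ⟨w, w', h'⟩ := exists_commutator_quadratic hl hl' hm'
    have e : ⁅l * l', m * m'⁆ =
        (l * l' * m - m * (l * l')) * m' + m * (l * l' * m' - m' * (l * l')) := by
      rw [Ring.lie_def]
      noncomm_ring
    rw [e, h, h', add_mul, mul_add, smul_mul_assoc, smul_mul_assoc, mul_smul_comm, mul_smul_comm]
    exact Submodule.add_mem _ (Submodule.add_mem _ (Submodule.smul_mem _ _ (mul_mem_omSpan hl hm'))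
      (Submodule.smul_mem _ _ (mul_mem_omSpan hl' hm')))
      (Submodule.add_mem _ (Submodule.smul_mem _ _ (mul_mem_omSpan hm hl))
      (Submodule.smul_mem _ _ (mul_mem_omSpan hm hl')))
  have hql : ∀ l ∈ linOps M, ∀ l' ∈ linOps M, ∀ m ∈ linOps M, ∀ μ ∈ S,
      ⁅l * l', m * mono μ μ⁆ ∈ omSpan M S := by
    intro l hl l' hl' m hm μ hμ
    obtain ⟨z, z', h⟩ := lie_quadratic_mul_mono (linOps_subset hS hμ hl)
      (linOps_subset hS hμ hl') (linOps_subset hS hμ hm)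
    rw [h]
    exact Submodule.add_mem _ (Submodule.smul_mem _ _ (mul_mono_mem_omSpan hl hμ))
      (Submodule.smul_mem _ _ (mul_mono_mem_omSpan hl' hμ))
  have hll : ∀ l ∈ linOps M, ∀ μ ∈ S, ∀ m ∈ linOps M, ∀ ν ∈ S,
      ⁅l * mono μ μ, m * mono ν ν⁆ ∈ omSpan M S := by
    intro l hl μ hμ m hm ν hν
    obtain ⟨z, h⟩ := exists_commutator_linOps hl hm
    have e : ⁅l * mono μ μ, m * mono ν ν⁆ = (l * m - m * l) * (mono μ μ * mono ν ν) := by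
      have e1 : l * mono μ μ * (m * mono ν ν) = l * m * (mono μ μ * mono ν ν) := by
        rw [mul_assoc l, ← mul_assoc (mono μ μ) m, ← (hc m hm μ hμ).eq]
        noncomm_ring
      have e2 : m * mono ν ν * (l * mono μ μ) = m * l * (mono μ μ * mono ν ν) := by
        rw [mul_assoc m, ← mul_assoc (mono ν ν) l, ← (hc l hl ν hν).eq,
          (commute_mono_self μ ν).eq]
        noncomm_ring
      rw [Ring.lie_def, e1, e2, sub_mul]
    rw [e, h, smul_mul_assoc, one_mul]
    exact Submodule.smul_mem _ _ (mono_mul_mono_mem_omSpan hμ hν)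
  have hcentral : ∀ μ ∈ S, ∀ ν ∈ S, ∀ y, y ∈ Set.image2 (fun l l' => l * l') (linOps M) (linOps M) ∪
      Set.image2 (fun l μ => l * mono μ μ) (linOps M) S ∪
      Set.image2 (fun μ ν => mono μ μ * mono ν ν) S S → Commute (mono μ μ * mono ν ν) y := by
    intro μ hμ ν hν y hy
    have h1 : ∀ l ∈ linOps M, Commute (mono μ μ * mono ν ν) l := fun l hl =>
      ((hc l hl μ hμ).symm).mul_left (hc l hl ν hν).symm
    have h2 : ∀ κ, Commute (mono μ μ * mono ν ν) (mono κ κ : Weyl n) := fun κ =>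
      (commute_mono_self μ κ).mul_left (commute_mono_self ν κ)
    rcases hy with (⟨l, hl, l', hl', rfl⟩ | ⟨l, hl, κ, hκ, rfl⟩) | ⟨κ, hκ, κ', hκ', rfl⟩
    · exact (h1 l hl).mul_right (h1 l' hl')
    · exact (h1 l hl).mul_right (h2 κ)
    · exact (h2 κ).mul_right (h2 κ')
  intro x hx y hy
  induction hx using Submodule.span_induction with
  | mem x hx =>
    induction hy using Submodule.span_induction with
    | mem y hy =>
      rcases hx with (⟨l, hl, l', hl', rfl⟩ | ⟨l, hl, κ, hκ, rfl⟩) | ⟨κ, hκ, κ', hκ', rfl⟩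
      · rcases hy with (⟨m, hm, m', hm', rfl⟩ | ⟨m, hm, ν, hν, rfl⟩) | ⟨ν, hν, ν', hν', rfl⟩
        · exact hqq l hl l' hl' m hm m' hm'
        · exact hql l hl l' hl' m hm ν hν
        · have := hcentral ν hν ν' hν' (l * l') (Or.inl (Or.inl ⟨l, hl, l', hl', rfl⟩))
          rw [Ring.lie_def, this.eq, sub_self]
          exact Submodule.zero_mem _
      · rcases hy with (⟨m, hm, m', hm', rfl⟩ | ⟨m, hm, ν, hν, rfl⟩) | ⟨ν, hν, ν', hν', rfl⟩
        · rw [← lie_skew]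
          exact Submodule.neg_mem _ (hql m hm m' hm' l hl κ hκ)
        · exact hll l hl κ hκ m hm ν hν
        · have := hcentral ν hν ν' hν' (l * mono κ κ) (Or.inl (Or.inr ⟨l, hl, κ, hκ, rfl⟩))
          rw [Ring.lie_def, this.eq, sub_self]
          exact Submodule.zero_mem _
      · rw [Ring.lie_def, (hcentral κ hκ κ' hκ' y hy).eq, sub_self]
        exact Submodule.zero_mem _
    | zero => rw [lie_zero]; exact Submodule.zero_mem _
    | add y y' _ _ hy hy' => rw [lie_add]; exact Submodule.add_mem _ hy hy'
    | smul z y _ hy =>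
      rw [Ring.lie_def, mul_smul_comm, smul_mul_assoc, ← smul_sub]
      exact Submodule.smul_mem _ z hy
  | zero => rw [zero_lie]; exact Submodule.zero_mem _
  | add x x' _ _ hx hx' => rw [add_lie]; exact Submodule.add_mem _ hx hx'
  | smul z x _ hx =>
    rw [Ring.lie_def, mul_smul_comm, smul_mul_assoc, ← smul_sub]
    exact Submodule.smul_mem _ z hx

end omSpan

/-- The indices `μ ≠ 0` such that `a^(μ,μ) a_k` occurs in an element of `G`, with `k` not a mode of
`μ`. -/
def omIndices (G : Set (skewWeyl n)) : Set (Fin n → ℕ) :=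
  {μ | ∃ x ∈ G, ∃ k, μ k = 0 ∧ μ ≠ 0 ∧ IsPair x μ (μ + Pi.single k 1)}

theorem finite_omIndices {G : Set (skewWeyl n)} (hG : G.Finite) : (omIndices G).Finite := by
  refine (hG.biUnion fun x _ => (coeff_support_finite (x : Weyl n)).image Prod.fst).subset ?_
  rintro μ ⟨x, hx, k, -, -, h⟩
  exact Set.mem_biUnion hx ⟨_, h.coeff_ne_zero, rfl⟩

/-- The modes of the indices in `omIndices`. -/
def omModes (G : Set (skewWeyl n)) : Set (Fin n) := {i | ∃ μ ∈ omIndices G, μ i ≠ 0}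

theorem IsPair.mem_Aom_of_add_single {x : skewWeyl n} {μ : Fin n → ℕ} {k : Fin n}
    (h : IsPair x μ (μ + Pi.single k 1)) (hk : μ k = 0) (hμ : μ ≠ 0) : x ∈ Aom n := by
  refine h.mem_Aom_iff.2 ⟨?_, singleMode_add_single hk⟩
  have : ∑ j, μ j ≠ 0 := mt sum_eq_zero_iff_eq_zero.1 hμ
  rw [deg_add_single]
  omega

theorem eq_zero_of_mem_omModes {G : Set (skewWeyl n)}
    (h3 : ∀ x ∈ G ∩ (A2 n : Set (skewWeyl n)), ∀ y ∈ G ∩ (Aom n : Set (skewWeyl n)),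
      ⁅x, y⁆ ∈ Aom n)
    {x : skewWeyl n} (hx : x ∈ G) {α β : Fin n → ℕ} (h : IsPair x α β) (hd : deg α β = 2)
    (hne : α ≠ β) {i : Fin n} (hi : i ∈ omModes G) : α i = 0 ∧ β i = 0 := by
  obtain ⟨μ, ⟨y, hy, k, hk, hμ, hp⟩, hμi⟩ := hi
  have hxy := h3 x ⟨hx, h.mem_A2_iff.2 ⟨hne, hd⟩⟩ y ⟨hy, hp.mem_Aom_of_add_single hk hμ⟩
  rw [mem_Aom_iff] at hxy
  by_contra hcon
  have key : ∀ {α β}, IsPair x α β → deg α β = 2 → α ≠ β → α i + β i ≠ 0 → α k = 0 → False := by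
    intro α β h hd hne hi' hαk
    obtain ⟨γ, hγ⟩ := exists_coeff_ne_zero (lie_quadratic_ne_zero (k := k) hd hne hμi hi')
    have hw := ((isWeight_mono α β).lie (isWeight_mono μ (μ + Pi.single k 1))) γ hγ
    have h1 := hxy γ (h.coeff_lie_ne_zero hp hne (singleMode_add_single hk).ne
      ⟨k, by simp; omega⟩ hγ)
    have h2 := h1.2.sum_natAbs
    simp only [hw] at h2
    have := sum_natAbs_quadratic_add_single (μ := μ) hd hne hαk
    exact absurd (this.symm.trans h2) (by norm_num)
  rcases disjoint_of_deg_eq_two hd hne k with hαk | hβk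
  · exact key h hd hne (by omega) hαk
  · exact key h.symm (by rwa [deg_comm]) hne.symm (by omega) hβk

theorem notMem_omModes {G : Set (skewWeyl n)}
    (h4 : ∀ x ∈ G ∩ (Aom n : Set (skewWeyl n)), ∀ y ∈ G ∩ (Aom n : Set (skewWeyl n)),
      projPerp n ⁅x, y⁆ = 0)
    {x : skewWeyl n} (hx : x ∈ G) {ν : Fin n → ℕ} {l : Fin n}
    (h : IsPair x ν (ν + Pi.single l 1)) (hl : ν l = 0) (hν : ν ≠ 0) : l ∉ omModes G := by
  rintro ⟨μ, ⟨y, hy, k, hk, hμ, hp⟩, hμl⟩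
  have hyx := h4 y ⟨hy, hp.mem_Aom_of_add_single hk hμ⟩ x ⟨hx, h.mem_Aom_of_add_single hl hν⟩
  rw [projPerp_eq_zero_iff, mem_Acore_iff] at hyx
  obtain ⟨γ, hγ, hγd⟩ := exists_coeff_lie_singleMode (k := k) hμl hν hl
  have hw := ((isWeight_mono μ (μ + Pi.single k 1)).lie
    (isWeight_mono ν (ν + Pi.single l 1))) γ hγ
  have hw' : ∀ j, (γ.2 j : ℤ) - γ.1 j =
      ((Pi.single k 1 : Fin n → ℕ) j + (Pi.single l 1 : Fin n → ℕ) j : ℕ) := fun j => by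
    rw [hw j]
    simp
  have h1 := hyx γ (hp.coeff_lie_ne_zero h (singleMode_add_single hk).ne
    (singleMode_add_single hl).ne
    ⟨l, by simp only [Pi.add_apply, Pi.single_eq_same]; push_cast; omega⟩ hγ)
  rcases h1 with h1 | h1 | h1
  · have := hw' l
    rw [h1, Pi.single_eq_same] at this
    push_cast at this
    omega
  · exact hγd h1
  · have h2 := h1.sum_natAbs
    simp only [hw', Int.natAbs_natCast] at h2
    rw [Finset.sum_add_distrib] at h2
    simp at h2

theorem coe_mem_omSpan {G : Set (skewWeyl n)}
    (h3 : ∀ x ∈ G ∩ (A2 n : Set (skewWeyl n)), ∀ y ∈ G ∩ (Aom n : Set (skewWeyl n)),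
      ⁅x, y⁆ ∈ Aom n)
    (h4 : ∀ x ∈ G ∩ (Aom n : Set (skewWeyl n)), ∀ y ∈ G ∩ (Aom n : Set (skewWeyl n)),
      projPerp n ⁅x, y⁆ = 0)
    {S : Set (Fin n → ℕ)} (hS0 : 0 ∈ S) (hS1 : ∀ k ∈ omModes G, Pi.single k 1 ∈ S)
    (hS2 : omIndices G ⊆ S) {x : skewWeyl n} (hx : x ∈ G) {α β : Fin n → ℕ} (h : IsPair x α β)
    (hd : deg α β ≠ 1) (hcore : x ∈ Acore n) (heq : x ∉ Aeq n) :
    (x : Weyl n) ∈ omSpan (omModes G) S := by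
  suffices hmono : mono α β ∈ omSpan (omModes G) S ∧ mono β α ∈ omSpan (omModes G) S by
    obtain ⟨z, z', -, -, -, he⟩ := h
    rw [he]
    exact Submodule.add_mem _ (Submodule.smul_mem _ _ hmono.1) (Submodule.smul_mem _ _ hmono.2)
  have hquad : ∀ {α β : Fin n → ℕ}, deg α β = 2 → (∀ i ∈ omModes G, α i = 0 ∧ β i = 0) →
      mono α β ∈ omSpan (omModes G) S := by
    intro α β hd hM
    obtain ⟨l, hl, l', hl', he⟩ := exists_mono_eq_mul_linOps hd hM
    rw [he]
    exact mul_mem_omSpan hl hl'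
  by_cases hab : α = β
  · subst hab
    rw [and_self]
    have hlt : ¬ 4 ≤ deg α α := fun h4 => heq (h.mem_Aeq_iff.2 ⟨rfl, h4⟩)
    have hself := deg_self α
    have hdiag : ∀ μ ∈ S, mono μ μ ∈ omSpan (omModes G) S := fun μ hμ => by
      have := mono_mul_mono_mem_omSpan (M := omModes G) hμ hS0
      rwa [mono_zero, mul_one] at this
    by_cases h0 : α = 0
    · rw [h0]
      exact hdiag 0 hS0
    · have hs0 : ∑ k, α k ≠ 0 := mt sum_eq_zero_iff_eq_zero.1 h0
      by_cases hM : ∀ i ∈ omModes G, α i = 0 ∧ α i = 0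
      · exact hquad (by omega) hM
      · push Not at hM
        obtain ⟨i, hi, hαi⟩ := hM
        have hi0 : α i ≠ 0 := fun h => hαi h h
        have hd2 : deg α α = 2 := by omega
        rw [deg_eq_add α α i] at hd2
        have hsingle : α = Pi.single i 1 := by
          ext j
          rcases eq_or_ne j i with rfl | hj
          · rw [Pi.single_eq_same]
            omega
          · rw [Pi.single_eq_of_ne hj]
            exact (eq_zero_of_deg_erase (α := α) (β := α) (k := i) (by omega) hj).1
        rw [hsingle]
        exact hdiag _ (hS1 i hi)
  · rcases (h.mem_Acore_iff.1 hcore).resolve_left hab with h2 | hs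
    · have hM := fun i hi => eq_zero_of_mem_omModes h3 hx h h2 hab (i := i) hi
      exact ⟨hquad h2 hM, hquad ((deg_comm β α).trans h2) fun i hi => (hM i hi).symm⟩
    · have hodd := hs.odd_deg
      have hxo : x ∈ Aom n := h.mem_Aom_iff.2 ⟨by
        obtain ⟨m, hm⟩ := hodd
        omega, hs⟩
      have key : ∀ {μ : Fin n → ℕ} {k : Fin n}, IsPair x μ (μ + Pi.single k 1) → μ k = 0 →
          μ ≠ 0 → mono μ (μ + Pi.single k 1) ∈ omSpan (omModes G) S ∧
            mono (μ + Pi.single k 1) μ ∈ omSpan (omModes G) S := by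
        intro μ k hp hk hμ
        have hkM := notMem_omModes h4 hx hp hk hμ
        have hμS : μ ∈ S := hS2 ⟨x, hx, k, hk, hμ, hp⟩
        have hann : ann k ∈ linOps {i | μ i ≠ 0} := ⟨k, not_not.2 hk, Or.inr rfl⟩
        refine ⟨?_, ?_⟩
        · rw [mono_mul_ann, ← (commute_linOps_mono hann).eq]
          exact mul_mono_mem_omSpan ⟨k, hkM, Or.inr rfl⟩ hμS
        · rw [← cre_mul_mono]
          exact mul_mono_mem_omSpan ⟨k, hkM, Or.inl rfl⟩ hμS
      have hne0 : ∀ (μ : Fin n → ℕ) (k), deg μ (μ + Pi.single k 1) ≠ 1 → μ ≠ 0 := by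
        rintro μ k hd rfl
        rw [deg_add_single] at hd
        simp at hd
      obtain ⟨μ, k, hk, ⟨rfl, rfl⟩ | ⟨rfl, rfl⟩⟩ := hs.exists_eq
      · exact key h hk (hne0 _ _ hd)
      · exact (key h.symm hk (hne0 _ _ (by rwa [deg_comm]))).symm

/-- Removing central generators does not affect finite dimensionality. -/
theorem finiteDimensional_lieSpan_of_central {L : Type*} [LieRing L] [LieAlgebra ℝ L]
    {G C : Set L} (hG : G.Finite) (hC : C ⊆ G) (hcomm : ∀ x ∈ C, ∀ y ∈ G, ⁅x, y⁆ = 0)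
    (h : FiniteDimensional ℝ (LieSubalgebra.lieSpan ℝ L (G \ C)).toSubmodule) :
    FiniteDimensional ℝ (LieSubalgebra.lieSpan ℝ L G) := by
  set H := LieSubalgebra.lieSpan ℝ L (G \ C) with hH
  have h1 : ∀ x ∈ C, ∀ y ∈ LieSubalgebra.lieSpan ℝ L G, ⁅x, y⁆ = 0 := by
    intro x hx y hy
    induction hy using LieSubalgebra.lieSpan_induction with
    | mem y hy => exact hcomm x hx y hy
    | zero => exact lie_zero x
    | add y y' _ _ hy hy' => rw [lie_add, hy, hy', add_zero]
    | smul r y _ hy => rw [lie_smul, hy, smul_zero]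
    | lie y y' _ _ hy hy' => rw [leibniz_lie, hy, hy', zero_lie, lie_zero, add_zero]
  have h2 : ∀ x ∈ Submodule.span ℝ C, ∀ y ∈ LieSubalgebra.lieSpan ℝ L G, ⁅x, y⁆ = 0 := by
    intro x hx y hy
    induction hx using Submodule.span_induction with
    | mem x hx => exact h1 x hx y hy
    | zero => exact zero_lie y
    | add x x' _ _ hx hx' => rw [add_lie, hx, hx', add_zero]
    | smul r x _ hx => rw [smul_lie, hx, smul_zero]
  have hHG : H ≤ LieSubalgebra.lieSpan ℝ L G := LieSubalgebra.lieSpan_mono Set.sdiff_subset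
  have hCG : Submodule.span ℝ C ≤ (LieSubalgebra.lieSpan ℝ L G).toSubmodule :=
    Submodule.span_le.2 fun x hx => LieSubalgebra.subset_lieSpan (hC hx)
  have hsup : H.toSubmodule ⊔ Submodule.span ℝ C ≤
      (LieSubalgebra.lieSpan ℝ L G).toSubmodule := sup_le hHG hCG
  let K : LieSubalgebra ℝ L :=
    { H.toSubmodule ⊔ Submodule.span ℝ C with
      lie_mem' := by
        intro x y hx hy
        have hy' : y ∈ LieSubalgebra.lieSpan ℝ L G := hsup hy
        obtain ⟨x1, hx1, x2, hx2, rfl⟩ := Submodule.mem_sup.1 hx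
        obtain ⟨y1, hy1, y2, hy2, rfl⟩ := Submodule.mem_sup.1 hy
        rw [add_lie, h2 x2 hx2 _ hy', add_zero, lie_add, ← lie_skew x1 y2,
          h2 y2 hy2 x1 (hHG hx1), neg_zero, add_zero]
        exact Submodule.mem_sup_left (H.lie_mem hx1 hy1) }
  have hle : LieSubalgebra.lieSpan ℝ L G ≤ K := by
    rw [LieSubalgebra.lieSpan_le]
    intro x hx
    by_cases hxC : x ∈ C
    · exact Submodule.mem_sup_right (Submodule.subset_span hxC)
    · exact Submodule.mem_sup_left (LieSubalgebra.subset_lieSpan ⟨hx, hxC⟩)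
  have hfC : FiniteDimensional ℝ (Submodule.span ℝ C) :=
    FiniteDimensional.span_of_finite ℝ (hG.subset hC)
  exact Submodule.finiteDimensional_of_le (S₁ := (LieSubalgebra.lieSpan ℝ L G).toSubmodule)
    (S₂ := H.toSubmodule ⊔ Submodule.span ℝ C) hle

/-- A Lie subalgebra generated by elements of a finite-dimensional, bracket-closed complex subspace
is finite-dimensional. -/
theorem finiteDimensional_lieSpan_of_subset {V : Submodule ℂ (Weyl n)} [FiniteDimensional ℂ V]
    (hV : ∀ x ∈ V, ∀ y ∈ V, ⁅x, y⁆ ∈ V) {G : Set (skewWeyl n)}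
    (hG : ∀ x ∈ G, (x : Weyl n) ∈ V) :
    FiniteDimensional ℝ (LieSubalgebra.lieSpan ℝ (skewWeyl n) G).toSubmodule := by
  let K : LieSubalgebra ℝ (skewWeyl n) :=
    { (V.restrictScalars ℝ).comap (skewWeyl n).toSubmodule.subtype with
      lie_mem' := fun {x y} hx hy => hV _ hx _ hy }
  have hle : LieSubalgebra.lieSpan ℝ (skewWeyl n) G ≤ K := LieSubalgebra.lieSpan_le.2 hG
  have : FiniteDimensional ℝ (V.restrictScalars ℝ) :=
    inferInstanceAs (FiniteDimensional ℝ V)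
  let f : (LieSubalgebra.lieSpan ℝ (skewWeyl n) G).toSubmodule →ₗ[ℝ] V.restrictScalars ℝ :=
    ((skewWeyl n).toSubmodule.subtype ∘ₗ Submodule.subtype _).codRestrict _ fun x => hle x.2
  refine FiniteDimensional.of_injective f fun x y hxy => ?_
  exact Subtype.ext (Subtype.ext (congrArg (fun z : V.restrictScalars ℝ => (z : Weyl n)) hxy))

end

end BosonicLie

theorem mainTheorem1 (n : ℕ) {R : Type*} [Finite R] (σ : R → BosonicLie.Sgn)
    (α β : R → Fin n → ℕ)
    (hG : ∀ p, BosonicLie.g (σ p) (α p) (β p) ∉ BosonicLie.A1 n) :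
    FiniteDimensional ℝ
        (LieSubalgebra.lieSpan ℝ (BosonicLie.skewWeyl n) (BosonicLie.gens σ α β)) ↔
      BosonicLie.gens σ α β ∩ (BosonicLie.Aperp n : Set (BosonicLie.skewWeyl n)) = ∅ ∧
      BosonicLie.gens σ α β ∩ (BosonicLie.Aeq n : Set (BosonicLie.skewWeyl n)) ⊆
        BosonicLie.centralGens (BosonicLie.gens σ α β) ∧
      (∀ x ∈ BosonicLie.gens σ α β ∩ (BosonicLie.A2 n : Set (BosonicLie.skewWeyl n)),
        ∀ y ∈ BosonicLie.gens σ α β ∩ (BosonicLie.Aom n : Set (BosonicLie.skewWeyl n)),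
          ⁅x, y⁆ ∈ BosonicLie.Aom n) ∧
      (∀ x ∈ BosonicLie.gens σ α β ∩ (BosonicLie.Aom n : Set (BosonicLie.skewWeyl n)),
        ∀ y ∈ BosonicLie.gens σ α β ∩ (BosonicLie.Aom n : Set (BosonicLie.skewWeyl n)),
          BosonicLie.projPerp n ⁅x, y⁆ = 0) := by
  open BosonicLie in
  constructor
  · intro hfin
    set L := LieSubalgebra.lieSpan ℝ (skewWeyl n) (gens σ α β)
    have : FiniteDimensional ℝ L.toSubmodule := hfin
    have := finiteDimensional_complexSpan L.toSubmodule
    have hV := lie_mem_complexSpan L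
    have hstar := star_mem_complexSpan L.toSubmodule
    have hmem : ∀ x ∈ gens σ α β, (x : Weyl n) ∈ complexSpan L.toSubmodule := fun x hx =>
      coe_mem_complexSpan (LieSubalgebra.subset_lieSpan hx)
    have hnum : ∀ k, num k ∈ complexSpan L.toSubmodule := fun k =>
      (Submodule.smul_mem_iff _ Complex.I_ne_zero).1 (hmem (free k) (Or.inl ⟨k, rfl⟩))
    refine ⟨?_, ?_, ?_, ?_⟩
    · rw [Set.eq_empty_iff_forall_notMem]
      rintro x ⟨hx, hxp⟩
      obtain ⟨a, b, hp, -⟩ := exists_isPair hG hx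
      exact hp.ne_zero ((Submodule.disjoint_def.1 (isCompl_perp_core n).disjoint) x hxp
        (mem_Acore_of_mem hV hnum hp (hmem x hx)))
    · rintro x ⟨hx, hxe⟩
      refine ⟨hx, fun y hy => ?_⟩
      obtain ⟨a, b, hp, -⟩ := exists_isPair hG hx
      obtain ⟨a', b', hp', -⟩ := exists_isPair hG hy
      exact lie_eq_zero_of_mem_Aeq hV hnum hp hp' (hmem x hx) (hmem y hy) hxe
    · rintro x ⟨hx, hx2⟩ y ⟨hy, hyo⟩
      obtain ⟨a, b, hp, -⟩ := exists_isPair hG hx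
      obtain ⟨a', b', hp', -⟩ := exists_isPair hG hy
      exact lie_mem_Aom hV hstar hnum hp hp' (hmem x hx) (hmem y hy) hx2 hyo
    · rintro x ⟨hx, hxo⟩ y ⟨hy, hyo⟩
      obtain ⟨a, b, hp, -⟩ := exists_isPair hG hx
      obtain ⟨a', b', hp', -⟩ := exists_isPair hG hy
      exact projPerp_eq_zero_iff.2
        (lie_mem_Acore hV hstar hnum hp hp' (hmem x hx) (hmem y hy) hxo hyo)
  · rintro ⟨h1, h2, h3, h4⟩
    refine finiteDimensional_lieSpan_of_central finite_gens
      (C := gens σ α β ∩ (Aeq n : Set (skewWeyl n))) Set.inter_subset_left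
      (fun x hx => (h2 hx).2) ?_
    let S : Set (Fin n → ℕ) :=
      ({0} ∪ (fun k => Pi.single k 1) '' omModes (gens σ α β)) ∪ omIndices (gens σ α β)
    have hSfin : S.Finite := ((Set.finite_singleton 0).union ((Set.toFinite _).image _)).union
      (finite_omIndices finite_gens)
    have hSM : ∀ μ ∈ S, ∀ i, μ i ≠ 0 → i ∈ omModes (gens σ α β) := by
      rintro μ ((rfl | ⟨k, hk, rfl⟩) | hμ) i hi
      · exact absurd rfl hi
      · by_cases hik : i = k
        · rwa [hik]
        · exact absurd (Pi.single_eq_of_ne hik 1) hi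
      · exact ⟨μ, hμ, hi⟩
    have := finiteDimensional_omSpan (omModes (gens σ α β)) hSfin
    refine finiteDimensional_lieSpan_of_subset (lie_mem_omSpan hSM) fun x hx => ?_
    obtain ⟨a, b, hp, hd⟩ := exists_isPair hG hx.1
    have hperp : x ∉ Aperp n := fun h => by
      have : x ∈ gens σ α β ∩ (Aperp n : Set (skewWeyl n)) := ⟨hx.1, h⟩
      rw [h1] at this
      exact this
    exact coe_mem_omSpan h3 h4 (Or.inl (Or.inl rfl)) (fun k hk => Or.inl (Or.inr ⟨k, hk, rfl⟩))
      Set.subset_union_right hx.1 hp hd (mem_Acore_of_notMem_Aperp hx.1 hperp)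
      fun h => hx.2 ⟨hx.1, h⟩
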